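/- Let $G$ be one of the following groups of unitary operators on a complex Hilbert space $H$: (i) $G=U(H)$ with $H$ finite dimensional (in particular $U(n)$, $H=\mathbb C^n$); (ii) $G=T=\mathbb T^n\subset U(n)$, the diagonal torus, $H=\mathbb C^n$; (iii) $G=U_p(H)$, $1\le p<\infty$, with $H$ infinite dimensional and separable: the Banach Lie group of unitary operators $g$ with $g-1$ in the Schatten ideal $\mathcal L_p(H)$, with the smooth structure given by $g\mapsto g-1\in\mathcal L_p(H)$. Order $U(1)\setminus\{1\}$ by $z_1>z_2$ iff $z_2$ can be rotated positively into $z_1$ without passing through $1$. Let $$Y=\{(z,g)\in U(1)\times G \mid z\notin \operatorname{spec}(g)\cup\{1\}\},\qquad \pi(z,g)=g ,$$ and let $Y^{[k]}$ be the $k$-fold fibre product of $Y$ over $G$, with points written $(z_1,\dots,z_k,g)$. Put $E_{(z_1,z_2,g)}=\bigoplus_{z_1>\lambda>z_2}\ker(g-\lambda)$, which is finite dimensional (and is $0$ if $z_1\le z_2$). Let $L\to Y^{[2]}$ be the smooth line bundle with fibre $\det E_{(z_1,z_2,g)}$ if $z_1>z_2$ and there are eigenvalues of $g$ between $z_2$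 and $z_1$, fibre $(\det E_{(z_2,z_1,g)})^*$ if $z_2>z_1$ and there are eigenvalues of $g$ between $z_1$ and $z_2$, and fibre $\mathbb C$ otherwise; its smooth local frames are the ones obtained from smooth local frames of the bundles $E$. Let $s$ be the section of $\delta(L)\to Y^{[3]}$, $\delta(L)_{(z_1,z_2,z_3,g)}=L_{(z_2,z_3,g)}\otimes L_{(z_1,z_3,g)}^*\otimes L_{(z_1,z_2,g)}$, which for $z_1\ge z_2\ge z_3$ is given by the wedge product $L_{(z_1,z_2,g)}\otimes L_{(z_2,z_3,g)}\to L_{(z_1,z_3,g)}$ and which is antisymmetric: under a permutation of the $z_i$ it goes to its $\pm1$ power according to the sign of the permutation, where $L_{(z_2,z_1,g)}=L_{(z_1,z_2,g)}^{*}$ and $v^{-1}\in V^*$ is the element dual to $0\ne v\in V$ when $\dim V=1$. There is exactly one such $s$. The pair $(L,Y)$, with $s$, is the basic bundle gerbe on $G$. Proposition. The basic bundle gerbe $(L,Y)$ is a $G$-equivariant bundle gerbe for the action of $G$ on itself by conjugation. That is: $(L,Y)$ is a bundle gerbe ($\pi$ is a surjective submersion, $L$ is a smooth line bundle on $Y^{[2]}$,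 and $s$ is a smooth nowhere vanishing section of $\delta(L)$ with $\delta(s)=1$, i.e. whose associated multiplication $L_{(z_1,z_2,g)}\otimes L_{(z_2,z_3,g)}\to L_{(z_1,z_3,g)}$ is associative); $G$ acts smoothly on $G$ by conjugation; and 1. $k\cdot(z,g)=(z,kgk^{-1})$ is a smooth action of $G$ on $Y$ for which $\pi$ is $G$-equivariant; 2. the maps $k\colon E_{(z_1,z_2,g)}\to E_{(z_1,z_2,kgk^{-1})}$ induce, on determinants and their duals, a smooth fibrewise linear action of $G$ on the total space of $L$ covering the induced action on $Y^{[2]}$, so that $L$ is a $G$-equivariant line bundle; 3. the section $s$ of $\delta(L)\to Y^{[3]}$ is $G$-equivariant for the induced actions. -/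

import Mathlib

open Filter Topology
open scoped ContDiff ENNReal InnerProductSpace

universe u v w

noncomputable section

/-! ### Smooth maps

A manifold is given here as a set `X` together with an injective map `c : X → W` into a normed
space, which identifies `X` with a submanifold of `W` (all the manifolds below arise in this way).
The topology of `X` is the one induced by `c`, and a map is smooth when it extends locally to a
smooth map on an open subset of `W`. -/

section Smooth

variable {X W F : Type*} [NormedAddCommGroup W] [NormedSpace ℝ W]
  [NormedAddCommGroup F] [NormedSpace ℝ F]

/-- The filter of neighbourhoods of `x` in the topology induced by `c`. -/
def nhdsVia (c : X → W) (x : X) : Filter X := comap c (𝓝 (c x))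

/-- `U` is open in the topology induced by `c`. -/
def IsOpenVia (c : X → W) (U : Set X) : Prop := ∀ x ∈ U, U ∈ nhdsVia c x

/-- `f` is smooth at `x`: near `x` it is the restriction of a smooth map on the ambient space.
A map into a manifold with coordinate map `c'` is tested after composition with `c'`. -/
def SmoothAt (c : X → W) (f : X → F) (x : X) : Prop :=
  ∃ f' : W → F, ContDiffAt ℝ ∞ f' (c x) ∧ ∀ᶠ x' in nhdsVia c x, f x' = f' (c x')

end Smooth

/-! ### Bundle gerbes -/

section FibreProducts

variable {M Y : Type*}

/-- The fibre product `Y^[2]`. -/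
def Fib2 (π : Y → M) : Type _ := {q : Y × Y // π q.1 = π q.2}

/-- The fibre product `Y^[3]`. -/
def Fib3 (π : Y → M) : Type _ := {t : Y × Y × Y // π t.1 = π t.2.1 ∧ π t.2.1 = π t.2.2}

/-- The fibre product `Y^[4]`. -/
def Fib4 (π : Y → M) : Type _ :=
  {t : Y × Y × Y × Y // π t.1 = π t.2.1 ∧ π t.2.1 = π t.2.2.1 ∧ π t.2.2.1 = π t.2.2.2}

variable {π : Y → M}

/-- `(y₁, y₂, y₃) ↦ (y₁, y₂)`. -/
def Fib3.p12 (t : Fib3 π) : Fib2 π := ⟨(t.1.1, t.1.2.1), t.2.1⟩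

/-- `(y₁, y₂, y₃) ↦ (y₂, y₃)`. -/
def Fib3.p23 (t : Fib3 π) : Fib2 π := ⟨(t.1.2.1, t.1.2.2), t.2.2⟩

/-- `(y₁, y₂, y₃) ↦ (y₁, y₃)`. -/
def Fib3.p13 (t : Fib3 π) : Fib2 π := ⟨(t.1.1, t.1.2.2), t.2.1.trans t.2.2⟩

/-- The permutation `(y₁, y₂, y₃) ↦ (y₂, y₁, y₃)`. -/
def Fib3.swap12 (t : Fib3 π) : Fib3 π :=
  ⟨(t.1.2.1, t.1.1, t.1.2.2), t.2.1.symm, t.2.1.trans t.2.2⟩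

/-- The permutation `(y₁, y₂, y₃) ↦ (y₁, y₃, y₂)`. -/
def Fib3.swap23 (t : Fib3 π) : Fib3 π :=
  ⟨(t.1.1, t.1.2.2, t.1.2.1), t.2.1.trans t.2.2, t.2.2.symm⟩

/-- `(y₁, y₂, y₃, y₄) ↦ (y₁, y₂, y₃)`. -/
def Fib4.p123 (t : Fib4 π) : Fib3 π := ⟨(t.1.1, t.1.2.1, t.1.2.2.1), t.2.1, t.2.2.1⟩

/-- `(y₁, y₂, y₃, y₄) ↦ (y₂, y₃, y₄)`. -/
def Fib4.p234 (t : Fib4 π) : Fib3 π := ⟨(t.1.2.1, t.1.2.2.1, t.1.2.2.2), t.2.2.1, t.2.2.2⟩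

/-- `(y₁, y₂, y₃, y₄) ↦ (y₁, y₂, y₄)`. -/
def Fib4.p124 (t : Fib4 π) : Fib3 π :=
  ⟨(t.1.1, t.1.2.1, t.1.2.2.2), t.2.1, t.2.2.1.trans t.2.2.2⟩

/-- `(y₁, y₂, y₃, y₄) ↦ (y₁, y₃, y₄)`. -/
def Fib4.p134 (t : Fib4 π) : Fib3 π :=
  ⟨(t.1.1, t.1.2.2.1, t.1.2.2.2), t.2.1.trans t.2.2.1, t.2.2.2⟩

/-- The coordinates on `Y^[2]` induced by those on `Y`. -/
def coord2 {W : Type*} (π : Y → M) (c : Y → W) (q : Fib2 π) : W × W := (c q.1.1, c q.1.2)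

/-- The coordinates on `Y^[3]` induced by those on `Y`. -/
def coord3 {W : Type*} (π : Y → M) (c : Y → W) (t : Fib3 π) : W × W × W :=
  (c t.1.1, c t.1.2.1, c t.1.2.2)

variable {K : Type*} [SMul K M] [SMul K Y]

/-- The action on `Y^[2]` induced by an action on `Y` covering an action on `M`. -/
def Fib2.smul (hπ : ∀ (k : K) (y : Y), π (k • y) = k • π y) (k : K) (q : Fib2 π) : Fib2 π :=
  ⟨(k • q.1.1, k • q.1.2), by
    show π (k • q.1.1) = π (k • q.1.2)
    rw [hπ, hπ, q.2]⟩

/-- The action on `Y^[3]` induced by an action on `Y` covering an action on `M`. -/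
def Fib3.smul (hπ : ∀ (k : K) (y : Y), π (k • y) = k • π y) (k : K) (t : Fib3 π) : Fib3 π :=
  ⟨(k • t.1.1, k • t.1.2.1, k • t.1.2.2), by
    show π (k • t.1.1) = π (k • t.1.2.1) ∧ π (k • t.1.2.1) = π (k • t.1.2.2)
    rw [hπ, hπ, hπ, t.2.1, t.2.2]
    exact ⟨rfl, rfl⟩⟩

end FibreProducts

/-- A line bundle with fibres `L x` is described by its smooth local frames (smooth nowhere
vanishing sections over open sets); `IsFrame U σ` says that `σ`, restricted to `U`, is one of them.
The conditions say that every fibre is a line, that there is a frame near every point, and that two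
frames differ by a smooth function, i.e. the local trivialisations form a smooth atlas. -/
structure IsSmoothLineBundle {X W : Type*} [NormedAddCommGroup W] [NormedSpace ℝ W] (c : X → W)
    (L : X → Type*) [∀ x, AddCommGroup (L x)] [∀ x, Module ℂ (L x)]
    (IsFrame : Set X → (∀ x, L x) → Prop) : Prop where
  rank_one : ∀ x, Module.finrank ℂ (L x) = 1
  isOpen : ∀ U σ, IsFrame U σ → IsOpenVia c U
  ne_zero : ∀ U σ, IsFrame U σ → ∀ x ∈ U, σ x ≠ 0
  exists_frame : ∀ x, ∃ U σ, x ∈ U ∧ IsFrame U σ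
  transition : ∀ U σ U' σ', IsFrame U σ → IsFrame U' σ' → ∃ t : X → ℂ,
    ∀ x ∈ U ∩ U', SmoothAt c t x ∧ σ' x = t x • σ x

/-- The data of a bundle gerbe `(L, Y)`: the map `Y → M`, the line bundle `L → Y^[2]` (fibres and
smooth local frames) and the section `s` of
`δ(L) = L_{(y₂, y₃)} ⊗ L_{(y₁, y₃)}^* ⊗ L_{(y₁, y₂)}`, written as the multiplication
`L_{(y₁, y₂)} ⊗ L_{(y₂, y₃)} → L_{(y₁, y₃)}`. -/
structure PreGerbe (M : Type u) (Y : Type v) where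
  π : Y → M
  L : Fib2 π → Type w
  [addCommGroup : ∀ q, AddCommGroup (L q)]
  [module : ∀ q, Module ℂ (L q)]
  IsFrame : Set (Fib2 π) → (∀ q, L q) → Prop
  s : ∀ t : Fib3 π, L t.p12 →ₗ[ℂ] L t.p23 →ₗ[ℂ] L t.p13

namespace PreGerbe

attribute [instance] PreGerbe.addCommGroup PreGerbe.module

variable {M : Type u} {Y : Type v} (D : PreGerbe.{u, v, w} M Y)

/-- `(L, Y)` is a bundle gerbe on `M`: `Y → M` is a surjective submersion (every point lies on a
smooth local section), `L` is a smooth line bundle, `s` is smooth and non-vanishing, and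
`δ(s) = 1`, i.e. the multiplication is associative. -/
structure IsBundleGerbe {WM WY : Type*} [NormedAddCommGroup WM] [NormedSpace ℝ WM]
    [NormedAddCommGroup WY] [NormedSpace ℝ WY] (cM : M → WM) (cY : Y → WY) : Prop where
  surjective : Function.Surjective D.π
  smooth : ∀ y, SmoothAt cY (fun y' => cM (D.π y')) y
  submersion : ∀ y, ∃ r : M → Y, r (D.π y) = y ∧
    ∀ᶠ m in nhdsVia cM (D.π y), D.π (r m) = m ∧ SmoothAt cM (fun m' => cY (r m')) m
  lineBundle : IsSmoothLineBundle (coord2 D.π cY) D.L D.IsFrame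
  s_ne_zero : ∀ t (a : D.L t.p12) (b : D.L t.p23), a ≠ 0 → b ≠ 0 → D.s t a b ≠ 0
  s_smooth : ∀ U₁ σ₁ U₂ σ₂ U₃ σ₃, D.IsFrame U₁ σ₁ → D.IsFrame U₂ σ₂ → D.IsFrame U₃ σ₃ →
    ∃ f : Fib3 D.π → ℂ, ∀ t : Fib3 D.π, t.p12 ∈ U₁ → t.p23 ∈ U₂ → t.p13 ∈ U₃ →
      SmoothAt (coord3 D.π cY) f t ∧ D.s t (σ₁ t.p12) (σ₂ t.p23) = f t • σ₃ t.p13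
  assoc : ∀ (t : Fib4 D.π) (a : D.L t.p123.p12) (b : D.L t.p123.p23) (c : D.L t.p234.p23),
    D.s t.p134 (D.s t.p123 a b) c = D.s t.p124 a (D.s t.p234 b c)

/-- `(L, Y)` is a `K`-equivariant bundle gerbe, for the given actions of `K` on `M` and `Y`
and the lift `act` to `L` of the induced action on `Y^[2]`: it is a bundle gerbe, the actions are
smooth, `π` is equivariant (`hπ`), `L` is an equivariant line bundle (the lift is fibrewise linear,
is an action of `K` on the total space, and is smooth), and `s` is equivariant. -/
structure IsEquivariant {K : Type*} [Group K] [MulAction K M] [MulAction K Y]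
    {WK WM WY : Type*} [NormedAddCommGroup WK] [NormedSpace ℝ WK]
    [NormedAddCommGroup WM] [NormedSpace ℝ WM] [NormedAddCommGroup WY] [NormedSpace ℝ WY]
    (cK : K → WK) (cM : M → WM) (cY : Y → WY)
    (hπ : ∀ (k : K) (y : Y), D.π (k • y) = k • D.π y)
    (act : ∀ (k : K) (q : Fib2 D.π), D.L q →ₗ[ℂ] D.L (q.smul hπ k)) : Prop where
  isBundleGerbe : D.IsBundleGerbe cM cY
  smooth_base : ∀ x : K × M,
    SmoothAt (fun x' : K × M => (cK x'.1, cM x'.2)) (fun x' => cM (x'.1 • x'.2)) x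
  smooth_total : ∀ x : K × Y,
    SmoothAt (fun x' : K × Y => (cK x'.1, cY x'.2)) (fun x' => cY (x'.1 • x'.2)) x
  act_one : ∀ (q : Fib2 D.π) (a : D.L q),
    (⟨q.smul hπ (1 : K), act 1 q a⟩ : Σ q, D.L q) = ⟨q, a⟩
  act_mul : ∀ (k k' : K) (q : Fib2 D.π) (a : D.L q),
    (⟨q.smul hπ (k * k'), act (k * k') q a⟩ : Σ q, D.L q) =
      ⟨(q.smul hπ k').smul hπ k, act k (q.smul hπ k') (act k' q a)⟩
  act_smooth : ∀ U σ U' σ', D.IsFrame U σ → D.IsFrame U' σ' →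
    ∃ f : K × Fib2 D.π → ℂ, ∀ x : K × Fib2 D.π, x.2 ∈ U → x.2.smul hπ x.1 ∈ U' →
      SmoothAt (fun x' : K × Fib2 D.π => (cK x'.1, coord2 D.π cY x'.2)) f x ∧
        act x.1 x.2 (σ x.2) = f x • σ' (x.2.smul hπ x.1)
  s_equivariant : ∀ (k : K) (t : Fib3 D.π) (a : D.L t.p12) (b : D.L t.p23),
    D.s (t.smul hπ k) (act k t.p12 a) (act k t.p23 b) = act k t.p13 (D.s t a b)

end PreGerbe

/-! ### The basic bundle gerbe -/

/-- The order on `U(1) ∖ {1}`: `z < w` when `z` can be rotated positively into `w` without passing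
through `1`. -/
def CircLT (z w : Circle) : Prop :=
  ∃ α β : ℝ, 0 < α ∧ α < β ∧ β < 2 * Real.pi ∧ z = Circle.exp α ∧ w = Circle.exp β

/-- The associated non-strict order. -/
def CircLE (z w : Circle) : Prop := CircLT z w ∨ z = w

section Basic

variable {H : Type u} [NormedAddCommGroup H] [InnerProductSpace ℂ H]

/-- The sum of the eigenspaces of `g` for the eigenvalues `λ` with `z₁ > λ > z₂`
(the zero space if `z₁ ≤ z₂`). -/
def eigenSum (z₁ z₂ : Circle) (g : H →L[ℂ] H) : Submodule ℂ H :=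
  ⨆ (μ : Circle) (_ : CircLT z₂ μ ∧ CircLT μ z₁),
    Module.End.eigenspace (g : H →ₗ[ℂ] H) (μ : ℂ)

/-- The top exterior power `det E` of a finite-dimensional subspace `E` of `H`, as a line in the
exterior algebra of `H`; `det 0` is the line of scalars. -/
def detLine (E : Submodule ℂ H) : Submodule ℂ (ExteriorAlgebra ℂ H) :=
  (E.map (ExteriorAlgebra.ι ℂ)) ^ Module.finrank ℂ E

variable [CompleteSpace H] (Γ : Subgroup (unitary (H →L[ℂ] H)))

/-- The operator on `H` underlying an element of the group `Γ`. -/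
abbrev toOp (g : Γ) : H →L[ℂ] H := ((g : unitary (H →L[ℂ] H)) : H →L[ℂ] H)

/-- The space `Y` of pairs `(z, g)` with `z ∈ U(1)` not in `spec(g) ∪ {1}`. -/
def BasicY : Type u :=
  {y : Circle × Γ // y.1 ≠ 1 ∧ (y.1 : ℂ) ∉ spectrum ℂ (toOp Γ y.2)}

variable {Γ}

/-- The component `z` of `(z, g) ∈ Y`. -/
def BasicY.z (y : BasicY Γ) : Circle := y.1.1

/-- The component `g` of `(z, g) ∈ Y`, which is also the projection to the group. -/
def BasicY.g (y : BasicY Γ) : Γ := y.1.2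

/-- The coordinates on `Y ⊆ U(1) × Γ` induced by coordinates `j` on `Γ`. -/
def BasicY.coord {V : Type*} (j : Γ → V) (y : BasicY Γ) : ℂ × V := ((y.z : ℂ), j y.g)

lemma toOp_conj (k : ConjAct Γ) (g : Γ) :
    toOp Γ (k • g) = toOp Γ (ConjAct.ofConjAct k) * toOp Γ g *
      toOp Γ (ConjAct.ofConjAct k)⁻¹ := by
  simp [ConjAct.smul_def, toOp]

lemma toOp_mul_inv (k : Γ) : toOp Γ k * toOp Γ k⁻¹ = 1 := by
  rw [← Submonoid.coe_mul, ← Subgroup.coe_mul, mul_inv_cancel]; rfl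

lemma toOp_inv_mul (k : Γ) : toOp Γ k⁻¹ * toOp Γ k = 1 := by
  rw [← Submonoid.coe_mul, ← Subgroup.coe_mul, inv_mul_cancel]; rfl

lemma spectrum_conj (k : ConjAct Γ) (g : Γ) :
    spectrum ℂ (toOp Γ (k • g)) = spectrum ℂ (toOp Γ g) := by
  rw [toOp_conj]
  let U : (H →L[ℂ] H)ˣ := ⟨toOp Γ (ConjAct.ofConjAct k), toOp Γ (ConjAct.ofConjAct k)⁻¹,
    toOp_mul_inv _, toOp_inv_mul _⟩
  exact spectrum.units_conjugate (u := U)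

@[ext] lemma BasicY.ext {y y' : BasicY Γ} (hz : y.z = y'.z) (hg : y.g = y'.g) : y = y' :=
  Subtype.ext (Prod.ext hz hg)

/-- `k · (z, g) = (z, k g k⁻¹)`. -/
def BasicY.conj (k : ConjAct Γ) (y : BasicY Γ) : BasicY Γ :=
  ⟨(y.z, k • y.g), y.2.1, fun h => y.2.2 ((spectrum_conj k y.g) ▸ h)⟩

lemma BasicY.z_conj (k : ConjAct Γ) (y : BasicY Γ) : (BasicY.conj k y).z = y.z := rfl

lemma BasicY.g_conj (k : ConjAct Γ) (y : BasicY Γ) : (BasicY.conj k y).g = k • y.g := rfl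

lemma BasicY.conj_one (y : BasicY Γ) : BasicY.conj 1 y = y := by
  apply BasicY.ext
  · rw [BasicY.z_conj]
  · rw [BasicY.g_conj, one_smul]

lemma BasicY.conj_mul (k k' : ConjAct Γ) (y : BasicY Γ) :
    BasicY.conj (k * k') y = BasicY.conj k (BasicY.conj k' y) := by
  apply BasicY.ext
  · rw [BasicY.z_conj, BasicY.z_conj, BasicY.z_conj]
  · rw [BasicY.g_conj, BasicY.g_conj, BasicY.g_conj, mul_smul]

/-- The action of `Γ` on `Y` given by `k · (z, g) = (z, k g k⁻¹)`. -/
instance BasicY.instMulAction : MulAction (ConjAct Γ) (BasicY Γ) where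
  smul := BasicY.conj
  one_smul := BasicY.conj_one
  mul_smul := BasicY.conj_mul

lemma BasicY.g_smul (k : ConjAct Γ) (y : BasicY Γ) : (k • y).g = k • y.g := rfl

variable (Γ)

/-- The space `Y^[2]`. -/
abbrev BasicY2 : Type u := Fib2 (BasicY.g : BasicY Γ → Γ)

/-- The space `Y^[3]`. -/
abbrev BasicY3 : Type u := Fib3 (BasicY.g : BasicY Γ → Γ)

variable {Γ}

/-- `det E_{(z₁, z₂, g)}` at the point `(z₁, z₂, g)` of `Y^[2]`. -/
def detPos (q : BasicY2 Γ) : Submodule ℂ (ExteriorAlgebra ℂ H) :=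
  detLine (eigenSum q.1.1.z q.1.2.z (toOp Γ q.1.1.g))

/-- `det E_{(z₂, z₁, g)}` at the point `(z₁, z₂, g)` of `Y^[2]`. -/
def detNeg (q : BasicY2 Γ) : Submodule ℂ (ExteriorAlgebra ℂ H) :=
  detLine (eigenSum q.1.2.z q.1.1.z (toOp Γ q.1.1.g))

/-- The line `L_{(z₁, z₂, g)}`. At every point at least one of `E_{(z₁, z₂, g)}` and
`E_{(z₂, z₁, g)}` is zero, with `det 0 = ℂ`. So this is `Hom(ℂ, det E_{(z₁, z₂, g)})`, i.e.
`det E_{(z₁, z₂, g)}`, at positive points, `Hom(ℂ, ℂ) = ℂ` at null points, and the dual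
`(det E_{(z₂, z₁, g)})^*` at negative points. -/
abbrev BasicL (q : BasicY2 Γ) : Type u := detNeg q →ₗ[ℂ] detPos q

/-- The smooth local frames of `L`: if `u` and `w` are smooth local frames of the vector bundles
`E_{(z₁, z₂, g)}` and `E_{(z₂, z₁, g)}` (of which at least one is zero) over an open set, then the
section of `L` that sends `w₁ ∧ ⋯ ∧ w_e` to `u₁ ∧ ⋯ ∧ u_d` is a smooth local frame. -/
def IsBasicFrame {V : Type*} [NormedAddCommGroup V] [NormedSpace ℝ V] (j : Γ → V)
    (U : Set (BasicY2 Γ)) (σ : ∀ q : BasicY2 Γ, BasicL q) : Prop :=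
  IsOpenVia (coord2 BasicY.g (BasicY.coord j)) U ∧
  ∃ (d e : ℕ) (u : Fin d → BasicY2 Γ → H) (w : Fin e → BasicY2 Γ → H), ∀ q ∈ U,
    (∀ i, SmoothAt (coord2 BasicY.g (BasicY.coord j)) (u i) q) ∧
    (∀ i, SmoothAt (coord2 BasicY.g (BasicY.coord j)) (w i) q) ∧
    LinearIndependent ℂ (fun i => u i q) ∧
    Submodule.span ℂ (Set.range fun i => u i q) =
      eigenSum q.1.1.z q.1.2.z (toOp Γ q.1.1.g) ∧
    LinearIndependent ℂ (fun i => w i q) ∧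
    Submodule.span ℂ (Set.range fun i => w i q) =
      eigenSum q.1.2.z q.1.1.z (toOp Γ q.1.1.g) ∧
    ∀ x : detNeg q, (x : ExteriorAlgebra ℂ H) = ExteriorAlgebra.ιMulti ℂ e (fun i => w i q) →
      (σ q x : ExteriorAlgebra ℂ H) = ExteriorAlgebra.ιMulti ℂ d (fun i => u i q)

/-- `a' = a⁻¹` under the identification of `L_{(z₂, z₁, g)}` with the dual of `L_{(z₁, z₂, g)}`:
since both are spaces of linear maps, in opposite directions, between the same two lines, this
means that `a' ∘ a` is the identity. -/
def IsInvElt {A B A' B' : Submodule ℂ (ExteriorAlgebra ℂ H)}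
    (a : A →ₗ[ℂ] B) (a' : B' →ₗ[ℂ] A') : Prop :=
  ∀ (x : A) (y : B'), (y : ExteriorAlgebra ℂ H) = a x → (a' y : ExteriorAlgebra ℂ H) = x

/-- The defining properties of the section `s` of `δ(L)` of the basic bundle gerbe: for
`z₁ ≥ z₂ ≥ z₃` it is given by the wedge product
`det E_{(z₁, z₂, g)} ⊗ det E_{(z₂, z₃, g)} → det E_{(z₁, z₃, g)}`, and it is antisymmetric under
permutations of `z₁, z₂, z₃`. In terms of the multiplication, for non-zero `a`, `b` with product
`c = a b` the section is `s(y₁, y₂, y₃) = b ⊗ c⁻¹ ⊗ a`, so that antisymmetry under the transposition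
of `y₁, y₂` reads `a⁻¹ c = b`, and under that of `y₂, y₃` it reads `c b⁻¹ = a`. -/
structure IsBasicSection
    (s : ∀ t : BasicY3 Γ, BasicL t.p12 →ₗ[ℂ] BasicL t.p23 →ₗ[ℂ] BasicL t.p13) : Prop where
  wedge : ∀ t : BasicY3 Γ, CircLE t.1.2.1.z t.1.1.z → CircLE t.1.2.2.z t.1.2.1.z →
    ∀ (a : BasicL t.p12) (b : BasicL t.p23)
      (x : detNeg t.p12) (y : detNeg t.p23) (r : detNeg t.p13),
      (x : ExteriorAlgebra ℂ H) = 1 → (y : ExteriorAlgebra ℂ H) = 1 →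
      (r : ExteriorAlgebra ℂ H) = 1 →
      (s t a b r : ExteriorAlgebra ℂ H) = (a x : ExteriorAlgebra ℂ H) * b y
  antisymm12 : ∀ (t : BasicY3 Γ) (a : BasicL t.p12) (b : BasicL t.p23)
    (a' : BasicL t.swap12.p12), IsInvElt a a' → s t.swap12 a' (s t a b) = b
  antisymm23 : ∀ (t : BasicY3 Γ) (a : BasicL t.p12) (b : BasicL t.p23)
    (b' : BasicL t.swap23.p23), IsInvElt b b' → s t.swap23 (s t a b) b' = a

/-- The basic bundle gerbe on `Γ` (the smooth structure of `Γ` being given by the coordinates `j`)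
with section `s`. -/
def basicGerbe {V : Type*} [NormedAddCommGroup V] [NormedSpace ℝ V] (j : Γ → V)
    (s : ∀ t : BasicY3 Γ, BasicL t.p12 →ₗ[ℂ] BasicL t.p23 →ₗ[ℂ] BasicL t.p13) :
    PreGerbe.{u, u, u} Γ (BasicY Γ) where
  π := BasicY.g
  L := BasicL
  IsFrame := IsBasicFrame j
  s := s

/-- The automorphism of the exterior algebra of `H` induced by `k`. -/
def extMap (k : Γ) : ExteriorAlgebra ℂ H →ₐ[ℂ] ExteriorAlgebra ℂ H :=
  ExteriorAlgebra.map (toOp Γ k : H →ₗ[ℂ] H)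

lemma eigenSum_conj (k : ConjAct Γ) (z₁ z₂ : Circle) (g : Γ) :
    (eigenSum z₁ z₂ (toOp Γ g)).map (toOp Γ (ConjAct.ofConjAct k) : H →ₗ[ℂ] H) ≤
      eigenSum z₁ z₂ (toOp Γ (k • g)) := by
  unfold eigenSum
  simp only [Submodule.map_iSup]
  refine iSup_mono fun μ => iSup_mono fun _ => ?_
  rintro _ ⟨v, hv, rfl⟩
  have hv' : toOp Γ g v = (μ : ℂ) • v := Module.End.mem_eigenspace_iff.1 hv
  refine Module.End.mem_eigenspace_iff.2 ?_
  show toOp Γ (k • g) (toOp Γ (ConjAct.ofConjAct k) v) =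
    (μ : ℂ) • toOp Γ (ConjAct.ofConjAct k) v
  have h1 : toOp Γ (ConjAct.ofConjAct k)⁻¹ (toOp Γ (ConjAct.ofConjAct k) v) = v :=
    congrArg (fun T : H →L[ℂ] H => T v) (toOp_inv_mul (ConjAct.ofConjAct k))
  rw [toOp_conj, mul_apply_eq_comp, mul_apply_eq_comp, h1, hv', map_smul]

lemma eigenSum_conj_eq (k : ConjAct Γ) (z₁ z₂ : Circle) (g : Γ) :
    (eigenSum z₁ z₂ (toOp Γ g)).map (toOp Γ (ConjAct.ofConjAct k) : H →ₗ[ℂ] H) =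
      eigenSum z₁ z₂ (toOp Γ (k • g)) := by
  refine le_antisymm (eigenSum_conj k z₁ z₂ g) fun v hv => ?_
  have h := eigenSum_conj k⁻¹ z₁ z₂ (k • g)
  rw [inv_smul_smul] at h
  refine ⟨_, h ⟨v, hv, rfl⟩, ?_⟩
  exact congrArg (fun T : H →L[ℂ] H => T v) (toOp_mul_inv (ConjAct.ofConjAct k))

lemma extMap_mem (k : ConjAct Γ) (z₁ z₂ : Circle) (g : Γ) {x : ExteriorAlgebra ℂ H}
    (hx : x ∈ detLine (eigenSum z₁ z₂ (toOp Γ g))) :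
    extMap (ConjAct.ofConjAct k) x ∈ detLine (eigenSum z₁ z₂ (toOp Γ (k • g))) := by
  have hinj : Function.Injective (toOp Γ (ConjAct.ofConjAct k) : H →ₗ[ℂ] H) := fun v w h => by
    have h' := congrArg (toOp Γ (ConjAct.ofConjAct k)⁻¹) h
    have e : ∀ v, toOp Γ (ConjAct.ofConjAct k)⁻¹ (toOp Γ (ConjAct.ofConjAct k) v) = v := fun v =>
      congrArg (fun T : H →L[ℂ] H => T v) (toOp_inv_mul (ConjAct.ofConjAct k))
    exact (e v).symm.trans (h'.trans (e w))
  unfold detLine at hx ⊢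
  rw [← eigenSum_conj_eq, ← (Submodule.equivMapOfInjective _ hinj _).finrank_eq]
  have h := Submodule.mem_map_of_mem (f := (extMap (ConjAct.ofConjAct k)).toLinearMap) hx
  rw [Submodule.map_pow, ← Submodule.map_comp] at h
  rw [← Submodule.map_comp]
  have hc : (extMap (ConjAct.ofConjAct k)).toLinearMap ∘ₗ ExteriorAlgebra.ι ℂ =
      ExteriorAlgebra.ι ℂ ∘ₗ (toOp Γ (ConjAct.ofConjAct k) : H →ₗ[ℂ] H) :=
    LinearMap.ext fun v => ExteriorAlgebra.map_apply_ι _ v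
  rw [hc] at h
  exact h

lemma extMap_inv_mem (k : ConjAct Γ) (z₁ z₂ : Circle) (g : Γ) {x : ExteriorAlgebra ℂ H}
    (hx : x ∈ detLine (eigenSum z₁ z₂ (toOp Γ (k • g)))) :
    extMap (ConjAct.ofConjAct k)⁻¹ x ∈ detLine (eigenSum z₁ z₂ (toOp Γ g)) := by
  have h := extMap_mem k⁻¹ z₁ z₂ (k • g) hx
  rwa [inv_smul_smul] at h

/-- The map `L_{(z₁, z₂, g)} → L_{(z₁, z₂, k g k⁻¹)}` induced by
`k : E_{(z₁, z₂, g)} → E_{(z₁, z₂, k g k⁻¹)}` on determinants, and dually. -/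
def basicAct (k : ConjAct Γ) (q : BasicY2 Γ) :
    BasicL q →ₗ[ℂ] BasicL (q.smul BasicY.g_smul k) where
  toFun a :=
    ((extMap (ConjAct.ofConjAct k)).toLinearMap.restrict
      (p := detPos q) (q := detPos (q.smul BasicY.g_smul k))
      (fun _ hx => extMap_mem k _ _ _ hx)) ∘ₗ a ∘ₗ
    ((extMap (ConjAct.ofConjAct k)⁻¹).toLinearMap.restrict
      (p := detNeg (q.smul BasicY.g_smul k)) (q := detNeg q)
      (fun _ hx => extMap_inv_mem k _ _ _ hx))
  map_add' a b := by ext x; simp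
  map_smul' r a := by ext x; simp

end Basic

/-! ### The unitary groups -/

section Groups

variable (H : Type u) [NormedAddCommGroup H] [InnerProductSpace ℂ H]

/-- The group `U(H)` of all unitary operators. -/
abbrev fullUnitary [CompleteSpace H] : Subgroup (unitary (H →L[ℂ] H)) := ⊤

/-- The coordinates on `U(H)` as a submanifold of `B(H)`. -/
def fullUnitary.coord [CompleteSpace H] (g : fullUnitary H) : H →L[ℂ] H :=
  toOp (fullUnitary H) g

/-- The diagonal torus `𝕋ⁿ ⊆ U(n)`. -/
def diagTorus (n : ℕ) : Subgroup (unitary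
    (EuclideanSpace ℂ (Fin n) →L[ℂ] EuclideanSpace ℂ (Fin n))) where
  carrier := {g | ∃ d : Fin n → Circle, ∀ x i,
    (g : EuclideanSpace ℂ (Fin n) →L[ℂ] EuclideanSpace ℂ (Fin n)) x i = (d i : ℂ) * x i}
  one_mem' := ⟨1, fun x i => by simp⟩
  mul_mem' := by
    rintro g g' ⟨d, hd⟩ ⟨d', hd'⟩
    refine ⟨d * d', fun x i => ?_⟩
    rw [Submonoid.coe_mul, mul_apply_eq_comp, hd, hd', Pi.mul_apply, Circle.coe_mul, mul_assoc]
  inv_mem' := by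
    rintro g ⟨d, hd⟩
    refine ⟨d⁻¹, fun x i => ?_⟩
    have h : (g : EuclideanSpace ℂ (Fin n) →L[ℂ] EuclideanSpace ℂ (Fin n))
        (((g⁻¹ : unitary _) : EuclideanSpace ℂ (Fin n) →L[ℂ] EuclideanSpace ℂ (Fin n)) x) = x := by
      rw [← mul_apply_eq_comp, ← Submonoid.coe_mul, mul_inv_cancel]; rfl
    have h' := hd (((g⁻¹ : unitary _) :
      EuclideanSpace ℂ (Fin n) →L[ℂ] EuclideanSpace ℂ (Fin n)) x) i
    rw [h] at h'
    rw [h', Pi.inv_apply, Circle.coe_inv, inv_mul_cancel_left₀ (Circle.coe_ne_zero _)]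

/-- The coordinates on the diagonal torus as a submanifold of the operators on `ℂⁿ`. -/
def diagTorus.coord (n : ℕ) (g : diagTorus n) :
    EuclideanSpace ℂ (Fin n) →L[ℂ] EuclideanSpace ℂ (Fin n) :=
  toOp (diagTorus n) g

variable {H}

/-- The Schatten norm `‖A‖_p`, `p ≥ 1`, with values in `[0, ∞]`: the supremum of
`(∑ |⟨f_i, A e_i⟩| ^ p) ^ (1 / p)` over all pairs of finite orthonormal families of equal length
(this is equal to the `ℓ^p` norm of the sequence of singular values). -/
def schattenENorm (p : ℝ) (A : H →L[ℂ] H) : ℝ≥0∞ :=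
  ⨆ (n : ℕ) (e : Fin n → H) (f : Fin n → H) (_ : Orthonormal ℂ e) (_ : Orthonormal ℂ f),
    (∑ i, ‖⟪f i, A (e i)⟫_ℂ‖ₑ ^ p) ^ (1 / p)

lemma le_schattenENorm (p : ℝ) (A : H →L[ℂ] H) {n : ℕ} {e f : Fin n → H}
    (he : Orthonormal ℂ e) (hf : Orthonormal ℂ f) :
    (∑ i, ‖⟪f i, A (e i)⟫_ℂ‖ₑ ^ p) ^ (1 / p) ≤ schattenENorm p A :=
  le_iSup_of_le n <| le_iSup_of_le e <| le_iSup_of_le f <| le_iSup_of_le he <|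
    le_iSup_of_le hf le_rfl

lemma schattenENorm_le {p : ℝ} {A : H →L[ℂ] H} {c : ℝ≥0∞}
    (h : ∀ (n : ℕ) (e f : Fin n → H), Orthonormal ℂ e → Orthonormal ℂ f →
      (∑ i, ‖⟪f i, A (e i)⟫_ℂ‖ₑ ^ p) ^ (1 / p) ≤ c) : schattenENorm p A ≤ c :=
  iSup_le fun n => iSup_le fun e => iSup_le fun f => iSup_le fun he => iSup_le fun hf =>
    h n e f he hf

lemma schattenENorm_zero {p : ℝ} (hp : 1 ≤ p) : schattenENorm p (0 : H →L[ℂ] H) = 0 := by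
  refine le_antisymm (schattenENorm_le fun n e f _ _ => ?_) zero_le
  have h0 : 0 < p := by linarith
  simp [ENNReal.zero_rpow_of_pos h0, h0]

lemma schattenENorm_add {p : ℝ} (hp : 1 ≤ p) (A B : H →L[ℂ] H) :
    schattenENorm p (A + B) ≤ schattenENorm p A + schattenENorm p B := by
  refine schattenENorm_le fun n e f he hf => ?_
  refine le_trans ?_ (add_le_add (le_schattenENorm p A he hf) (le_schattenENorm p B he hf))
  refine le_trans ?_ (ENNReal.Lp_add_le Finset.univ _ _ hp)
  have h0 : 0 ≤ p := by linarith
  refine ENNReal.rpow_le_rpow (Finset.sum_le_sum fun i _ => ENNReal.rpow_le_rpow ?_ h0)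
    (by positivity)
  rw [add_apply, inner_add_right]
  exact enorm_add_le _ _

lemma schattenENorm_smul_le {p : ℝ} (hp : 1 ≤ p) (c : ℂ) (A : H →L[ℂ] H) :
    schattenENorm p (c • A) ≤ ‖c‖ₑ * schattenENorm p A := by
  refine schattenENorm_le fun n e f he hf => ?_
  have h0 : 0 < p := by linarith
  refine le_trans (le_of_eq ?_) (mul_le_mul_right (le_schattenENorm p A he hf) ‖c‖ₑ)
  simp_rw [smul_apply, inner_smul_right, enorm_mul,
    ENNReal.mul_rpow_of_nonneg _ _ h0.le]
  rw [← Finset.mul_sum, ENNReal.mul_rpow_of_nonneg _ _ (by positivity), ← ENNReal.rpow_mul,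
    mul_one_div_cancel h0.ne', ENNReal.rpow_one]

lemma schattenENorm_smul {p : ℝ} (hp : 1 ≤ p) (c : ℂ) (A : H →L[ℂ] H) :
    schattenENorm p (c • A) = ‖c‖ₑ * schattenENorm p A := by
  refine le_antisymm (schattenENorm_smul_le hp c A) ?_
  rcases eq_or_ne c 0 with rfl | hc
  · simp
  have h := schattenENorm_smul_le hp c⁻¹ (c • A)
  rw [inv_smul_smul₀ hc] at h
  have hc' : ‖c‖ₑ ≠ 0 := by simpa using hc
  calc ‖c‖ₑ * schattenENorm p A ≤ ‖c‖ₑ * (‖c⁻¹‖ₑ * schattenENorm p (c • A)) :=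
        mul_le_mul_right h _
    _ = schattenENorm p (c • A) := by
        rw [← mul_assoc, enorm_inv hc, ENNReal.mul_inv_cancel hc' enorm_ne_top, one_mul]

lemma eq_zero_of_schattenENorm {p : ℝ} (hp : 1 ≤ p) {A : H →L[ℂ] H}
    (h : schattenENorm p A = 0) : A = 0 := by
  have h0 : 0 < p := by linarith
  by_contra hA
  obtain ⟨v, hv⟩ : ∃ v, A v ≠ 0 := by
    by_contra! hc
    exact hA (ContinuousLinearMap.ext hc)
  have hv0 : v ≠ 0 := fun hc => hv (by rw [hc, map_zero])
  have on : ∀ w : H, w ≠ 0 → Orthonormal ℂ (fun _ : Fin 1 => ((‖w‖⁻¹ : ℝ) : ℂ) • w) := by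
    intro w hw
    refine ⟨fun i => ?_, fun i j hij => absurd (Subsingleton.elim i j) hij⟩
    rw [norm_smul, Complex.norm_real, norm_inv, norm_norm, inv_mul_cancel₀ (norm_ne_zero_iff.2 hw)]
  have h1 := le_schattenENorm p A (on v hv0) (on (A v) hv)
  rw [h, nonpos_iff_eq_zero] at h1
  have hne : ⟪((‖A v‖⁻¹ : ℝ) : ℂ) • A v, A (((‖v‖⁻¹ : ℝ) : ℂ) • v)⟫_ℂ ≠ 0 := by
    rw [map_smul, inner_smul_left, inner_smul_right]
    refine mul_ne_zero ?_ (mul_ne_zero ?_ (inner_self_ne_zero.2 hv))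
    · simpa using hv
    · simpa using hv0
  simp only [Finset.univ_unique, Finset.sum_singleton, ← ENNReal.rpow_mul,
    mul_one_div_cancel h0.ne', ENNReal.rpow_one, enorm_eq_zero] at h1
  exact hne h1

lemma schattenENorm_mul_unitary [CompleteSpace H] (p : ℝ) (A : H →L[ℂ] H)
    (g : unitary (H →L[ℂ] H)) : schattenENorm p (A * (g : H →L[ℂ] H)) ≤ schattenENorm p A := by
  refine schattenENorm_le fun n e f he hf => ?_
  refine le_schattenENorm p A (e := fun i => (g : H →L[ℂ] H) (e i)) ?_ hf
  exact he.comp_linearIsometryEquiv (Unitary.linearIsometryEquiv g)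

lemma schattenENorm_unitary_mul [CompleteSpace H] (p : ℝ) (A : H →L[ℂ] H)
    (g : unitary (H →L[ℂ] H)) : schattenENorm p ((g : H →L[ℂ] H) * A) ≤ schattenENorm p A := by
  refine schattenENorm_le fun n e f he hf => ?_
  have hf' : Orthonormal ℂ (fun i => ((g⁻¹ : unitary (H →L[ℂ] H)) : H →L[ℂ] H) (f i)) :=
    hf.comp_linearIsometryEquiv (Unitary.linearIsometryEquiv g⁻¹)
  refine le_trans (le_of_eq ?_) (le_schattenENorm p A he hf')
  congr 2
  funext i
  have : ⟪((g⁻¹ : unitary (H →L[ℂ] H)) : H →L[ℂ] H) (f i), A (e i)⟫_ℂ =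
      ⟪f i, ((g : H →L[ℂ] H) * A) (e i)⟫_ℂ := by
    show ⟪(ContinuousLinearMap.adjoint (g : H →L[ℂ] H)) (f i), A (e i)⟫_ℂ = _
    rw [ContinuousLinearMap.adjoint_inner_left, mul_apply_eq_comp]
  rw [this]

variable (H)

/-- The Schatten ideal `ℒ_p(H)` as a space of bounded operators. -/
def schattenSubmodule (p : ℝ) [Fact (1 ≤ p)] : Submodule ℂ (H →L[ℂ] H) where
  carrier := {A | schattenENorm p A < ⊤}
  zero_mem' := by
    show schattenENorm p (0 : H →L[ℂ] H) < ⊤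
    rw [schattenENorm_zero Fact.out]; exact ENNReal.zero_lt_top
  add_mem' hA hB := lt_of_le_of_lt (schattenENorm_add Fact.out _ _) (ENNReal.add_lt_top.2 ⟨hA, hB⟩)
  smul_mem' c A hA := by
    show schattenENorm p (c • A) < ⊤
    rw [schattenENorm_smul Fact.out]; exact ENNReal.mul_lt_top enorm_lt_top hA

lemma mem_schattenSubmodule {p : ℝ} [Fact (1 ≤ p)] {A : H →L[ℂ] H} :
    A ∈ schattenSubmodule H p ↔ schattenENorm p A < ⊤ := Iff.rfl

/-- The Schatten ideal `ℒ_p(H)`, with the Schatten norm. -/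
def SchattenClass (p : ℝ) [Fact (1 ≤ p)] : Type u := schattenSubmodule H p

instance (p : ℝ) [Fact (1 ≤ p)] : AddCommGroup (SchattenClass H p) :=
  inferInstanceAs (AddCommGroup (schattenSubmodule H p))

instance (p : ℝ) [Fact (1 ≤ p)] : Module ℂ (SchattenClass H p) :=
  inferInstanceAs (Module ℂ (schattenSubmodule H p))

instance (p : ℝ) [Fact (1 ≤ p)] : NormedAddCommGroup (SchattenClass H p) :=
  AddGroupNorm.toNormedAddCommGroup
    { toFun := fun A => (schattenENorm p A.1).toReal
      map_zero' := by
        show (schattenENorm p (0 : H →L[ℂ] H)).toReal = 0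
        rw [schattenENorm_zero Fact.out, ENNReal.toReal_zero]
      add_le' := fun A B => by
        have hA := ((mem_schattenSubmodule H).1 A.2).ne
        have hB := ((mem_schattenSubmodule H).1 B.2).ne
        rw [← ENNReal.toReal_add hA hB]
        exact ENNReal.toReal_mono (ENNReal.add_ne_top.2 ⟨hA, hB⟩)
          (schattenENorm_add Fact.out A.1 B.1)
      neg' := fun A => by
        show (schattenENorm p (-A.1)).toReal = (schattenENorm p A.1).toReal
        rw [← neg_one_smul ℂ A.1, schattenENorm_smul Fact.out]
        simp
      eq_zero_of_map_eq_zero' := fun A hA =>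
        Subtype.ext (eq_zero_of_schattenENorm (p := p) Fact.out
          (((ENNReal.toReal_eq_zero_iff _).1 hA).resolve_right
            ((mem_schattenSubmodule H).1 A.2).ne)) }

instance (p : ℝ) [Fact (1 ≤ p)] : NormedSpace ℂ (SchattenClass H p) where
  norm_smul_le c A := by
    show (schattenENorm p (c • A.1)).toReal ≤ ‖c‖ * (schattenENorm p A.1).toReal
    rw [schattenENorm_smul Fact.out, ENNReal.toReal_mul, toReal_enorm]

/-- The group `U_p(H)` of unitary operators that differ from the identity by an element of the
Schatten ideal `ℒ_p(H)`. -/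
def schattenUnitary [CompleteSpace H] (p : ℝ) [Fact (1 ≤ p)] :
    Subgroup (unitary (H →L[ℂ] H)) where
  carrier := {g | (g : H →L[ℂ] H) - 1 ∈ schattenSubmodule H p}
  one_mem' := by
    show (1 : H →L[ℂ] H) - 1 ∈ schattenSubmodule H p
    rw [sub_self]; exact zero_mem _
  mul_mem' := by
    intro g h hg hh
    show (g : H →L[ℂ] H) * (h : H →L[ℂ] H) - 1 ∈ schattenSubmodule H p
    have e : (g : H →L[ℂ] H) * (h : H →L[ℂ] H) - 1 =
        ((g : H →L[ℂ] H) - 1) * (h : H →L[ℂ] H) + ((h : H →L[ℂ] H) - 1) := by noncomm_ring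
    rw [e]
    exact add_mem ((mem_schattenSubmodule H).2
      (lt_of_le_of_lt (schattenENorm_mul_unitary p _ h) ((mem_schattenSubmodule H).1 hg))) hh
  inv_mem' := by
    intro g hg
    show ((g⁻¹ : unitary (H →L[ℂ] H)) : H →L[ℂ] H) - 1 ∈ schattenSubmodule H p
    have hu : ((g⁻¹ : unitary (H →L[ℂ] H)) : H →L[ℂ] H) * (g : H →L[ℂ] H) = 1 := by
      rw [← Submonoid.coe_mul, inv_mul_cancel]; rfl
    have e : ((g⁻¹ : unitary (H →L[ℂ] H)) : H →L[ℂ] H) - 1 =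
        -(((g⁻¹ : unitary (H →L[ℂ] H)) : H →L[ℂ] H) * ((g : H →L[ℂ] H) - 1)) := by
      rw [mul_sub, hu, mul_one, neg_sub]
    rw [e]
    exact neg_mem ((mem_schattenSubmodule H).2
      (lt_of_le_of_lt (schattenENorm_unitary_mul p _ g⁻¹) ((mem_schattenSubmodule H).1 hg)))

/-- The coordinates on `U_p(H)` as a submanifold of `1 + ℒ_p(H)`: `g ↦ g - 1`. -/
def schattenUnitary.coord [CompleteSpace H] (p : ℝ) [Fact (1 ≤ p)] (g : schattenUnitary H p) :
    SchattenClass H p :=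
  ⟨toOp (schattenUnitary H p) g - 1, g.2⟩

end Groups

/-- The basic bundle gerbe on `Γ` is well defined (there is exactly one section `s` with the
defining properties) and, with the action of `Γ` on `Y` and on `L` induced by conjugation on `Γ`
and by the given representation on `H`, it is an equivariant bundle gerbe for the action of
`Γ` on itself by conjugation. -/
def BasicGerbeEquivariant {H : Type u} [NormedAddCommGroup H] [InnerProductSpace ℂ H]
    [CompleteSpace H] (Γ : Subgroup (unitary (H →L[ℂ] H))) {V : Type*} [NormedAddCommGroup V]
    [NormedSpace ℝ V] (j : Γ → V) : Prop :=
  ∃ s : ∀ t : BasicY3 Γ, BasicL t.p12 →ₗ[ℂ] BasicL t.p23 →ₗ[ℂ] BasicL t.p13,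
    IsBasicSection s ∧ (∀ s', IsBasicSection s' → s' = s) ∧
    (basicGerbe j s).IsEquivariant (K := ConjAct Γ) (fun k => j (ConjAct.ofConjAct k)) j
      (BasicY.coord j) BasicY.g_smul basicAct

end

/-! ### Determinant lines in the exterior algebra -/

section DetLine

open ExteriorAlgebra

variable {H : Type*} [NormedAddCommGroup H] [InnerProductSpace ℂ H]

/-! Everything takes place in the exterior algebra of H. A fibre of L is Hom(det E_(z₂,z₁), det
E_(z₁,z₂)), where at least one of the two lines is ℂ, so that positive, null and negative points are
treated alike. The product c = a b is encoded by a single equation, `IsBasicMul`: ± a(x) b(y) r = ±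
c(r) y x for all x, y, r in the source lines of a, b, c. The Koszul signs are trivial unless z₁ lies
between z₂ and z₃.

Compatible generators θ of the determinant lines, multiplicative along decreasing z, satisfy this
equation in all six orders of the zᵢ (`IsGeneratorSystem.relation`). Hence it has exactly one
solution c, bilinear in a and b (`exists_mulRel`). For decreasing z it is the wedge product, and it
is stable under transposing points and inverting elements (`IsBasicMul.swap12`,
`IsBasicMul.swap23`); since the transpositions generate the symmetric group, it defines the unique
section s. In terms of the generators the product reads e₁₂ e₂₃ = e₁₃, which gives associativity. A
unitary operator induces an algebra automorphism of the exterior algebra, which preserves the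
equation; this gives equivariance.

Smoothness rests on Riesz projections. An arc avoiding 1 is cut out of the circle by a disc, and the
projection P_T of that disc depends smoothly on T as long as the bounding circle avoids the
spectrum. If T is unitary and T - 1 is compact, then P_T is compact and fixes E; since the
eigenvectors of T are dense, its range is E. So E is finite dimensional, and P_T applied to a basis
at T₀ is a smooth frame near T₀ (`exists_smooth_eigenframe`). Transition functions, the coefficient
of s and that of the action are then built from quotients of Gram determinants.

The groups enter only through `IsSmoothRealization`: g - 1 is compact, g is affine in the
coordinates, and conjugation extends to a smooth map of the coordinates. For the Schatten groups
this requires that ℒ_p is an ideal of compact operators with continuous multiplications by bounded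
operators. -/

/-- The alternating form `v' ↦ det ⟨v k, v' i⟩`. -/
noncomputable def gramForm {n : ℕ} (v : Fin n → H) : H [⋀^Fin n]→ₗ[ℂ] ℂ :=
  Matrix.detRowAlternating.compLinearMap (LinearMap.pi fun k => innerₛₗ ℂ (v k))

lemma gramForm_apply {n : ℕ} (v v' : Fin n → H) :
    gramForm v v' = (Matrix.of fun i k => ⟪v k, v' i⟫_ℂ).det := rfl

lemma gramForm_self_ne_zero {n : ℕ} {v : Fin n → H} (hv : LinearIndependent ℂ v) :
    gramForm v v ≠ 0 := by
  have h := Matrix.det_gram_ne_zero_iff_linearIndependent.2 hv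
  -- `gramForm` carries its free argument along the rows, so its matrix is the transpose of the Gram
  -- matrix.
  rw [← Matrix.det_transpose] at h
  exact h

/-- The linear functional on the exterior algebra that vanishes in degrees other than `n` and is
given by `gramForm v` in degree `n`. -/
noncomputable def gramFunctional {n : ℕ} (v : Fin n → H) : ExteriorAlgebra ℂ H →ₗ[ℂ] ℂ :=
  liftAlternating (R := ℂ) (Pi.single n (gramForm v))

lemma gramFunctional_ιMulti {n : ℕ} (v v' : Fin n → H) :
    gramFunctional v (ιMulti ℂ n v') = gramForm v v' := by
  rw [gramFunctional, liftAlternating_apply_ιMulti, Pi.single_eq_same]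

lemma gramFunctional_ιMulti_of_ne {m n : ℕ} (h : m ≠ n) (v : Fin n → H) (v' : Fin m → H) :
    gramFunctional v (ιMulti ℂ m v') = 0 := by
  rw [gramFunctional, liftAlternating_apply_ιMulti, Pi.single_eq_of_ne h]; rfl

/-- The wedge is detected by the functional `gramFunctional v`, whose value on it is the Gram
determinant. -/
lemma ιMulti_ne_zero {n : ℕ} {v : Fin n → H} (hv : LinearIndependent ℂ v) :
    ιMulti ℂ n v ≠ 0 := fun h => gramForm_self_ne_zero hv <| by
  rw [← gramFunctional_ιMulti, h, map_zero]

lemma linearIndependent_of_ιMulti_ne_zero {n : ℕ} {v : Fin n → H} (h : ιMulti ℂ n v ≠ 0) :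
    LinearIndependent ℂ v := by
  by_contra hv
  exact h ((ιMulti ℂ n).map_linearDependent v hv)

/-- The determinant line is spanned by the wedge product of a basis. -/
lemma detLine_span {n : ℕ} {u : Fin n → H} (hu : LinearIndependent ℂ u) :
    detLine (Submodule.span ℂ (Set.range u)) = Submodule.span ℂ {ιMulti ℂ n u} := by
  rw [detLine, finrank_span_eq_card hu, Fintype.card_fin, Submodule.map_span, Submodule.span_pow]
  refine le_antisymm (Submodule.span_le.2 fun x hx => ?_) (Submodule.span_mono ?_)
  · obtain ⟨f, rfl⟩ := Set.mem_pow.1 hx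
    choose w hw hw' using fun i => (f i).2
    choose k hk using hw
    have e : (List.ofFn fun i => (f i : ExteriorAlgebra ℂ H)).prod = ιMulti ℂ n (u ∘ k) := by
      rw [ιMulti_apply]
      congr 2
      funext i
      rw [← hw', ← hk]; rfl
    rw [e]
    -- A product of n of the vectors is indexed by a map k from `Fin n` to itself: a permutation
    -- gives plus or minus the wedge of u, a repeated index gives zero.
    by_cases hinj : Function.Injective k
    · have hb : Function.Bijective k := hinj.bijective_of_finite
      have := (ιMulti ℂ n).map_perm u (Equiv.ofBijective k hb)
      have e' : u ∘ k = u ∘ Equiv.ofBijective k hb := rfl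
      rw [e', this]
      refine Submodule.smul_of_tower_mem _ _ (Submodule.subset_span rfl)
    · rw [ιMulti_eq_zero_of_not_inj (v := u ∘ k) fun h => hinj h.of_comp]
      exact zero_mem _
  · rintro _ rfl
    rw [Set.mem_pow]
    refine ⟨fun i => ⟨ι ℂ (u i), _, ⟨i, rfl⟩, rfl⟩, ?_⟩
    rw [ιMulti_apply]

lemma exists_frame_of_finiteDimensional (E : Submodule ℂ H) [FiniteDimensional ℂ E] :
    ∃ (n : ℕ) (u : Fin n → H), LinearIndependent ℂ u ∧ Submodule.span ℂ (Set.range u) = E := by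
  let b := Module.finBasis ℂ E
  refine ⟨_, fun i => b i, b.linearIndependent.map' E.subtype E.ker_subtype, ?_⟩
  have := congrArg (Submodule.map E.subtype) b.span_eq
  rw [Submodule.map_span, Submodule.map_top, Submodule.range_subtype, ← Set.range_comp] at this
  exact this

lemma detLine_bot : detLine (⊥ : Submodule ℂ H) = Submodule.span ℂ {1} := by
  rw [detLine, finrank_bot, pow_zero, Submodule.one_eq_span]

lemma exists_detLine_eq_span (E : Submodule ℂ H) [FiniteDimensional ℂ E] :
    ∃ x : ExteriorAlgebra ℂ H, x ≠ 0 ∧ detLine E = Submodule.span ℂ {x} := by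
  obtain ⟨n, u, hu, hE⟩ := exists_frame_of_finiteDimensional E
  exact ⟨ιMulti ℂ _ u, ιMulti_ne_zero hu, by rw [← detLine_span hu, hE]⟩

lemma detLine_eq_span_of_mem {E : Submodule ℂ H} [FiniteDimensional ℂ E] {x : ExteriorAlgebra ℂ H}
    (hx : x ∈ detLine E) (h0 : x ≠ 0) : detLine E = Submodule.span ℂ {x} := by
  obtain ⟨y, hy, hE⟩ := exists_detLine_eq_span E
  rw [hE] at hx ⊢
  obtain ⟨c, rfl⟩ := Submodule.mem_span_singleton.1 hx
  have hc : IsUnit c := isUnit_iff_ne_zero.2 fun h => h0 (by rw [h, zero_smul])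
  exact (Submodule.span_singleton_smul_eq hc y).symm

/-- The wedge product `det E ⊗ det F → det (E ⊕ F)` maps non-zero elements to non-zero ones. -/
lemma mul_mem_detLine_sup {E F : Submodule ℂ H} [FiniteDimensional ℂ E] [FiniteDimensional ℂ F]
    (h : Disjoint E F) {x y : ExteriorAlgebra ℂ H} (hx : x ∈ detLine E) (hx0 : x ≠ 0)
    (hy : y ∈ detLine F) (hy0 : y ≠ 0) : x * y ∈ detLine (E ⊔ F) ∧ x * y ≠ 0 := by
  obtain ⟨n, u, hu, hE⟩ := exists_frame_of_finiteDimensional E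
  obtain ⟨m, v, hv, hF⟩ := exists_frame_of_finiteDimensional F
  have hw : LinearIndependent ℂ (Fin.append u v) := by
    have h1 : LinearIndependent ℂ (Sum.elim u v) := by
      rw [linearIndependent_sum]
      exact ⟨hu, hv, by simpa [hE, hF] using h⟩
    have h2 : Fin.append u v = Sum.elim u v ∘ finSumFinEquiv.symm := by
      rw [Equiv.eq_comp_symm]
      funext i
      rcases i with i | i <;> simp
    rw [h2]
    exact h1.comp _ (Equiv.injective _)
  have hs : Submodule.span ℂ (Set.range (Fin.append u v)) = E ⊔ F := by
    rw [← hE, ← hF, ← Submodule.span_union]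
    congr 1
    ext x
    simp only [Set.mem_range, Set.mem_union]
    constructor
    · rintro ⟨i, rfl⟩
      refine Fin.addCases (fun i => ?_) (fun i => ?_) i
      · exact Or.inl ⟨i, by simp⟩
      · exact Or.inr ⟨i, by simp⟩
    · rintro (⟨i, rfl⟩ | ⟨i, rfl⟩)
      · exact ⟨Fin.castAdd _ i, by simp⟩
      · exact ⟨Fin.natAdd _ i, by simp⟩
  rw [← hs, detLine_span hw]
  rw [← hE, detLine_span hu] at hx
  rw [← hF, detLine_span hv] at hy
  obtain ⟨a, rfl⟩ := Submodule.mem_span_singleton.1 hx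
  obtain ⟨b, rfl⟩ := Submodule.mem_span_singleton.1 hy
  rw [smul_mul_smul_comm, ιMulti_mul_ιMulti]
  refine ⟨Submodule.smul_mem _ _ (Submodule.subset_span rfl), smul_ne_zero ?_ (ιMulti_ne_zero hw)⟩
  exact mul_ne_zero (fun h => hx0 (by rw [h, zero_smul])) fun h => hy0 (by rw [h, zero_smul])

lemma ι_mul_pow_comm (v : H) {n : ℕ} {y : ExteriorAlgebra ℂ H}
    (hy : y ∈ LinearMap.range (ι ℂ : H →ₗ[ℂ] ExteriorAlgebra ℂ H) ^ n) :
    ι ℂ v * y = (-1 : ℂ) ^ n • (y * ι ℂ v) := by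
  induction hy using Submodule.pow_induction_on_left' with
  | algebraMap r => rw [pow_zero, one_smul, Algebra.commutes]
  | add x y i hx hy h1 h2 => rw [mul_add, h1, h2, add_mul, smul_add]
  | mem_mul m hm i x hx h =>
    obtain ⟨w, rfl⟩ := hm
    have e : ι ℂ v * ι ℂ w = -(ι ℂ w * ι ℂ v) := eq_neg_of_add_eq_zero_left (ι_add_mul_swap v w)
    rw [← mul_assoc, e, neg_mul, mul_assoc, h, mul_smul_comm, pow_succ, mul_assoc, mul_neg_one,
      neg_smul]

lemma pow_mul_pow_comm {m n : ℕ} {x y : ExteriorAlgebra ℂ H}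
    (hx : x ∈ LinearMap.range (ι ℂ : H →ₗ[ℂ] ExteriorAlgebra ℂ H) ^ m)
    (hy : y ∈ LinearMap.range (ι ℂ : H →ₗ[ℂ] ExteriorAlgebra ℂ H) ^ n) :
    x * y = (-1 : ℂ) ^ (m * n) • (y * x) := by
  induction hx using Submodule.pow_induction_on_left' with
  | algebraMap r => rw [zero_mul, pow_zero, one_smul, Algebra.commutes]
  | add x x' i hx hx' h1 h2 => rw [mul_add, add_mul, h1, h2, smul_add]
  | mem_mul v hv i x hx h =>
    obtain ⟨w, rfl⟩ := hv
    rw [mul_assoc, h, mul_smul_comm, ← mul_assoc, ι_mul_pow_comm w hy, smul_mul_assoc, smul_smul,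
      mul_assoc, ← pow_add, Nat.succ_mul]

lemma detLine_le_pow (E : Submodule ℂ H) :
    detLine E ≤ LinearMap.range (ι ℂ : H →ₗ[ℂ] ExteriorAlgebra ℂ H) ^ Module.finrank ℂ E :=
  pow_le_pow_left' LinearMap.map_le_range _

/-- Elements of determinant lines commute up to the usual sign. -/
lemma detLine_mul_comm {E F : Submodule ℂ H} {x y : ExteriorAlgebra ℂ H} (hx : x ∈ detLine E)
    (hy : y ∈ detLine F) :
    x * y = (-1 : ℂ) ^ (Module.finrank ℂ E * Module.finrank ℂ F) • (y * x) :=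
  pow_mul_pow_comm (detLine_le_pow E hx) (detLine_le_pow F hy)

end DetLine
/-! ### Calculus of smooth maps -/

section SmoothCalculus

section Neighbourhoods

variable {X W : Type*} [NormedAddCommGroup W] {c : X → W}

lemma self_of_nhdsVia {p : X → Prop} {x : X} (h : ∀ᶠ x' in nhdsVia c x, p x') : p x := by
  obtain ⟨s, hs, hsp⟩ := h
  exact hsp (mem_of_mem_nhds (x := c x) hs)

lemma tendsto_nhdsVia (x : X) : Tendsto c (nhdsVia c x) (𝓝 (c x)) := tendsto_comap

lemma isOpenVia_preimage {s : Set W} (hs : IsOpen s) : IsOpenVia c (c ⁻¹' s) :=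
  fun _ hx => preimage_mem_comap (hs.mem_nhds hx)

lemma exists_isOpenVia_of_eventually {p : W → Prop} {x : X} (h : ∀ᶠ w in 𝓝 (c x), p w) :
    ∃ U : Set X, x ∈ U ∧ IsOpenVia c U ∧ ∀ x' ∈ U, p (c x') := by
  obtain ⟨s, hs, ho, hx⟩ := eventually_nhds_iff.1 h
  exact ⟨c ⁻¹' s, hx, isOpenVia_preimage ho, fun x' hx' => hs _ hx'⟩

end Neighbourhoods

variable {X X' W W' F F' : Type*} [NormedAddCommGroup W] [NormedSpace ℝ W]
  [NormedAddCommGroup W'] [NormedSpace ℝ W'] [NormedAddCommGroup F] [NormedSpace ℝ F]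
  [NormedAddCommGroup F'] [NormedSpace ℝ F'] {c : X → W} {c' : X' → W'}

lemma SmoothAt.of_contDiffAt {f : W → F} {x : X} (hf : ContDiffAt ℝ ∞ f (c x)) :
    SmoothAt c (fun x' => f (c x')) x :=
  ⟨f, hf, Eventually.of_forall fun _ => rfl⟩

lemma smoothAt_const (a : F) (x : X) : SmoothAt c (fun _ => a) x :=
  SmoothAt.of_contDiffAt (f := fun _ => a) contDiffAt_const

lemma SmoothAt.congr {f g : X → F} {x : X} (hf : SmoothAt c f x)
    (h : ∀ᶠ x' in nhdsVia c x, g x' = f x') : SmoothAt c g x := by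
  obtain ⟨f', hf', he⟩ := hf
  exact ⟨f', hf', by filter_upwards [h, he] with x' h1 h2 using h1.trans h2⟩

lemma SmoothAt.tendsto {f : X → F} {x : X} (hf : SmoothAt c f x) :
    Tendsto f (nhdsVia c x) (𝓝 (f x)) := by
  obtain ⟨f', hf', he⟩ := hf
  rw [self_of_nhdsVia he]
  exact (hf'.continuousAt.tendsto.comp (tendsto_nhdsVia x)).congr'
    (by filter_upwards [he] with x' h using h.symm)

lemma ContDiffAt.comp_smoothAt {Φ : F → F'} {f : X → F} {x : X} (hΦ : ContDiffAt ℝ ∞ Φ (f x))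
    (hf : SmoothAt c f x) : SmoothAt c (fun x' => Φ (f x')) x := by
  obtain ⟨f', hf', he⟩ := hf
  refine ⟨Φ ∘ f', ContDiffAt.comp _ (self_of_nhdsVia he ▸ hΦ) hf', ?_⟩
  filter_upwards [he] with x' h
  rw [h]; rfl

lemma ContDiff.comp_smoothAt {Φ : F → F'} {f : X → F} {x : X} (hΦ : ContDiff ℝ ∞ Φ)
    (hf : SmoothAt c f x) : SmoothAt c (fun x' => Φ (f x')) x :=
  ContDiffAt.comp_smoothAt hΦ.contDiffAt hf

lemma SmoothAt.prodMk {f : X → F} {g : X → F'} {x : X} (hf : SmoothAt c f x)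
    (hg : SmoothAt c g x) : SmoothAt c (fun x' => (f x', g x')) x := by
  obtain ⟨f', hf', he⟩ := hf
  obtain ⟨g', hg', he'⟩ := hg
  refine ⟨fun w => (f' w, g' w), hf'.prodMk hg', ?_⟩
  filter_upwards [he, he'] with x' h1 h2
  rw [h1, h2]

lemma smoothAt_pi {ι : Type*} [Fintype ι] {f : ι → X → F} {x : X}
    (hf : ∀ i, SmoothAt c (f i) x) : SmoothAt c (fun x' i => f i x') x := by
  choose f' hf' he using hf
  refine ⟨fun w i => f' i w, contDiffAt_pi.2 hf', ?_⟩
  filter_upwards [eventually_all.2 he] with x' h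
  exact funext h

/-- The pullback of a smooth map along a smooth map between manifolds is smooth. -/
lemma SmoothAt.comp {f : X → F} {ψ : X' → X} {x : X'} (hf : SmoothAt c f (ψ x))
    (hψ : SmoothAt c' (fun x' => c (ψ x')) x) : SmoothAt c' (fun x' => f (ψ x')) x := by
  obtain ⟨f', hf', he⟩ := hf
  refine SmoothAt.congr (ContDiffAt.comp_smoothAt (f := fun x' => c (ψ x')) hf' hψ) ?_
  exact (tendsto_comap_iff.2 hψ.tendsto).eventually he

lemma SmoothAt.mul {f g : X → ℂ} {x : X} (hf : SmoothAt c f x) (hg : SmoothAt c g x) :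
    SmoothAt c (fun x' => f x' * g x') x :=
  ContDiff.comp_smoothAt (Φ := fun p : ℂ × ℂ => p.1 * p.2) (contDiff_fst.mul contDiff_snd)
    (hf.prodMk hg)

lemma SmoothAt.div {f g : X → ℂ} {x : X} (hf : SmoothAt c f x) (hg : SmoothAt c g x)
    (h0 : g x ≠ 0) : SmoothAt c (fun x' => f x' / g x') x := by
  have h : ContDiffAt ℝ ∞ (fun p : ℂ × ℂ => p.1 * p.2⁻¹) (f x, g x) :=
    contDiffAt_fst.mul (contDiffAt_snd.inv h0)
  simp only [div_eq_mul_inv]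
  exact ContDiffAt.comp_smoothAt (f := fun x' => (f x', g x')) h (hf.prodMk hg)

section Gram

variable {H : Type*} [NormedAddCommGroup H] [InnerProductSpace ℂ H]

lemma contDiff_gramForm (n : ℕ) :
    ContDiff ℝ ∞ fun p : (Fin n → H) × (Fin n → H) => gramForm p.1 p.2 := by
  simp only [gramForm_apply, Matrix.det_apply, Matrix.of_apply]
  refine ContDiff.sum fun σ _ => ContDiff.const_smul _ (contDiff_prod fun i _ => ?_)
  exact ContDiff.inner ℂ (by fun_prop) (by fun_prop)

lemma SmoothAt.gramFunctional {m n : ℕ} {v : Fin n → X → H} {v' : Fin m → X → H} {x : X}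
    (hv : ∀ i, SmoothAt c (v i) x) (hv' : ∀ i, SmoothAt c (v' i) x) :
    SmoothAt c (fun x' => gramFunctional (fun i => v i x')
      (ExteriorAlgebra.ιMulti ℂ m fun i => v' i x')) x := by
  rcases eq_or_ne m n with rfl | h
  · simp only [gramFunctional_ιMulti]
    exact ContDiff.comp_smoothAt (Φ := fun p : (Fin m → H) × (Fin m → H) => gramForm p.1 p.2)
      (f := fun x' => (fun i => v i x', fun i => v' i x')) (contDiff_gramForm m)
      ((smoothAt_pi hv).prodMk (smoothAt_pi hv'))
  -- For families of different lengths the functional vanishes identically, so no equality of ranks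
  -- has to be assumed later.
  · simp only [gramFunctional_ιMulti_of_ne h]
    exact smoothAt_const _ _

lemma SmoothAt.append {m n : ℕ} {v : Fin n → X → H} {v' : Fin m → X → H} {x : X}
    (hv : ∀ i, SmoothAt c (v i) x) (hv' : ∀ i, SmoothAt c (v' i) x) (i : Fin (n + m)) :
    SmoothAt c (fun x' => Fin.append (fun i => v i x') (fun i => v' i x') i) x := by
  refine Fin.addCases (fun i => ?_) (fun i => ?_) i
  · simpa using hv i
  · simpa using hv' i

end Gram

end SmoothCalculus
/-! ### The order on the circle -/

section CircleOrder

open Real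

/-- The angle of a point of the circle, in `(0, 2π]`. -/
noncomputable def ang (z : Circle) : ℝ := Complex.arg (-(z : ℂ)) + π

lemma ang_pos (z : Circle) : 0 < ang z := by
  have := Complex.neg_pi_lt_arg (-(z : ℂ))
  unfold ang; linarith

lemma ang_le (z : Circle) : ang z ≤ 2 * π := by
  have := Complex.arg_le_pi (-(z : ℂ))
  unfold ang; linarith

lemma exp_ang (z : Circle) : Circle.exp (ang z) = z := by
  ext
  have h := Complex.norm_mul_exp_arg_mul_I (-(z : ℂ))
  rw [norm_neg, Circle.norm_coe, Complex.ofReal_one, one_mul] at h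
  rw [Circle.coe_exp, ang, Complex.ofReal_add, add_mul, Complex.exp_add, h, Complex.exp_pi_mul_I]
  ring

lemma ang_injective : Function.Injective ang := fun z w h => by
  rw [← exp_ang z, h, exp_ang]

lemma ang_exp {α : ℝ} (h0 : 0 < α) (h1 : α ≤ 2 * π) : ang (Circle.exp α) = α := by
  obtain ⟨m, hm⟩ := Circle.exp_eq_exp.1 (exp_ang (Circle.exp α))
  have h2 := ang_pos (Circle.exp α)
  have h3 := ang_le (Circle.exp α)
  have hπ := Real.pi_pos
  -- Both angles lie in (0, 2π], so the integer number of turns between them is zero.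
  have h4 : (m : ℝ) < 1 := by
    by_contra! h
    nlinarith
  have h5 : (-1 : ℝ) < m := by
    by_contra! h
    nlinarith
  have h6 : m = 0 := by
    have h4' : m < 1 := by exact_mod_cast h4
    have h5' : -1 < m := by exact_mod_cast h5
    omega
  rw [hm, h6]; simp

lemma ang_lt_two_pi {z : Circle} (hz : z ≠ 1) : ang z < 2 * π :=
  lt_of_le_of_ne (ang_le z) fun h => hz (by rw [← exp_ang z, h, Circle.exp_two_pi])

lemma ang_one : ang 1 = 2 * π := by
  rw [← Circle.exp_two_pi, ang_exp Real.two_pi_pos le_rfl]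

/-- The point 1 has the maximal angle 2π, so z ≠ 1 follows from the inequality of angles and only w
≠ 1 has to be recorded. -/
lemma circLT_iff {z w : Circle} : CircLT z w ↔ ang z < ang w ∧ w ≠ 1 := by
  constructor
  · rintro ⟨α, β, h0, h1, h2, rfl, rfl⟩
    have hα := ang_exp h0 (h1.trans h2).le
    have hβ := ang_exp (h0.trans h1) h2.le
    refine ⟨by rwa [hα, hβ], fun h => ?_⟩
    rw [h, ang_one] at hβ
    exact h2.ne hβ.symm
  · rintro ⟨h1, h2⟩
    exact ⟨ang z, ang w, ang_pos z, h1, ang_lt_two_pi h2, (exp_ang z).symm, (exp_ang w).symm⟩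

lemma circLT_iff_of_ne {z w : Circle} (hw : w ≠ 1) : CircLT z w ↔ ang z < ang w := by
  rw [circLT_iff, and_iff_left hw]

lemma circLE_iff {z w : Circle} (hw : w ≠ 1) : CircLE z w ↔ ang z ≤ ang w := by
  rw [CircLE, circLT_iff_of_ne hw, le_iff_lt_or_eq, ang_injective.eq_iff]

/-- The sign in the definition of `ang` moves the branch cut of the argument to the excluded point
1. -/
lemma continuousAt_ang {z : Circle} (hz : z ≠ 1) : ContinuousAt ang z := by
  refine ContinuousAt.add (ContinuousAt.comp (f := fun w : Circle => -(w : ℂ))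
    (Complex.continuousAt_arg ?_) (by fun_prop)) continuousAt_const
  rw [Complex.mem_slitPlane_iff_arg]
  refine ⟨fun h => ?_, by simp⟩
  have := ang_lt_two_pi hz
  unfold ang at this
  linarith

end CircleOrder

/-! ### The spaces spanned by eigenvectors with eigenvalues in an arc -/

section EigenSum

variable {H : Type*} [NormedAddCommGroup H] [InnerProductSpace ℂ H] {T : H →L[ℂ] H}

lemma eigenSum_eq_bot {z z' : Circle} (h : ¬ CircLT z' z) (T : H →L[ℂ] H) :
    eigenSum z z' T = ⊥ := by
  refine iSup₂_eq_bot.2 fun μ hμ => absurd ?_ h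
  obtain ⟨h1, h2⟩ := hμ
  rw [circLT_iff] at h1 h2 ⊢
  exact ⟨h1.1.trans h2.1, h2.2⟩

lemma eigenSum_eq_bot_of_le {z z' : Circle} (hz' : z' ≠ 1) (h : CircLE z z') (T : H →L[ℂ] H) :
    eigenSum z z' T = ⊥ :=
  eigenSum_eq_bot (fun h' => ((circLT_iff.1 h').1.trans_le ((circLE_iff hz').1 h)).false) T

lemma eigenspace_eq_bot {z : ℂ} (hz : z ∉ spectrum ℂ T) :
    Module.End.eigenspace (T : H →ₗ[ℂ] H) z = ⊥ := by
  rw [eq_bot_iff]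
  intro v hv
  rw [spectrum.notMem_iff] at hz
  obtain ⟨u, hu⟩ := hz
  have h1 : (algebraMap ℂ (H →L[ℂ] H) z - T) v = 0 := by
    rw [sub_apply, Algebra.algebraMap_eq_smul_one, smul_apply, one_apply_eq_self]
    exact sub_eq_zero.2 (Module.End.mem_eigenspace_iff.1 hv).symm
  rw [← hu] at h1
  have h2 : ((u⁻¹ : (H →L[ℂ] H)ˣ) : H →L[ℂ] H) ((u : H →L[ℂ] H) v) = v := by
    rw [← mul_apply_eq_comp, Units.inv_mul, one_apply_eq_self]
  rw [← h2, h1, map_zero]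
  exact zero_mem _

lemma eigenspaces_circle_iSupIndep (T : H →L[ℂ] H) :
    iSupIndep fun μ : Circle => Module.End.eigenspace (T : H →ₗ[ℂ] H) (μ : ℂ) :=
  (Module.End.eigenspaces_iSupIndep (T : H →ₗ[ℂ] H)).comp Circle.coe_injective

/-- The two arcs have no point in common, and eigenspaces for distinct eigenvalues are independent.
-/
lemma eigenSum_disjoint {z₁ z₂ z₃ z₄ : Circle} (h : ang z₃ ≤ ang z₂) (T : H →L[ℂ] H) :
    Disjoint (eigenSum z₁ z₂ T) (eigenSum z₃ z₄ T) := by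
  refine (eigenspaces_circle_iSupIndep T).disjoint_biSup_biSup (s := {μ | CircLT z₂ μ ∧ CircLT μ z₁})
    (t := {μ | CircLT z₄ μ ∧ CircLT μ z₃}) (Set.disjoint_left.2 fun μ h1 h2 => ?_)
  have h3 := (circLT_iff.1 h1.1).1
  have h4 := (circLT_iff.1 h2.2).1
  linarith

/-- An eigenvalue in the long arc lies in one of the two short ones, because z₂ itself is not in the
spectrum. -/
lemma eigenSum_sup {z₁ z₂ z₃ : Circle} (hz₂ : z₂ ≠ 1) (hs : (z₂ : ℂ) ∉ spectrum ℂ T)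
    (h12 : CircLE z₂ z₁) (h23 : CircLE z₃ z₂) (hz₁ : z₁ ≠ 1) :
    eigenSum z₁ z₂ T ⊔ eigenSum z₂ z₃ T = eigenSum z₁ z₃ T := by
  rw [circLE_iff hz₁] at h12
  rw [circLE_iff hz₂] at h23
  refine le_antisymm (sup_le ?_ ?_) ?_
  · refine biSup_mono fun μ h => ?_
    rw [circLT_iff, circLT_iff] at h ⊢
    exact ⟨⟨h23.trans_lt h.1.1, h.1.2⟩, h.2⟩
  · refine biSup_mono fun μ h => ?_
    rw [circLT_iff, circLT_iff] at h ⊢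
    exact ⟨h.1, h.2.1.trans_le h12, hz₁⟩
  · refine iSup₂_le fun μ h => ?_
    rw [circLT_iff, circLT_iff] at h
    rcases lt_trichotomy (ang μ) (ang z₂) with h1 | h1 | h1
    · exact le_sup_of_le_right (le_iSup₂_of_le μ ⟨circLT_iff.2 h.1, circLT_iff.2 ⟨h1, hz₂⟩⟩ le_rfl)
    · rw [ang_injective h1, eigenspace_eq_bot hs]
      exact bot_le
    · exact le_sup_of_le_left
        (le_iSup₂_of_le μ ⟨circLT_iff.2 ⟨h1, h.1.2⟩, circLT_iff.2 h.2⟩ le_rfl)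

/-- Compatible generators `θ z z'` of the lines `det E_{(z, z')}`, for `z, z'` in `S`. -/
structure IsGeneratorSystem (T : H →L[ℂ] H) (S : Set Circle)
    (θ : Circle → Circle → ExteriorAlgebra ℂ H) : Prop where
  ne_one : ∀ z ∈ S, z ≠ 1
  span : ∀ z ∈ S, ∀ z' ∈ S, detLine (eigenSum z z' T) = Submodule.span ℂ {θ z z'}
  ne_zero : ∀ z ∈ S, ∀ z' ∈ S, θ z z' ≠ 0
  eq_one : ∀ z ∈ S, ∀ z' ∈ S, CircLE z z' → θ z z' = 1
  mul : ∀ z ∈ S, ∀ z' ∈ S, ∀ z'' ∈ S, CircLE z' z → CircLE z'' z' → θ z z' * θ z' z'' = θ z z''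

/-- Fix generators τ z of det E_(z, z₀), with z₀ below all of S. For z' ≤ z let θ z z' be the
quotient determined by θ z z' ∧ τ z' = τ z; in the opposite direction the line is ℂ and the
generator is 1. Multiplicativity is then the uniqueness of such quotients. -/
lemma exists_isGeneratorSystem
    (hfd : ∀ z z' : Circle, z ≠ 1 → z' ≠ 1 → FiniteDimensional ℂ (eigenSum z z' T))
    {S : Set Circle} (hS : ∀ z ∈ S, z ≠ 1 ∧ (z : ℂ) ∉ spectrum ℂ T) {z₀ : Circle} (hz₀ : z₀ ≠ 1)
    (hmin : ∀ z ∈ S, CircLE z₀ z) : ∃ θ, IsGeneratorSystem T S θ := by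
  have h1 : ∀ z ∈ S, ∃ x : ExteriorAlgebra ℂ H,
      x ≠ 0 ∧ detLine (eigenSum z z₀ T) = Submodule.span ℂ {x} := fun z hz => by
    have := hfd z z₀ (hS z hz).1 hz₀
    exact exists_detLine_eq_span _
  choose! τ hτ0 hτ using h1
  have h2 : ∀ z ∈ S, ∀ z' ∈ S, CircLE z' z →
      ∃ x ∈ detLine (eigenSum z z' T), x * τ z' = τ z := by
    intro z hz z' hz' hle
    have i1 := hfd z z' (hS z hz).1 (hS z' hz').1
    have i2 := hfd z' z₀ (hS z' hz').1 hz₀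
    have i3 := hfd z z₀ (hS z hz).1 hz₀
    obtain ⟨y, hy0, hy⟩ := exists_detLine_eq_span (eigenSum z z' T)
    have hym : y ∈ detLine (eigenSum z z' T) := hy ▸ Submodule.mem_span_singleton_self y
    have hτm : τ z' ∈ detLine (eigenSum z' z₀ T) :=
      hτ z' hz' ▸ Submodule.mem_span_singleton_self (τ z')
    have hm := mul_mem_detLine_sup (eigenSum_disjoint le_rfl T) hym hy0 hτm (hτ0 z' hz')
    rw [eigenSum_sup (hS z' hz').1 (hS z' hz').2 hle (hmin z' hz') (hS z hz).1] at hm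
    have := hτ z hz ▸ Submodule.mem_span_singleton_self (τ z)
    rw [detLine_eq_span_of_mem hm.1 hm.2] at this
    obtain ⟨c, hc⟩ := Submodule.mem_span_singleton.1 this
    exact ⟨c • y, Submodule.smul_mem _ _ hym, by rw [smul_mul_assoc, hc]⟩
  choose! ρ hρ hρτ using h2
  have hρ0 : ∀ z ∈ S, ∀ z' ∈ S, CircLE z' z → ρ z z' ≠ 0 := fun z hz z' hz' hle h =>
    hτ0 z hz (by rw [← hρτ z hz z' hz' hle, h, zero_mul])
  -- Wedging with τ z' is injective on det E_(z, z'), since E_(z, z') and E_(z', z₀) are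
  -- independent.
  have huniq : ∀ z ∈ S, ∀ z' ∈ S, ∀ x y, x ∈ detLine (eigenSum z z' T) →
      y ∈ detLine (eigenSum z z' T) → x * τ z' = y * τ z' → x = y := by
    intro z hz z' hz' x y hx hy hxy
    have i1 := hfd z z' (hS z hz).1 (hS z' hz').1
    have i2 := hfd z' z₀ (hS z' hz').1 hz₀
    by_contra hne
    have hτm : τ z' ∈ detLine (eigenSum z' z₀ T) :=
      hτ z' hz' ▸ Submodule.mem_span_singleton_self (τ z')
    refine (mul_mem_detLine_sup (eigenSum_disjoint le_rfl T) (sub_mem hx hy) (sub_ne_zero.2 hne)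
      hτm (hτ0 z' hz')).2 ?_
    rw [sub_mul, hxy, sub_self]
  have hone : ∀ z ∈ S, ρ z z = 1 := by
    intro z hz
    refine huniq z hz z hz _ _ (hρ z hz z hz (Or.inr rfl)) ?_ ?_
    · rw [eigenSum_eq_bot_of_le (hS z hz).1 (Or.inr rfl), detLine_bot]
      exact Submodule.mem_span_singleton_self 1
    · rw [hρτ z hz z hz (Or.inr rfl), one_mul]
  classical
  refine ⟨fun z z' => if CircLE z' z then ρ z z' else 1, fun z hz => (hS z hz).1, ?_, ?_, ?_, ?_⟩
  · intro z hz z' hz'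
    have i1 := hfd z z' (hS z hz).1 (hS z' hz').1
    by_cases h : CircLE z' z
    · simp only [h, if_true]
      exact detLine_eq_span_of_mem (hρ z hz z' hz' h) (hρ0 z hz z' hz' h)
    · simp only [h, if_false]
      rw [eigenSum_eq_bot (fun h' => h (Or.inl h')), detLine_bot]
  · intro z hz z' hz'
    by_cases h : CircLE z' z
    · simp only [h, if_true]
      exact hρ0 z hz z' hz' h
    · simp only [h, if_false]
      exact one_ne_zero
  · intro z hz z' hz' hle
    by_cases h : CircLE z' z
    · simp only [h, if_true]
      rw [circLE_iff (hS _ hz).1] at h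
      rw [circLE_iff (hS _ hz').1] at hle
      rw [ang_injective (le_antisymm h hle), hone z hz]
    · simp only [h, if_false]
  · intro z hz z' hz' z'' hz'' h1 h2
    have h3 : CircLE z'' z := by
      rw [circLE_iff (hS _ hz).1] at h1 ⊢
      rw [circLE_iff (hS _ hz').1] at h2
      exact h2.trans h1
    simp only [h1, h2, h3, if_true]
    have i1 := hfd z z' (hS z hz).1 (hS z' hz').1
    have i2 := hfd z' z'' (hS z' hz').1 (hS z'' hz'').1
    have hm := mul_mem_detLine_sup (eigenSum_disjoint le_rfl T) (hρ z hz z' hz' h1)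
      (hρ0 z hz z' hz' h1) (hρ z' hz' z'' hz'' h2) (hρ0 z' hz' z'' hz'' h2)
    rw [eigenSum_sup (hS z' hz').1 (hS z' hz').2 h1 h2 (hS z hz).1] at hm
    refine huniq z hz z'' hz'' _ _ hm.1 (hρ z hz z'' hz'' h3) ?_
    rw [mul_assoc, hρτ z' hz' z'' hz'' h2, hρτ z hz z' hz' h1, hρτ z hz z'' hz'' h3]

lemma circle_order_cases {z₁ z₂ z₃ : Circle} (h₁ : z₁ ≠ 1) (h₂ : z₂ ≠ 1) (h₃ : z₃ ≠ 1) :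
    (CircLE z₂ z₁ ∧ CircLE z₃ z₂ ∧ CircLE z₃ z₁) ∨ (CircLE z₁ z₂ ∧ CircLE z₃ z₁ ∧ CircLE z₃ z₂) ∨
    (CircLE z₃ z₁ ∧ CircLE z₂ z₃ ∧ CircLE z₂ z₁) ∨ (CircLE z₃ z₂ ∧ CircLE z₁ z₃ ∧ CircLE z₁ z₂) ∨
    (CircLE z₁ z₃ ∧ CircLE z₂ z₁ ∧ CircLE z₂ z₃) ∨
    (CircLE z₂ z₃ ∧ CircLE z₁ z₂ ∧ CircLE z₁ z₃) := by
  simp only [circLE_iff h₁, circLE_iff h₂, circLE_iff h₃]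
  grind

/-- In each of the six orders at least three of the six generators are 1, and the equation reduces
to multiplicativity along a decreasing chain. The two factors appear in the wrong order exactly when
z₁ is the middle point; the signs compensate for that. -/
lemma IsGeneratorSystem.relation {S : Set Circle} {θ : Circle → Circle → ExteriorAlgebra ℂ H}
    (hθ : IsGeneratorSystem T S θ) {z₁ z₂ z₃ : Circle} (h₁ : z₁ ∈ S) (h₂ : z₂ ∈ S) (h₃ : z₃ ∈ S) :
    (-1 : ℂ) ^ (Module.finrank ℂ (eigenSum z₁ z₂ T) * Module.finrank ℂ (eigenSum z₃ z₁ T)) •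
        (θ z₁ z₂ * θ z₂ z₃ * θ z₃ z₁) =
      (-1 : ℂ) ^ (Module.finrank ℂ (eigenSum z₂ z₁ T) * Module.finrank ℂ (eigenSum z₁ z₃ T)) •
        (θ z₁ z₃ * θ z₃ z₂ * θ z₂ z₁) ∧ θ z₁ z₂ * θ z₂ z₃ * θ z₃ z₁ ≠ 0 := by
  have n₁ := hθ.ne_one _ h₁
  have n₂ := hθ.ne_one _ h₂
  have n₃ := hθ.ne_one _ h₃
  have hb : ∀ {z z'}, z' ≠ 1 → CircLE z z' → Module.finrank ℂ (eigenSum z z' T) = 0 :=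
    fun hz' h => by rw [eigenSum_eq_bot_of_le hz' h, finrank_bot]
  have hmem : ∀ {z z'}, z ∈ S → z' ∈ S → θ z z' ∈ detLine (eigenSum z z' T) :=
    fun hz hz' => hθ.span _ hz _ hz' ▸ Submodule.mem_span_singleton_self _
  rcases circle_order_cases n₁ n₂ n₃ with h | h | h | h | h | h <;> obtain ⟨ha, hb', hc⟩ := h
  · rw [hb n₁ ha, hb n₁ hc, hθ.eq_one _ h₂ _ h₁ ha, hθ.eq_one _ h₃ _ h₂ hb',
      hθ.eq_one _ h₃ _ h₁ hc, hθ.mul _ h₁ _ h₂ _ h₃ ha hb']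
    simpa using hθ.ne_zero _ h₁ _ h₃
  · have hm := hθ.mul _ h₂ _ h₁ _ h₃ ha hb'
    rw [detLine_mul_comm (hmem h₂ h₁) (hmem h₁ h₃)] at hm
    rw [hb n₂ ha, hθ.eq_one _ h₁ _ h₂ ha, hθ.eq_one _ h₃ _ h₁ hb', hθ.eq_one _ h₃ _ h₂ hc]
    simpa [hm] using hθ.ne_zero _ h₂ _ h₃
  · rw [hb n₁ ha, hb n₁ hc, hθ.eq_one _ h₂ _ h₁ hc, hθ.eq_one _ h₃ _ h₁ ha,
      hθ.eq_one _ h₂ _ h₃ hb', ← hθ.mul _ h₁ _ h₃ _ h₂ ha hb']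
    simpa [hθ.mul _ h₁ _ h₃ _ h₂ ha hb'] using hθ.ne_zero _ h₁ _ h₂
  · rw [hb n₂ hc, hb n₃ hb', hθ.eq_one _ h₁ _ h₂ hc, hθ.eq_one _ h₃ _ h₂ ha,
      hθ.eq_one _ h₁ _ h₃ hb', ← hθ.mul _ h₂ _ h₃ _ h₁ ha hb']
    simpa [hθ.mul _ h₂ _ h₃ _ h₁ ha hb'] using hθ.ne_zero _ h₂ _ h₁
  · have hm := hθ.mul _ h₃ _ h₁ _ h₂ ha hb'
    rw [detLine_mul_comm (hmem h₃ h₁) (hmem h₁ h₂), mul_comm (Module.finrank _ _)] at hm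
    have hne : θ z₁ z₂ * θ z₃ z₁ ≠ 0 := fun h => by
      rw [h, smul_zero] at hm
      exact hθ.ne_zero _ h₃ _ h₂ hm.symm
    rw [hb n₃ ha, hθ.eq_one _ h₁ _ h₃ ha, hθ.eq_one _ h₂ _ h₁ hb', hθ.eq_one _ h₂ _ h₃ hc]
    simpa [hm] using hne
  · rw [hb n₂ hb', hb n₃ hc, hθ.eq_one _ h₁ _ h₂ hb', hθ.eq_one _ h₂ _ h₃ ha,
      hθ.eq_one _ h₁ _ h₃ hc, ← hθ.mul _ h₃ _ h₂ _ h₁ ha hb']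
    simpa [hθ.mul _ h₃ _ h₂ _ h₁ ha hb'] using hθ.ne_zero _ h₃ _ h₁

end EigenSum
/-! ### Linear maps between lines -/

section LineHom

variable {Λ : Type*} [Ring Λ] [Algebra ℂ Λ] {A B A₁ B₁ A₂ B₂ A₃ B₃ : Submodule ℂ Λ}

lemma exists_smul_eq_of_span {x : Λ} (hA : A = Submodule.span ℂ {x}) (v : A) :
    ∃ k : ℂ, (v : Λ) = k • x := by
  obtain ⟨k, hk⟩ := Submodule.mem_span_singleton.1 (hA ▸ v.2 : (v : Λ) ∈ Submodule.span ℂ {x})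
  exact ⟨k, hk.symm⟩

lemma lineHom_ext {x : Λ} (hA : A = Submodule.span ℂ {x}) {a a' : A →ₗ[ℂ] B}
    (h : ∀ v : A, (v : Λ) = x → a v = a' v) : a = a' := by
  subst hA
  ext ⟨v, hv⟩
  obtain ⟨c, rfl⟩ := Submodule.mem_span_singleton.1 hv
  have e : (⟨c • x, hv⟩ : Submodule.span ℂ {x}) = c • ⟨x, Submodule.mem_span_singleton_self x⟩ := rfl
  rw [e, map_smul, map_smul, h _ rfl]

lemma exists_lineHom {x y : Λ} (hA : A = Submodule.span ℂ {x}) (hx : x ≠ 0) (hy : y ∈ B) :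
    ∃ e : A →ₗ[ℂ] B, ∀ v : A, (v : Λ) = x → (e v : Λ) = y := by
  subst hA
  refine ⟨LinearMap.toSpanSingleton ℂ B ⟨y, hy⟩ ∘ₗ
    (LinearEquiv.toSpanNonzeroSingleton ℂ Λ x hx).symm.toLinearMap, ?_⟩
  rintro ⟨v, hv⟩ h
  obtain rfl : v = x := h
  have e : (LinearEquiv.toSpanNonzeroSingleton ℂ Λ v hx).symm ⟨v, hv⟩ = 1 := by
    rw [LinearEquiv.symm_apply_eq, LinearEquiv.toSpanNonzeroSingleton_one]
  simp [e]

/-- Homomorphisms between two lines form a line with generator e. The coordinate is produced as a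
linear functional, so that a product built from coordinates is visibly bilinear. -/
lemma exists_lineHom_coord {x y : Λ} (hA : A = Submodule.span ℂ {x})
    (hB : B = Submodule.span ℂ {y}) (hy : y ≠ 0) {e : A →ₗ[ℂ] B}
    (he : ∀ v : A, (v : Λ) = x → (e v : Λ) = y) :
    ∃ φ : (A →ₗ[ℂ] B) →ₗ[ℂ] ℂ, ∀ a, a = φ a • e := by
  have hx : x ∈ A := hA ▸ Submodule.mem_span_singleton_self x
  have hy' : y ∈ B := hB ▸ Submodule.mem_span_singleton_self y
  -- The line B is identified with the scalars by y ↦ 1; evaluating at x and applying this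
  -- identification reads off the coefficient.
  obtain ⟨f, hf⟩ := exists_lineHom (A := B) (B := Submodule.span ℂ {(1 : Λ)}) hB hy
    (Submodule.mem_span_singleton_self 1)
  have h1 : (1 : Λ) ≠ 0 := fun h => hy (by rw [← one_mul y, h, zero_mul])
  let c := (LinearEquiv.toSpanNonzeroSingleton ℂ Λ 1 h1).symm
  refine ⟨c.toLinearMap ∘ₗ f ∘ₗ LinearMap.applyₗ ⟨x, hx⟩, fun a => lineHom_ext hA ?_⟩
  rintro ⟨v, hv⟩ rfl
  obtain ⟨k, hk⟩ := exists_smul_eq_of_span hB (a ⟨v, hv⟩)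
  have e1 : a ⟨v, hv⟩ = k • ⟨y, hy'⟩ := Subtype.ext hk
  have e2 : c (f ⟨y, hy'⟩) = 1 := by
    rw [LinearEquiv.symm_apply_eq, LinearEquiv.toSpanNonzeroSingleton_one]
    exact Subtype.ext (hf _ rfl)
  have e3 : e ⟨v, hv⟩ = ⟨y, hy'⟩ := Subtype.ext (he _ rfl)
  have e4 : (c.toLinearMap ∘ₗ f ∘ₗ LinearMap.applyₗ ⟨v, hx⟩) a = k := by
    show c (f (a ⟨v, hv⟩)) = k
    rw [e1, map_smul, map_smul, e2, smul_eq_mul, mul_one]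
  rw [e4, LinearMap.smul_apply, e3, e1]

lemma lineHom_apply_eq_zero {x : Λ} (hA : A = Submodule.span ℂ {x}) {a : A →ₗ[ℂ] B} (ha : a ≠ 0)
    {v : A} (hv : a v = 0) : v = 0 := by
  by_contra h0
  obtain ⟨c, hc⟩ := exists_smul_eq_of_span hA v
  have hc0 : IsUnit c :=
    isUnit_iff_ne_zero.2 fun h => h0 (Subtype.ext (by rw [hc, h, zero_smul]; rfl))
  refine ha (lineHom_ext (x := (v : Λ)) ?_ fun w hw => ?_)
  · exact hA.trans (by rw [hc, Submodule.span_singleton_smul_eq hc0])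
  · rw [Subtype.ext hw, hv]; rfl

lemma exists_lineHom_apply_eq {x y : Λ} (hA : A = Submodule.span ℂ {x}) (hx : x ≠ 0)
    (hB : B = Submodule.span ℂ {y}) {a : A →ₗ[ℂ] B} (ha : a ≠ 0) (w : B) : ∃ v, a v = w := by
  have hxA : x ∈ A := hA ▸ Submodule.mem_span_singleton_self x
  have h0 : (a ⟨x, hxA⟩ : Λ) ≠ 0 := fun h => hx
    (congrArg Subtype.val (lineHom_apply_eq_zero hA ha (v := ⟨x, hxA⟩) (Subtype.ext h)))
  obtain ⟨k, hk⟩ := exists_smul_eq_of_span hB (a ⟨x, hxA⟩)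
  obtain ⟨l, hl⟩ := exists_smul_eq_of_span hB w
  have hk0 : k ≠ 0 := fun h => h0 (by rw [hk, h, zero_smul])
  refine ⟨(l / k) • ⟨x, hxA⟩, Subtype.ext ?_⟩
  rw [map_smul, Submodule.coe_smul, hk, smul_smul, div_mul_cancel₀ _ hk0, hl]

/-- The relation `a b = c` for linear maps between lines in an algebra, with signs. -/
def IsMulRel (σ τ : ℂ) (a : A₁ →ₗ[ℂ] B₁) (b : A₂ →ₗ[ℂ] B₂) (c : A₃ →ₗ[ℂ] B₃) : Prop :=
  ∀ (x : A₁) (y : A₂) (r : A₃), σ • ((a x : Λ) * b y * r) = τ • ((c r : Λ) * y * x)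

lemma IsMulRel.zero_left {σ τ : ℂ} {b : A₂ →ₗ[ℂ] B₂} :
    IsMulRel σ τ (0 : A₁ →ₗ[ℂ] B₁) b (0 : A₃ →ₗ[ℂ] B₃) := fun x y r => by simp

lemma IsMulRel.zero_right {σ τ : ℂ} {a : A₁ →ₗ[ℂ] B₁} :
    IsMulRel σ τ a (0 : A₂ →ₗ[ℂ] B₂) (0 : A₃ →ₗ[ℂ] B₃) := fun x y r => by simp

lemma IsMulRel.of_generators {σ τ : ℂ} {a : A₁ →ₗ[ℂ] B₁} {b : A₂ →ₗ[ℂ] B₂} {c : A₃ →ₗ[ℂ] B₃}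
    {x₁ x₂ x₃ y₁ y₂ y₃ : Λ} (hA₁ : A₁ = Submodule.span ℂ {x₁}) (hA₂ : A₂ = Submodule.span ℂ {x₂})
    (hA₃ : A₃ = Submodule.span ℂ {x₃})
    (ha : ∀ v : A₁, (v : Λ) = x₁ → (a v : Λ) = y₁) (hb : ∀ v : A₂, (v : Λ) = x₂ → (b v : Λ) = y₂)
    (hc : ∀ v : A₃, (v : Λ) = x₃ → (c v : Λ) = y₃)
    (h : σ • (y₁ * y₂ * x₃) = τ • (y₃ * x₂ * x₁)) : IsMulRel σ τ a b c := by
  intro x y r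
  have key : ∀ {A B : Submodule ℂ Λ} {g g' : Λ} {a : A →ₗ[ℂ] B}, A = Submodule.span ℂ {g} →
      (∀ v : A, (v : Λ) = g → (a v : Λ) = g') → ∀ v : A, ∃ k : ℂ, (v : Λ) = k • g ∧
        (a v : Λ) = k • g' := by
    intro A B g g' a hA ha v
    obtain ⟨k, hk⟩ := exists_smul_eq_of_span hA v
    have hg : g ∈ A := hA ▸ Submodule.mem_span_singleton_self g
    have e : v = k • ⟨g, hg⟩ := Subtype.ext hk
    exact ⟨k, hk, by rw [e, map_smul, Submodule.coe_smul, ha _ rfl]⟩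
  obtain ⟨k, h1, h1'⟩ := key hA₁ ha x
  obtain ⟨l, h2, h2'⟩ := key hA₂ hb y
  obtain ⟨m, h3, h3'⟩ := key hA₃ hc r
  rw [h1, h1', h2, h2', h3, h3']
  simp only [smul_mul_assoc, mul_smul_comm]
  rw [smul_comm σ, smul_comm σ, smul_comm σ, h]
  simp only [smul_smul]
  congr 1
  ring

/-- Existence: by h the generators e₁, e₂, e₃ are related, and the relation is homogeneous in each
argument, so s(a, b) is the product of the coordinates of a and b times e₃. Uniqueness: the right
side evaluated at generators is a non-zero vector times the coordinate of c. -/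
lemma exists_mulRel {σ τ : ℂ} (hσ : σ ≠ 0) {x₁ x₂ x₃ y₁ y₂ y₃ : Λ}
    (hA₁ : A₁ = Submodule.span ℂ {x₁}) (hA₂ : A₂ = Submodule.span ℂ {x₂})
    (hA₃ : A₃ = Submodule.span ℂ {x₃}) (hB₁ : B₁ = Submodule.span ℂ {y₁})
    (hB₂ : B₂ = Submodule.span ℂ {y₂}) (hB₃ : B₃ = Submodule.span ℂ {y₃})
    (h : σ • (y₁ * y₂ * x₃) = τ • (y₃ * x₂ * x₁)) (h0 : y₁ * y₂ * x₃ ≠ 0)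
    (hx₁ : x₁ ≠ 0) (hx₂ : x₂ ≠ 0) :
    ∃ s : (A₁ →ₗ[ℂ] B₁) →ₗ[ℂ] (A₂ →ₗ[ℂ] B₂) →ₗ[ℂ] (A₃ →ₗ[ℂ] B₃),
      (∀ a b c, IsMulRel σ τ a b c ↔ c = s a b) ∧ ∀ a b, a ≠ 0 → b ≠ 0 → s a b ≠ 0 := by
  have hy₁ : y₁ ≠ 0 := fun h => h0 (by rw [h, zero_mul, zero_mul])
  have hy₂ : y₂ ≠ 0 := fun h => h0 (by rw [h, mul_zero, zero_mul])
  have hx₃ : x₃ ≠ 0 := fun h => h0 (by rw [h, mul_zero])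
  have h0' : τ • (y₃ * x₂ * x₁) ≠ 0 := h ▸ smul_ne_zero hσ h0
  have hy₃ : y₃ ≠ 0 := fun h => h0' (by rw [h, zero_mul, zero_mul, smul_zero])
  obtain ⟨e₁, he₁⟩ := exists_lineHom (B := B₁) hA₁ hx₁
    (hB₁ ▸ Submodule.mem_span_singleton_self y₁)
  obtain ⟨e₂, he₂⟩ := exists_lineHom (B := B₂) hA₂ hx₂
    (hB₂ ▸ Submodule.mem_span_singleton_self y₂)
  obtain ⟨e₃, he₃⟩ := exists_lineHom (B := B₃) hA₃ hx₃
    (hB₃ ▸ Submodule.mem_span_singleton_self y₃)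
  obtain ⟨φ₁, hφ₁⟩ := exists_lineHom_coord hA₁ hB₁ hy₁ he₁
  obtain ⟨φ₂, hφ₂⟩ := exists_lineHom_coord hA₂ hB₂ hy₂ he₂
  obtain ⟨φ₃, hφ₃⟩ := exists_lineHom_coord hA₃ hB₃ hy₃ he₃
  have hrel : IsMulRel σ τ e₁ e₂ e₃ := .of_generators hA₁ hA₂ hA₃ he₁ he₂ he₃ h
  have he₃0 : e₃ ≠ 0 := fun h => hy₃ <| by
    rw [← he₃ ⟨x₃, hA₃ ▸ Submodule.mem_span_singleton_self x₃⟩ rfl, h]; rfl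
  have hs : ∀ a b, φ₁.smulRight (φ₂.smulRight e₃) a b = φ₁ a • φ₂ b • e₃ := fun a b => rfl
  have hrel' : ∀ a b, IsMulRel σ τ a b (φ₁.smulRight (φ₂.smulRight e₃) a b) := by
    intro a b x y r
    have := hrel x y r
    rw [hs]
    conv_lhs => rw [hφ₁ a, hφ₂ b]
    simp only [LinearMap.smul_apply, Submodule.coe_smul, smul_mul_assoc, mul_smul_comm]
    rw [smul_comm σ, smul_comm σ, this]
    simp only [smul_smul]
    congr 1
    ring
  refine ⟨φ₁.smulRight (φ₂.smulRight e₃), fun a b c => ⟨fun hc => ?_, ?_⟩, fun a b ha hb => ?_⟩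
  · refine sub_eq_zero.1 ?_
    set c' := φ₁.smulRight (φ₂.smulRight e₃) a b
    have h1 : ∀ (x : A₁) (y : A₂) (r : A₃), τ • (((c - c') r : Λ) * y * x) = 0 := by
      intro x y r
      have e1 := hc x y r
      have e2 := hrel' a b x y r
      rw [LinearMap.sub_apply, Submodule.coe_sub, sub_mul, sub_mul, smul_sub, ← e1, ← e2, sub_self]
    have h2 := h1 ⟨x₁, hA₁ ▸ Submodule.mem_span_singleton_self x₁⟩
      ⟨x₂, hA₂ ▸ Submodule.mem_span_singleton_self x₂⟩
      ⟨x₃, hA₃ ▸ Submodule.mem_span_singleton_self x₃⟩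
    rw [hφ₃ (c - c')] at h2 ⊢
    rw [LinearMap.smul_apply, Submodule.coe_smul, he₃ _ rfl, smul_mul_assoc, smul_mul_assoc, smul_comm] at h2
    rw [(smul_eq_zero.1 h2).resolve_right h0', zero_smul]
  · rintro rfl
    exact hrel' a b
  · rw [hs]
    refine smul_ne_zero (fun h => ha ?_) (smul_ne_zero (fun h => hb ?_) he₃0)
    · rw [hφ₁ a, h, zero_smul]
    · rw [hφ₂ b, h, zero_smul]

end LineHom

/-! ### The section of the basic bundle gerbe -/

lemma exists_isGeneratorSystem_of_finite {H : Type*} [NormedAddCommGroup H]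
    [InnerProductSpace ℂ H] {T : H →L[ℂ] H}
    (hfd : ∀ z z' : Circle, z ≠ 1 → z' ≠ 1 → FiniteDimensional ℂ (eigenSum z z' T))
    {S : Set Circle} (hS : ∀ z ∈ S, z ≠ 1 ∧ (z : ℂ) ∉ spectrum ℂ T) (hfin : S.Finite)
    (hne : S.Nonempty) : ∃ θ, IsGeneratorSystem T S θ := by
  obtain ⟨z₀, hz₀, hmin⟩ := Set.exists_min_image S ang hfin hne
  exact exists_isGeneratorSystem hfd hS (hS z₀ hz₀).1
    fun z hz => (circLE_iff (hS z hz).1).2 (hmin z hz)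

section BasicSection

variable {H : Type u} [NormedAddCommGroup H] [InnerProductSpace ℂ H] [CompleteSpace H]
  {Γ : Subgroup (unitary (H →L[ℂ] H))}

/-- The rank of `E_{(z₁, z₂, g)}`. -/
noncomputable def rankPos (q : BasicY2 Γ) : ℕ :=
  Module.finrank ℂ (eigenSum q.1.1.z q.1.2.z (toOp Γ q.1.1.g))

/-- The rank of `E_{(z₂, z₁, g)}`. -/
noncomputable def rankNeg (q : BasicY2 Γ) : ℕ :=
  Module.finrank ℂ (eigenSum q.1.2.z q.1.1.z (toOp Γ q.1.1.g))

/-- The relation `a b = c` for `a`, `b`, `c` in the fibres of `L` over the three sides of a point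
of `Y^[3]`. -/
def IsBasicMul (t : BasicY3 Γ) (a : BasicL t.p12) (b : BasicL t.p23) (c : BasicL t.p13) : Prop :=
  IsMulRel ((-1) ^ (rankPos t.p12 * rankNeg t.p13)) ((-1) ^ (rankNeg t.p12 * rankPos t.p13)) a b c

lemma BasicY.admissible {y : BasicY Γ} {g : Γ} (h : y.g = g) :
    y.z ≠ 1 ∧ (y.z : ℂ) ∉ spectrum ℂ (toOp Γ g) := h ▸ y.2

/-- A generator system for the three points z₁, z₂, z₃ supplies the generators and the relation
between them. -/
lemma exists_basicMul (hfd : ∀ (g : Γ) (z z' : Circle), z ≠ 1 → z' ≠ 1 →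
    FiniteDimensional ℂ (eigenSum z z' (toOp Γ g))) (t : BasicY3 Γ) :
    ∃ s : BasicL t.p12 →ₗ[ℂ] BasicL t.p23 →ₗ[ℂ] BasicL t.p13,
      (∀ a b c, IsBasicMul t a b c ↔ c = s a b) ∧ ∀ a b, a ≠ 0 → b ≠ 0 → s a b ≠ 0 := by
  obtain ⟨θ, hθ⟩ := exists_isGeneratorSystem_of_finite (hfd t.1.1.g)
    (S := {t.1.1.z, t.1.2.1.z, t.1.2.2.z}) (by
      rintro z (rfl | rfl | rfl)
      · exact BasicY.admissible rfl
      · exact BasicY.admissible t.2.1.symm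
      · exact BasicY.admissible (t.2.1.trans t.2.2).symm) (Set.toFinite _) ⟨_, Or.inl rfl⟩
  have m1 : t.1.1.z ∈ ({t.1.1.z, t.1.2.1.z, t.1.2.2.z} : Set Circle) := Or.inl rfl
  have m2 : t.1.2.1.z ∈ ({t.1.1.z, t.1.2.1.z, t.1.2.2.z} : Set Circle) := Or.inr (Or.inl rfl)
  have m3 : t.1.2.2.z ∈ ({t.1.1.z, t.1.2.1.z, t.1.2.2.z} : Set Circle) := Or.inr (Or.inr rfl)
  -- The lines over `t.p23` are built from the operator at the second point, which agrees with the
  -- one at the first point only through the proof of membership in the fibre product.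
  have e : toOp Γ t.1.2.1.g = toOp Γ t.1.1.g := congrArg _ t.2.1.symm
  have hrel := hθ.relation m1 m2 m3
  refine exists_mulRel (pow_ne_zero _ (neg_ne_zero.2 one_ne_zero))
    (hθ.span _ m2 _ m1) ?_ (hθ.span _ m3 _ m1) (hθ.span _ m1 _ m2) ?_ (hθ.span _ m1 _ m3)
    hrel.1 hrel.2 (hθ.ne_zero _ m2 _ m1) (hθ.ne_zero _ m3 _ m2)
  · rw [← hθ.span _ m3 _ m2, ← e]; rfl
  · rw [← hθ.span _ m2 _ m3, ← e]; rfl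

end BasicSection
-- Inverse elements in the fibres of L
section InvElt

variable {H : Type*} [NormedAddCommGroup H] [InnerProductSpace ℂ H]

lemma IsInvElt.ne_zero {A B A' B' : Submodule ℂ (ExteriorAlgebra ℂ H)}
    {x : ExteriorAlgebra ℂ H} (hx : x ≠ 0) (hA : A = Submodule.span ℂ {x})
    {a : A →ₗ[ℂ] B} {a' : B' →ₗ[ℂ] A'} (h : IsInvElt a a') : a ≠ 0 := by
  rintro rfl
  have h1 := h ⟨x, hA ▸ Submodule.mem_span_singleton_self x⟩ 0 rfl
  rw [map_zero] at h1
  exact hx h1.symm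

lemma IsInvElt.symm {A B A' B' : Submodule ℂ (ExteriorAlgebra ℂ H)} (hA : A = A')
    {a : A →ₗ[ℂ] B} {a' : B' →ₗ[ℂ] A'} {x y : ExteriorAlgebra ℂ H}
    (hx : x ≠ 0) (hAx : A = Submodule.span ℂ {x}) (hBy : B = Submodule.span ℂ {y})
    (h : IsInvElt a a') (hB : B = B') : IsInvElt a' a := by
  subst hA hB
  intro y' x' hxy
  obtain ⟨v, hv⟩ := exists_lineHom_apply_eq hAx hx hBy (h.ne_zero hx hAx) y'
  have h1 := h v y' (by rw [hv])
  have h2 : x' = v := Subtype.ext (hxy.trans h1)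
  rw [h2, hv]

lemma exists_isInvElt {A B : Submodule ℂ (ExteriorAlgebra ℂ H)} {x y : ExteriorAlgebra ℂ H}
    (hx : x ≠ 0) (hA : A = Submodule.span ℂ {x}) (hB : B = Submodule.span ℂ {y})
    {a : A →ₗ[ℂ] B} (ha : a ≠ 0) : ∃ a' : B →ₗ[ℂ] A, IsInvElt a a' := by
  have hxA : x ∈ A := hA ▸ Submodule.mem_span_singleton_self x
  have h0 : (a ⟨x, hxA⟩ : ExteriorAlgebra ℂ H) ≠ 0 := fun h => hx
    (congrArg Subtype.val (lineHom_apply_eq_zero hA ha (v := ⟨x, hxA⟩) (Subtype.ext h)))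
  have hB' : B = Submodule.span ℂ {(a ⟨x, hxA⟩ : ExteriorAlgebra ℂ H)} := by
    obtain ⟨k, hk⟩ := exists_smul_eq_of_span hB (a ⟨x, hxA⟩)
    have hk0 : IsUnit k := isUnit_iff_ne_zero.2 fun h => h0 (by rw [hk, h, zero_smul])
    rw [hk, Submodule.span_singleton_smul_eq hk0, hB]
  obtain ⟨a', ha'⟩ := exists_lineHom (B := A) hB' h0 hxA
  refine ⟨a', fun v w hvw => ?_⟩
  obtain ⟨k, hk⟩ := exists_smul_eq_of_span hA v
  have hv : v = k • ⟨x, hxA⟩ := Subtype.ext hk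
  have hw : w = k • a ⟨x, hxA⟩ := Subtype.ext (by rw [hvw, hv, map_smul])
  rw [hw, map_smul, Submodule.coe_smul, ha' _ rfl, hk]

/-- The identifications of the lines are kept as hypotheses because exchanging two points gives
equal, but not definitionally equal, determinant lines. -/
lemma exists_isInvElt_of_eq {A B A' B' : Submodule ℂ (ExteriorAlgebra ℂ H)}
    {x y : ExteriorAlgebra ℂ H} (hB' : A = B') (hA' : B = A') (hx : x ≠ 0)
    (hA : A = Submodule.span ℂ {x}) (hB : B = Submodule.span ℂ {y}) {a : A →ₗ[ℂ] B} (ha : a ≠ 0) :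
    ∃ a' : A' →ₗ[ℂ] B', IsInvElt a a' ∧ IsInvElt a' a := by
  subst hA' hB'
  obtain ⟨a', ha'⟩ := exists_isInvElt hx hA hB ha
  exact ⟨a', ha', ha'.symm rfl hx hA hB rfl⟩

end InvElt

/-! ### Antisymmetry of the multiplication relation -/

section BasicSectionProperties

variable {H : Type u} [NormedAddCommGroup H] [InnerProductSpace ℂ H] [CompleteSpace H]
  {Γ : Subgroup (unitary (H →L[ℂ] H))}

lemma toOp_fib12 (t : BasicY3 Γ) : toOp Γ t.1.2.1.g = toOp Γ t.1.1.g := congrArg _ t.2.1.symm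

lemma exists_detPos_eq_span (hfd : ∀ (g : Γ) (z z' : Circle), z ≠ 1 → z' ≠ 1 →
    FiniteDimensional ℂ (eigenSum z z' (toOp Γ g))) (q : BasicY2 Γ) :
    ∃ x : ExteriorAlgebra ℂ H, x ≠ 0 ∧ detPos q = Submodule.span ℂ {x} := by
  have := hfd q.1.1.g q.1.1.z q.1.2.z q.1.1.2.1 q.1.2.2.1
  exact exists_detLine_eq_span _

lemma exists_detNeg_eq_span (hfd : ∀ (g : Γ) (z z' : Circle), z ≠ 1 → z' ≠ 1 →
    FiniteDimensional ℂ (eigenSum z z' (toOp Γ g))) (q : BasicY2 Γ) :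
    ∃ x : ExteriorAlgebra ℂ H, x ≠ 0 ∧ detNeg q = Submodule.span ℂ {x} := by
  have := hfd q.1.1.g q.1.2.z q.1.1.z q.1.2.2.1 q.1.1.2.1
  exact exists_detLine_eq_span _

lemma neg_one_pow_mul_self (n : ℕ) : (-1 : ℂ) ^ n * (-1) ^ n = 1 := by
  rw [← mul_pow, neg_one_mul, neg_neg, one_pow]

/-- The scalars k, l, m, n are the commutation signs met when x is moved to the right past c and r,
and a past b and y. Moving both elements turns the old equation into the new one. -/
lemma smul_mul_mul_rotate {Λ : Type*} [Ring Λ] [Algebra ℂ Λ] {a b c r x y : Λ} {k l m n : ℂ}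
    (hl : l * l = 1) (hn : n * n = 1) (hxc : x * c = k • (c * x)) (hxr : x * r = l • (r * x))
    (hab : a * b = m • (b * a)) (hay : a * y = n • (y * a))
    (h : n • (a * b * y) = k • (c * r * x)) : l • (x * c * r) = m • (b * y * a) := by
  rw [hxc, smul_mul_assoc, mul_assoc, hxr, mul_smul_comm, smul_comm k, smul_smul l l, hl, one_smul,
    ← mul_assoc, ← h, hab, smul_mul_assoc, mul_assoc, hay, mul_smul_comm, smul_comm m, smul_smul n n,
    hn, one_smul, ← mul_assoc]

/-- Antisymmetry of the multiplication relation under exchange of the first two points. -/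
lemma IsBasicMul.swap12 (hfd : ∀ (g : Γ) (z z' : Circle), z ≠ 1 → z' ≠ 1 →
    FiniteDimensional ℂ (eigenSum z z' (toOp Γ g))) {t : BasicY3 Γ} {a : BasicL t.p12}
    {b : BasicL t.p23} {c : BasicL t.p13} (h : IsBasicMul t a b c) {a' : BasicL t.swap12.p12}
    (ha' : IsInvElt a a') : IsBasicMul t.swap12 a' c b := by
  intro x' y r
  have e := toOp_fib12 t
  obtain ⟨u, hu, hN⟩ := exists_detNeg_eq_span hfd t.p12
  obtain ⟨v, hv, hP⟩ := exists_detPos_eq_span hfd t.p12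
  have hx' : (x' : ExteriorAlgebra ℂ H) ∈ detPos t.p12 :=
    (show detNeg t.swap12.p12 = detPos t.p12 from
      congrArg (fun T => detLine (eigenSum t.1.1.z t.1.2.1.z T)) e).le x'.2
  -- The inverse is specified only on values of a, but a is onto, being a non-zero map between
  -- lines.
  obtain ⟨x, hx⟩ := exists_lineHom_apply_eq hN hu hP (ha'.ne_zero hu hN) ⟨x', hx'⟩
  have hx2 : (x' : ExteriorAlgebra ℂ H) = a x := by rw [hx]
  have hrel := h x r y
  rw [ha' x x' hx2, hx2]
  have mx : (x : ExteriorAlgebra ℂ H) ∈ detLine (eigenSum t.1.2.1.z t.1.1.z (toOp Γ t.1.1.g)) := x.2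
  have ma : (a x : ExteriorAlgebra ℂ H) ∈
    detLine (eigenSum t.1.1.z t.1.2.1.z (toOp Γ t.1.1.g)) := (a x).2
  have mc : (c y : ExteriorAlgebra ℂ H) ∈
    detLine (eigenSum t.1.1.z t.1.2.2.z (toOp Γ t.1.1.g)) := (c y).2
  have my : (y : ExteriorAlgebra ℂ H) ∈ detLine (eigenSum t.1.2.2.z t.1.1.z (toOp Γ t.1.1.g)) := y.2
  have mb : (b r : ExteriorAlgebra ℂ H) ∈
    detLine (eigenSum t.1.2.1.z t.1.2.2.z (toOp Γ t.1.1.g)) := e ▸ (b r).2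
  have mr : (r : ExteriorAlgebra ℂ H) ∈
    detLine (eigenSum t.1.2.2.z t.1.2.1.z (toOp Γ t.1.1.g)) := e ▸ r.2
  have e1 : rankPos t.swap12.p12 =
      Module.finrank ℂ (eigenSum t.1.2.1.z t.1.1.z (toOp Γ t.1.1.g)) := e ▸ rfl
  have e2 : rankNeg t.swap12.p13 =
      Module.finrank ℂ (eigenSum t.1.2.2.z t.1.2.1.z (toOp Γ t.1.1.g)) := e ▸ rfl
  have e3 : rankNeg t.swap12.p12 =
      Module.finrank ℂ (eigenSum t.1.1.z t.1.2.1.z (toOp Γ t.1.1.g)) := e ▸ rfl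
  have e4 : rankPos t.swap12.p13 =
      Module.finrank ℂ (eigenSum t.1.2.1.z t.1.2.2.z (toOp Γ t.1.1.g)) := e ▸ rfl
  have f1 : rankPos t.p12 =
      Module.finrank ℂ (eigenSum t.1.1.z t.1.2.1.z (toOp Γ t.1.1.g)) := rfl
  have f2 : rankNeg t.p13 =
      Module.finrank ℂ (eigenSum t.1.2.2.z t.1.1.z (toOp Γ t.1.1.g)) := rfl
  have f3 : rankNeg t.p12 =
      Module.finrank ℂ (eigenSum t.1.2.1.z t.1.1.z (toOp Γ t.1.1.g)) := rfl
  have f4 : rankPos t.p13 =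
      Module.finrank ℂ (eigenSum t.1.1.z t.1.2.2.z (toOp Γ t.1.1.g)) := rfl
  rw [f1, f2, f3, f4] at hrel
  rw [e1, e2, e3, e4]
  -- The signs in `IsBasicMul` are precisely the commutation signs of the pairs of lines involved,
  -- before and after the exchange.
  exact smul_mul_mul_rotate (neg_one_pow_mul_self _) (neg_one_pow_mul_self _)
    (detLine_mul_comm mx mc) (detLine_mul_comm mx mr) (detLine_mul_comm ma mb)
    (detLine_mul_comm ma my) hrel

/-- Antisymmetry of the multiplication relation under exchange of the last two points. -/
lemma IsBasicMul.swap23 (hfd : ∀ (g : Γ) (z z' : Circle), z ≠ 1 → z' ≠ 1 →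
    FiniteDimensional ℂ (eigenSum z z' (toOp Γ g))) {t : BasicY3 Γ} {a : BasicL t.p12}
    {b : BasicL t.p23} {c : BasicL t.p13} (h : IsBasicMul t a b c) {b' : BasicL t.swap23.p23}
    (hb' : IsInvElt b b') : IsBasicMul t.swap23 c b' a := by
  intro r y' x
  have e : toOp Γ t.1.2.2.g = toOp Γ t.1.2.1.g := congrArg _ t.2.2.symm
  obtain ⟨u, hu, hN⟩ := exists_detNeg_eq_span hfd t.p23
  obtain ⟨v, hv, hP⟩ := exists_detPos_eq_span hfd t.p23
  have hy' : (y' : ExteriorAlgebra ℂ H) ∈ detPos t.p23 :=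
    (show detNeg t.swap23.p23 = detPos t.p23 from
      congrArg (fun T => detLine (eigenSum t.1.2.1.z t.1.2.2.z T)) e).le y'.2
  obtain ⟨y, hy⟩ := exists_lineHom_apply_eq hN hu hP (hb'.ne_zero hu hN) ⟨y', hy'⟩
  have hy2 : (y' : ExteriorAlgebra ℂ H) = b y := by rw [hy]
  -- With y' = b y and b' y' = y the new equation is the old one read from right to left, with the
  -- two signs exchanged.
  have hrel := (h x y r).symm
  rw [mul_comm (rankNeg t.p12), mul_comm (rankPos t.p12)] at hrel
  rw [hb' y y' hy2, hy2]
  exact hrel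

end BasicSectionProperties
-- Existence and uniqueness of the section, and associativity
section BasicSectionExistence

variable {H : Type u} [NormedAddCommGroup H] [InnerProductSpace ℂ H] [CompleteSpace H]
  {Γ : Subgroup (unitary (H →L[ℂ] H))}

/-- The multiplication on `L`. -/
noncomputable def basicMul (hfd : ∀ (g : Γ) (z z' : Circle), z ≠ 1 → z' ≠ 1 →
    FiniteDimensional ℂ (eigenSum z z' (toOp Γ g))) (t : BasicY3 Γ) :
    BasicL t.p12 →ₗ[ℂ] BasicL t.p23 →ₗ[ℂ] BasicL t.p13 :=
  (exists_basicMul hfd t).choose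

variable (hfd : ∀ (g : Γ) (z z' : Circle), z ≠ 1 → z' ≠ 1 →
    FiniteDimensional ℂ (eigenSum z z' (toOp Γ g)))

lemma isBasicMul_iff {t : BasicY3 Γ} {a : BasicL t.p12} {b : BasicL t.p23} {c : BasicL t.p13} :
    IsBasicMul t a b c ↔ c = basicMul hfd t a b :=
  (exists_basicMul hfd t).choose_spec.1 a b c

lemma isBasicMul_basicMul (t : BasicY3 Γ) (a : BasicL t.p12) (b : BasicL t.p23) :
    IsBasicMul t a b (basicMul hfd t a b) := (isBasicMul_iff hfd).2 rfl

lemma basicMul_ne_zero (t : BasicY3 Γ) (a : BasicL t.p12) (b : BasicL t.p23) (ha : a ≠ 0)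
    (hb : b ≠ 0) : basicMul hfd t a b ≠ 0 := (exists_basicMul hfd t).choose_spec.2 a b ha hb

lemma BasicY.z_ne_one (y : BasicY Γ) : y.z ≠ 1 := y.2.1

lemma rankNeg_eq_zero {q : BasicY2 Γ} (h : CircLE q.1.2.z q.1.1.z) : rankNeg q = 0 := by
  rw [rankNeg, eigenSum_eq_bot_of_le q.1.1.z_ne_one h, finrank_bot]

lemma detNeg_eq_span_one {q : BasicY2 Γ} (h : CircLE q.1.2.z q.1.1.z) :
    detNeg q = Submodule.span ℂ {1} := by
  rw [detNeg, eigenSum_eq_bot_of_le q.1.1.z_ne_one h, detLine_bot]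

lemma CircLE.trans_of_fib {t : BasicY3 Γ} (h1 : CircLE t.1.2.1.z t.1.1.z)
    (h2 : CircLE t.1.2.2.z t.1.2.1.z) : CircLE t.1.2.2.z t.1.1.z := by
  rw [circLE_iff t.1.1.z_ne_one] at h1 ⊢
  rw [circLE_iff t.1.2.1.z_ne_one] at h2
  exact h2.trans h1

/-- For decreasing z the negative ranks vanish, so the signs are trivial and the relation at x = y =
r = 1 is the wedge formula. Antisymmetry is that of the relation, combined with uniqueness of its
solution. -/
lemma isBasicSection_basicMul : IsBasicSection (basicMul hfd) where
  wedge t h1 h2 a b x y r hx hy hr := by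
    have h := isBasicMul_basicMul hfd t a b x y r
    rw [rankNeg_eq_zero (q := t.p12) h1, rankNeg_eq_zero (q := t.p13) (h1.trans_of_fib h2), hx, hy,
      hr] at h
    simpa using h.symm
  antisymm12 t a b a' ha' :=
    ((isBasicMul_iff hfd).1 ((isBasicMul_basicMul hfd t a b).swap12 hfd ha')).symm
  antisymm23 t a b b' hb' :=
    ((isBasicMul_iff hfd).1 ((isBasicMul_basicMul hfd t a b).swap23 hfd hb')).symm

/-- For decreasing z all three source lines are spanned by 1, so the wedge formula at 1 already
implies the whole relation. -/
lemma IsBasicSection.isBasicMul_of_le {s : ∀ t : BasicY3 Γ,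
    BasicL t.p12 →ₗ[ℂ] BasicL t.p23 →ₗ[ℂ] BasicL t.p13} (hs : IsBasicSection s) {t : BasicY3 Γ}
    (h1 : CircLE t.1.2.1.z t.1.1.z) (h2 : CircLE t.1.2.2.z t.1.2.1.z) (a : BasicL t.p12)
    (b : BasicL t.p23) : IsBasicMul t a b (s t a b) := by
  have e1 := detNeg_eq_span_one (q := t.p12) h1
  have e2 := detNeg_eq_span_one (q := t.p23) h2
  have e3 := detNeg_eq_span_one (q := t.p13) (h1.trans_of_fib h2)
  have m1 : 1 ∈ detNeg t.p12 := e1 ▸ Submodule.mem_span_singleton_self 1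
  have m2 : 1 ∈ detNeg t.p23 := e2 ▸ Submodule.mem_span_singleton_self 1
  have m3 : 1 ∈ detNeg t.p13 := e3 ▸ Submodule.mem_span_singleton_self 1
  refine IsMulRel.of_generators (y₁ := a ⟨1, m1⟩) (y₂ := b ⟨1, m2⟩) (y₃ := s t a b ⟨1, m3⟩)
    e1 e2 e3 ?_ ?_ ?_ ?_
  · intro v hv
    rw [show v = ⟨1, m1⟩ from Subtype.ext hv]
  · intro v hv
    rw [show v = ⟨1, m2⟩ from Subtype.ext hv]
  · intro v hv
    rw [show v = ⟨1, m3⟩ from Subtype.ext hv]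
  · rw [rankNeg_eq_zero (q := t.p12) h1, rankNeg_eq_zero (q := t.p13) (h1.trans_of_fib h2),
      hs.wedge t h1 h2 a b ⟨1, m1⟩ ⟨1, m2⟩ ⟨1, m3⟩ rfl rfl rfl]
    simp

set_option maxHeartbeats 1000000 in
-- Let a be the inverse of a' and put b = a' b', computed with `basicMul`. Antisymmetry of the
-- relation gives a b = b', and s agrees with `basicMul` at t, so s(a, b) = b'. Antisymmetry of s
-- now yields s(a', b') = b at the exchanged point. If a' = 0 there is no inverse, but both sides
-- vanish.
lemma IsBasicSection.isBasicMul_swap12 (hfd : ∀ (g : Γ) (z z' : Circle), z ≠ 1 → z' ≠ 1 →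
    FiniteDimensional ℂ (eigenSum z z' (toOp Γ g))) {s : ∀ t : BasicY3 Γ,
    BasicL t.p12 →ₗ[ℂ] BasicL t.p23 →ₗ[ℂ] BasicL t.p13} (hs : IsBasicSection s) {t : BasicY3 Γ}
    (h : ∀ a b, IsBasicMul t a b (s t a b)) (a' : BasicL t.swap12.p12) (b' : BasicL t.swap12.p23) :
    IsBasicMul t.swap12 a' b' (s t.swap12 a' b') := by
  rcases eq_or_ne a' 0 with rfl | ha'
  · rw [map_zero, LinearMap.zero_apply]
    exact IsMulRel.zero_left
  obtain ⟨u, hu, hN⟩ := exists_detNeg_eq_span hfd t.swap12.p12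
  obtain ⟨v, hv, hP⟩ := exists_detPos_eq_span hfd t.swap12.p12
  have e := toOp_fib12 t
  have e1 : detNeg t.swap12.p12 = detPos t.p12 :=
    congrArg (fun T => detLine (eigenSum t.1.1.z t.1.2.1.z T)) e
  have e2 : detPos t.swap12.p12 = detNeg t.p12 :=
    congrArg (fun T => detLine (eigenSum t.1.2.1.z t.1.1.z T)) e
  obtain ⟨a, ha, ha''⟩ := exists_isInvElt_of_eq e1 e2 hu hN hP ha'
  have hb2 : IsBasicMul t a (basicMul hfd t.swap12 a' b') b' :=
    (isBasicMul_basicMul hfd t.swap12 a' b').swap12 hfd ha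
  have hb3 : b' = s t a (basicMul hfd t.swap12 a' b') :=
    ((isBasicMul_iff hfd).1 hb2).trans ((isBasicMul_iff hfd).1 (h a _)).symm
  have hb4 := hs.antisymm12 t a (basicMul hfd t.swap12 a' b') a' ha''
  rw [← hb3] at hb4
  exact (isBasicMul_iff hfd).2 hb4

set_option maxHeartbeats 1000000 in
-- The same argument as for the first two points, inverting b' instead of a'.
lemma IsBasicSection.isBasicMul_swap23 (hfd : ∀ (g : Γ) (z z' : Circle), z ≠ 1 → z' ≠ 1 →
    FiniteDimensional ℂ (eigenSum z z' (toOp Γ g))) {s : ∀ t : BasicY3 Γ,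
    BasicL t.p12 →ₗ[ℂ] BasicL t.p23 →ₗ[ℂ] BasicL t.p13} (hs : IsBasicSection s) {t : BasicY3 Γ}
    (h : ∀ a b, IsBasicMul t a b (s t a b)) (a' : BasicL t.swap23.p12) (b' : BasicL t.swap23.p23) :
    IsBasicMul t.swap23 a' b' (s t.swap23 a' b') := by
  rcases eq_or_ne b' 0 with rfl | hb'
  · rw [map_zero]
    exact IsMulRel.zero_right
  obtain ⟨u, hu, hN⟩ := exists_detNeg_eq_span hfd t.swap23.p23
  obtain ⟨v, hv, hP⟩ := exists_detPos_eq_span hfd t.swap23.p23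
  have e : toOp Γ t.1.2.2.g = toOp Γ t.1.2.1.g := congrArg _ t.2.2.symm
  have e1 : detNeg t.swap23.p23 = detPos t.p23 :=
    congrArg (fun T => detLine (eigenSum t.1.2.1.z t.1.2.2.z T)) e
  have e2 : detPos t.swap23.p23 = detNeg t.p23 :=
    congrArg (fun T => detLine (eigenSum t.1.2.2.z t.1.2.1.z T)) e
  obtain ⟨b, hb, hb''⟩ := exists_isInvElt_of_eq e1 e2 hu hN hP hb'
  have ha2 : IsBasicMul t (basicMul hfd t.swap23 a' b') b a' :=
    (isBasicMul_basicMul hfd t.swap23 a' b').swap23 hfd hb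
  have ha3 : a' = s t (basicMul hfd t.swap23 a' b') b :=
    ((isBasicMul_iff hfd).1 ha2).trans ((isBasicMul_iff hfd).1 (h _ b)).symm
  have ha4 := hs.antisymm23 t (basicMul hfd t.swap23 a' b') b b' hb''
  rw [← ha3] at ha4
  exact (isBasicMul_iff hfd).2 ha4

lemma IsBasicSection.eq_basicMul {s : ∀ t : BasicY3 Γ,
    BasicL t.p12 →ₗ[ℂ] BasicL t.p23 →ₗ[ℂ] BasicL t.p13} (hs : IsBasicSection s) :
    s = basicMul hfd := by
  have key : ∀ t : BasicY3 Γ, ∀ a b, IsBasicMul t a b (s t a b) := by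
    intro t
    have s12 : ∀ t : BasicY3 Γ, (∀ a b, IsBasicMul t a b (s t a b)) →
      ∀ a b, IsBasicMul t.swap12 a b (s t.swap12 a b) := fun t => hs.isBasicMul_swap12 hfd
    have s23 : ∀ t : BasicY3 Γ, (∀ a b, IsBasicMul t a b (s t a b)) →
      ∀ a b, IsBasicMul t.swap23 a b (s t.swap23 a b) := fun t => hs.isBasicMul_swap23 hfd
    -- Every triple becomes decreasing after at most three adjacent transpositions, and applying the
    -- same transposition twice gives back the triple definitionally.
    rcases circle_order_cases t.1.1.2.1 t.1.2.1.2.1 t.1.2.2.2.1 with h | h | h | h | h | h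
    · exact hs.isBasicMul_of_le h.1 h.2.1
    · exact s12 t.swap12 (hs.isBasicMul_of_le h.1 h.2.1)
    · exact s23 t.swap23 (hs.isBasicMul_of_le h.1 h.2.1)
    · exact s12 t.swap12 (s23 t.swap12.swap23 (hs.isBasicMul_of_le h.1 h.2.1))
    · exact s23 t.swap23 (s12 t.swap23.swap12 (hs.isBasicMul_of_le h.1 h.2.1))
    · exact s12 t.swap12 (s23 t.swap12.swap23 (s12 t.swap12.swap23.swap12
        (hs.isBasicMul_of_le h.1 h.2.1)))
  funext t
  exact LinearMap.ext₂ fun a b => (isBasicMul_iff hfd).1 (key t a b)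

/-- `e` is the element of `L` given by a generator system. -/
def IsGenerator (θ : Circle → Circle → ExteriorAlgebra ℂ H) (q : BasicY2 Γ) (e : BasicL q) : Prop :=
  ∀ v : detNeg q, (v : ExteriorAlgebra ℂ H) = θ q.1.2.z q.1.1.z →
    (e v : ExteriorAlgebra ℂ H) = θ q.1.1.z q.1.2.z

lemma IsGeneratorSystem.exists_isGenerator {T : H →L[ℂ] H} {S : Set Circle}
    {θ : Circle → Circle → ExteriorAlgebra ℂ H} (hθ : IsGeneratorSystem T S θ) {q : BasicY2 Γ}
    (hT : toOp Γ q.1.1.g = T) (h1 : q.1.1.z ∈ S) (h2 : q.1.2.z ∈ S) :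
    ∃ e : BasicL q, IsGenerator θ q e ∧ ∀ a : BasicL q, ∃ k : ℂ, a = k • e := by
  have hN : detNeg q = Submodule.span ℂ {θ q.1.2.z q.1.1.z} := by
    rw [← hθ.span _ h2 _ h1, ← hT]; rfl
  have hP : detPos q = Submodule.span ℂ {θ q.1.1.z q.1.2.z} := by
    rw [← hθ.span _ h1 _ h2, ← hT]; rfl
  obtain ⟨e, he⟩ := exists_lineHom (B := detPos q) hN (hθ.ne_zero _ h2 _ h1)
    (hP ▸ Submodule.mem_span_singleton_self _)
  obtain ⟨φ, hφ⟩ := exists_lineHom_coord hN hP (hθ.ne_zero _ h1 _ h2) he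
  exact ⟨e, he, fun a => ⟨φ a, hφ a⟩⟩

/-- In the trivialisation of L given by a generator system the product is e₁₂ e₂₃ = e₁₃, with no
sign left over, for every order of the points. -/
lemma IsGeneratorSystem.basicMul_eq {T : H →L[ℂ] H} {S : Set Circle}
    {θ : Circle → Circle → ExteriorAlgebra ℂ H} (hθ : IsGeneratorSystem T S θ) {t : BasicY3 Γ}
    (hT : toOp Γ t.1.1.g = T) (h1 : t.1.1.z ∈ S) (h2 : t.1.2.1.z ∈ S) (h3 : t.1.2.2.z ∈ S)
    {e₁ : BasicL t.p12} {e₂ : BasicL t.p23} {e₃ : BasicL t.p13} (he₁ : IsGenerator θ t.p12 e₁)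
    (he₂ : IsGenerator θ t.p23 e₂) (he₃ : IsGenerator θ t.p13 e₃) :
    basicMul hfd t e₁ e₂ = e₃ := by
  subst hT
  have e := toOp_fib12 t
  refine ((isBasicMul_iff hfd).1 ?_).symm
  have h23 : detNeg t.p23 = Submodule.span ℂ {θ t.1.2.2.z t.1.2.1.z} := by
    rw [← hθ.span _ h3 _ h2, ← e]; rfl
  exact .of_generators (hθ.span _ h2 _ h1) h23
    (hθ.span _ h3 _ h1) he₁ he₂ he₃ (hθ.relation h1 h2 h3).1

lemma bilinear_assoc {M₁₂ M₂₃ M₃₄ M₁₃ M₂₄ M₁₄ : Type*} [AddCommGroup M₁₂] [AddCommGroup M₂₃]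
    [AddCommGroup M₃₄] [AddCommGroup M₁₃] [AddCommGroup M₂₄] [AddCommGroup M₁₄] [Module ℂ M₁₂]
    [Module ℂ M₂₃] [Module ℂ M₃₄] [Module ℂ M₁₃] [Module ℂ M₂₄] [Module ℂ M₁₄]
    (s₁₂₃ : M₁₂ →ₗ[ℂ] M₂₃ →ₗ[ℂ] M₁₃) (s₁₃₄ : M₁₃ →ₗ[ℂ] M₃₄ →ₗ[ℂ] M₁₄)
    (s₂₃₄ : M₂₃ →ₗ[ℂ] M₃₄ →ₗ[ℂ] M₂₄) (s₁₂₄ : M₁₂ →ₗ[ℂ] M₂₄ →ₗ[ℂ] M₁₄) {e₁₂ : M₁₂} {e₂₃ : M₂₃}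
    {e₃₄ : M₃₄} {e₁₃ : M₁₃} {e₂₄ : M₂₄} {e₁₄ : M₁₄} (h₁₂₃ : s₁₂₃ e₁₂ e₂₃ = e₁₃)
    (h₁₃₄ : s₁₃₄ e₁₃ e₃₄ = e₁₄) (h₂₃₄ : s₂₃₄ e₂₃ e₃₄ = e₂₄) (h₁₂₄ : s₁₂₄ e₁₂ e₂₄ = e₁₄)
    {a : M₁₂} {b : M₂₃} {c : M₃₄} (ha : ∃ k : ℂ, a = k • e₁₂) (hb : ∃ k : ℂ, b = k • e₂₃)
    (hc : ∃ k : ℂ, c = k • e₃₄) : s₁₃₄ (s₁₂₃ a b) c = s₁₂₄ a (s₂₃₄ b c) := by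
  obtain ⟨α, rfl⟩ := ha
  obtain ⟨β, rfl⟩ := hb
  obtain ⟨γ, rfl⟩ := hc
  simp only [map_smul, LinearMap.smul_apply, h₁₂₃, h₁₃₄, h₂₃₄, h₁₂₄, smul_smul, mul_assoc]

/-- A point of `Y^[2]`. -/
def fibPair (y₁ y₂ : BasicY Γ) (h : y₁.g = y₂.g) : BasicY2 Γ := ⟨(y₁, y₂), h⟩

/-- A point of `Y^[3]`. -/
def fibTriple (y₁ y₂ y₃ : BasicY Γ) (h : y₁.g = y₂.g) (h' : y₂.g = y₃.g) : BasicY3 Γ :=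
  ⟨(y₁, y₂, y₃), h, h'⟩

/-- The multiplication on `L`, in terms of points of `Y`. -/
noncomputable def pointMul (y₁ y₂ y₃ : BasicY Γ) (h : y₁.g = y₂.g) (h' : y₂.g = y₃.g) :
    BasicL (fibPair y₁ y₂ h) →ₗ[ℂ] BasicL (fibPair y₂ y₃ h') →ₗ[ℂ]
      BasicL (fibPair y₁ y₃ (h.trans h')) :=
  basicMul hfd (fibTriple y₁ y₂ y₃ h h')

lemma IsGeneratorSystem.pointMul_eq {T : H →L[ℂ] H} {S : Set Circle}
    {θ : Circle → Circle → ExteriorAlgebra ℂ H} (hθ : IsGeneratorSystem T S θ) {y₁ y₂ y₃ : BasicY Γ}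
    {h : y₁.g = y₂.g} {h' : y₂.g = y₃.g} (hT : toOp Γ y₁.g = T) (h1 : y₁.z ∈ S) (h2 : y₂.z ∈ S)
    (h3 : y₃.z ∈ S) {e₁ : BasicL (fibPair y₁ y₂ h)} {e₂ : BasicL (fibPair y₂ y₃ h')}
    {e₃ : BasicL (fibPair y₁ y₃ (h.trans h'))} (he₁ : IsGenerator θ _ e₁)
    (he₂ : IsGenerator θ _ e₂) (he₃ : IsGenerator θ _ e₃) :
    pointMul hfd y₁ y₂ y₃ h h' e₁ e₂ = e₃ :=
  hθ.basicMul_eq hfd (t := fibTriple y₁ y₂ y₃ h h') hT h1 h2 h3 he₁ he₂ he₃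

set_option maxHeartbeats 400000 in
lemma IsGeneratorSystem.pointMul_assoc {T : H →L[ℂ] H} {S : Set Circle}
    {θ : Circle → Circle → ExteriorAlgebra ℂ H} (hθ : IsGeneratorSystem T S θ)
    {y₁ y₂ y₃ y₄ : BasicY Γ} (h : y₁.g = y₂.g) (h' : y₂.g = y₃.g)
    (h'' : y₃.g = y₄.g) (g1 : toOp Γ y₁.g = T) (g2 : toOp Γ y₂.g = T)
    (m1 : y₁.z ∈ S) (m2 : y₂.z ∈ S)
    (m3 : y₃.z ∈ S) (m4 : y₄.z ∈ S)
    {e12 : BasicL (fibPair y₁ y₂ h)} {e23 : BasicL (fibPair y₂ y₃ h')}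
    {e34 : BasicL (fibPair y₃ y₄ h'')}
    {e13 : BasicL (fibPair y₁ y₃ (h.trans h'))}
    {e24 : BasicL (fibPair y₂ y₄ (h'.trans h''))}
    {e14 : BasicL (fibPair y₁ y₄ ((h.trans h').trans h''))}
    (h12 : IsGenerator θ _ e12) (h23 : IsGenerator θ _ e23) (h34 : IsGenerator θ _ e34)
    (h13 : IsGenerator θ _ e13) (h24 : IsGenerator θ _ e24) (h14 : IsGenerator θ _ e14)
    {a : BasicL (fibPair y₁ y₂ h)} {b : BasicL (fibPair y₂ y₃ h')}
    {c : BasicL (fibPair y₃ y₄ h'')} (ka : ∃ k : ℂ, a = k • e12) (kb : ∃ k : ℂ, b = k • e23)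
    (kc : ∃ k : ℂ, c = k • e34) :
    pointMul hfd y₁ y₃ y₄ (h.trans h') h'' (pointMul hfd y₁ y₂ y₃ h h' a b) c =
      pointMul hfd y₁ y₂ y₄ h (h'.trans h'') a (pointMul hfd y₂ y₃ y₄ h' h'' b c) := by
  have A1 := hθ.pointMul_eq hfd g1 m1 m2 m3 h12 h23 h13
  have A2 := hθ.pointMul_eq hfd g1 m1 m3 m4 h13 h34 h14
  have A3 := hθ.pointMul_eq hfd g2 m2 m3 m4 h23 h34 h24
  have A4 := hθ.pointMul_eq hfd g1 m1 m2 m4 h12 h24 h14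
  refine @bilinear_assoc (BasicL (fibPair y₁ y₂ h)) (BasicL (fibPair y₂ y₃ h')) (BasicL (fibPair y₃ y₄ h''))
    (BasicL (fibPair y₁ y₃ (h.trans h'))) (BasicL (fibPair y₂ y₄ (h'.trans h''))) (BasicL (fibPair y₁ y₄ ((h.trans h').trans h'')))
    _ _ _ _ _ _ _ _ _ _ _ _ (pointMul hfd y₁ y₂ y₃ h h') (pointMul hfd y₁ y₃ y₄ (h.trans h') h'')
     (pointMul hfd y₂ y₃ y₄ h' h'') (pointMul hfd y₁ y₂ y₄ h (h'.trans h'')) e12 e23 e34 e13 e24 e14 A1 A2 A3 A4 a b c ka kb kc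

/-- One generator system for all four points trivialises the six lines simultaneously. Both
bracketings then send e₁₂, e₂₃, e₃₄ to e₁₄, and bilinearity gives the rest. -/
lemma pointMul_assoc (y₁ y₂ y₃ y₄ : BasicY Γ) (h : y₁.g = y₂.g) (h' : y₂.g = y₃.g)
    (h'' : y₃.g = y₄.g) (a : BasicL (fibPair y₁ y₂ h)) (b : BasicL (fibPair y₂ y₃ h'))
    (c : BasicL (fibPair y₃ y₄ h'')) :
    pointMul hfd y₁ y₃ y₄ (h.trans h') h'' (pointMul hfd y₁ y₂ y₃ h h' a b) c =
      pointMul hfd y₁ y₂ y₄ h (h'.trans h'') a (pointMul hfd y₂ y₃ y₄ h' h'' b c) :=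
  (exists_isGeneratorSystem_of_finite (hfd y₁.g)
    (S := {y₁.z, y₂.z, y₃.z, y₄.z}) (by
      rintro z (rfl | rfl | rfl | rfl)
      · exact BasicY.admissible rfl
      · exact BasicY.admissible h.symm
      · exact BasicY.admissible (h.trans h').symm
      · exact BasicY.admissible ((h.trans h').trans h'').symm)
    (Set.toFinite _) ⟨_, Or.inl rfl⟩).elim fun _ hθ =>
  have m1 : y₁.z ∈ ({y₁.z, y₂.z, y₃.z, y₄.z} : Set Circle) := by simp
  have m2 : y₂.z ∈ ({y₁.z, y₂.z, y₃.z, y₄.z} : Set Circle) := by simp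
  have m3 : y₃.z ∈ ({y₁.z, y₂.z, y₃.z, y₄.z} : Set Circle) := by simp
  have m4 : y₄.z ∈ ({y₁.z, y₂.z, y₃.z, y₄.z} : Set Circle) := by simp
  have g2 : toOp Γ y₂.g = toOp Γ y₁.g := congrArg _ h.symm
  have g3 : toOp Γ y₃.g = toOp Γ y₁.g := congrArg _ (h.trans h').symm
  (hθ.exists_isGenerator (q := fibPair y₁ y₂ h) rfl m1 m2).elim fun _ k12 =>
  (hθ.exists_isGenerator (q := fibPair y₂ y₃ h') g2 m2 m3).elim fun _ k23 =>
  (hθ.exists_isGenerator (q := fibPair y₃ y₄ h'') g3 m3 m4).elim fun _ k34 =>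
  (hθ.exists_isGenerator (q := fibPair y₁ y₃ (h.trans h')) rfl m1 m3).elim fun _ k13 =>
  (hθ.exists_isGenerator (q := fibPair y₂ y₄ (h'.trans h'')) g2 m2 m4).elim fun _ k24 =>
  (hθ.exists_isGenerator (q := fibPair y₁ y₄ ((h.trans h').trans h'')) rfl m1 m4).elim
    fun _ k14 =>
  hθ.pointMul_assoc hfd h h' h'' rfl g2 m1 m2 m3 m4 k12.1 k23.1 k34.1 k13.1 k24.1 k14.1
    (k12.2 a) (k23.2 b) (k34.2 c)

lemma basicMul_assoc (t : Fib4 (BasicY.g : BasicY Γ → Γ)) (a : BasicL t.p123.p12)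
    (b : BasicL t.p123.p23) (c : BasicL t.p234.p23) :
    basicMul hfd t.p134 (basicMul hfd t.p123 a b) c =
      basicMul hfd t.p124 a (basicMul hfd t.p234 b c) :=
  pointMul_assoc hfd t.1.1 t.1.2.1 t.1.2.2.1 t.1.2.2.2 t.2.1 t.2.2.1 t.2.2.2 a b c

end BasicSectionExistence

/-! ### The action on the line bundle -/

section BasicAction

/-- The relation involves only products and scalars, so an algebra endomorphism that intertwines the
three maps carries it along. -/
lemma IsMulRel.map {Λ : Type*} [Ring Λ] [Algebra ℂ Λ]
    {A₁ A₂ A₃ B₁ B₂ B₃ A₁' A₂' A₃' B₁' B₂' B₃' : Submodule ℂ Λ} {σ τ σ' τ' : ℂ}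
    {a : A₁ →ₗ[ℂ] B₁} {b : A₂ →ₗ[ℂ] B₂} {c : A₃ →ₗ[ℂ] B₃}
    {a' : A₁' →ₗ[ℂ] B₁'} {b' : A₂' →ₗ[ℂ] B₂'} {c' : A₃' →ₗ[ℂ] B₃'} (φ : Λ →ₐ[ℂ] Λ)
    (hσ : σ' = σ) (hτ : τ' = τ) (ha : ∀ x' : A₁', ∃ x : A₁, φ x = x' ∧ (a' x' : Λ) = φ (a x))
    (hb : ∀ x' : A₂', ∃ x : A₂, φ x = x' ∧ (b' x' : Λ) = φ (b x))
    (hc : ∀ x' : A₃', ∃ x : A₃, φ x = x' ∧ (c' x' : Λ) = φ (c x))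
    (h : IsMulRel σ τ a b c) : IsMulRel σ' τ' a' b' c' := by
  subst hσ hτ
  intro x' y' r'
  obtain ⟨x, hx, hx'⟩ := ha x'
  obtain ⟨y, hy, hy'⟩ := hb y'
  obtain ⟨r, hr, hr'⟩ := hc r'
  rw [← hx, hx', ← hy, hy', ← hr, hr', ← map_mul, ← map_mul, ← map_mul, ← map_mul, ← map_smul,
    ← map_smul, h x y r]

variable {H : Type u} [NormedAddCommGroup H] [InnerProductSpace ℂ H] [CompleteSpace H]
  {Γ : Subgroup (unitary (H →L[ℂ] H))}

lemma extMap_one : extMap (1 : Γ) = AlgHom.id ℂ (ExteriorAlgebra ℂ H) :=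
  ExteriorAlgebra.map_id

lemma extMap_mul (k k' : Γ) : extMap (k * k') = (extMap k).comp (extMap k') :=
  (ExteriorAlgebra.map_comp_map _ _).symm

lemma extMap_mul_apply (k k' : Γ) (x : ExteriorAlgebra ℂ H) :
    extMap (k * k') x = extMap k (extMap k' x) := by
  rw [extMap_mul]; rfl

lemma extMap_extMap_inv (k : Γ) (x : ExteriorAlgebra ℂ H) : extMap k (extMap k⁻¹ x) = x := by
  rw [← extMap_mul_apply, mul_inv_cancel, extMap_one]; rfl

lemma extMap_inv_extMap (k : Γ) (x : ExteriorAlgebra ℂ H) : extMap k⁻¹ (extMap k x) = x := by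
  rw [← extMap_mul_apply, inv_mul_cancel, extMap_one]; rfl

lemma extMap_ιMulti (k : Γ) {n : ℕ} (v : Fin n → H) :
    extMap k (ExteriorAlgebra.ιMulti ℂ n v) =
      ExteriorAlgebra.ιMulti ℂ n fun i => toOp Γ k (v i) :=
  ExteriorAlgebra.map_apply_ιMulti _ v

lemma coe_basicAct_apply (k : ConjAct Γ) (q : BasicY2 Γ) (a : BasicL q)
    (x : detNeg (q.smul BasicY.g_smul k)) :
    (basicAct k q a x : ExteriorAlgebra ℂ H) = extMap (ConjAct.ofConjAct k)
      (a ⟨extMap (ConjAct.ofConjAct k)⁻¹ x, extMap_inv_mem k _ _ _ x.2⟩) := rfl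

lemma coe_basicAct_eq (k : ConjAct Γ) (q : BasicY2 Γ) (a : BasicL q)
    {x : detNeg (q.smul BasicY.g_smul k)} {y : detNeg q}
    (h : (x : ExteriorAlgebra ℂ H) = extMap (ConjAct.ofConjAct k) y) :
    (basicAct k q a x : ExteriorAlgebra ℂ H) = extMap (ConjAct.ofConjAct k) (a y) := by
  rw [coe_basicAct_apply]
  have e : (⟨extMap (ConjAct.ofConjAct k)⁻¹ x, extMap_inv_mem k _ _ _ x.2⟩ : detNeg q) = y :=
    Subtype.ext ((congrArg (extMap (ConjAct.ofConjAct k)⁻¹) h).trans (extMap_inv_extMap _ _))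
  rw [e]

lemma exists_coe_basicAct_eq (k : ConjAct Γ) (q : BasicY2 Γ) (a : BasicL q)
    (x' : detNeg (q.smul BasicY.g_smul k)) :
    ∃ x : detNeg q, extMap (ConjAct.ofConjAct k) (x : ExteriorAlgebra ℂ H) = x' ∧
      (basicAct k q a x' : ExteriorAlgebra ℂ H) = extMap (ConjAct.ofConjAct k) (a x) :=
  ⟨⟨extMap (ConjAct.ofConjAct k)⁻¹ x', extMap_inv_mem k _ _ _ x'.2⟩, extMap_extMap_inv _ _, rfl⟩

lemma toOp_injective (k : Γ) : Function.Injective (toOp Γ k) :=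
  Function.LeftInverse.injective (g := toOp Γ k⁻¹) fun v =>
    congrArg (fun T : H →L[ℂ] H => T v) (toOp_inv_mul k)

lemma finrank_eigenSum_conj (k : ConjAct Γ) (z₁ z₂ : Circle) (g : Γ) :
    Module.finrank ℂ (eigenSum z₁ z₂ (toOp Γ (k • g))) =
      Module.finrank ℂ (eigenSum z₁ z₂ (toOp Γ g)) := by
  rw [← eigenSum_conj_eq, ← (Submodule.equivMapOfInjective
    (toOp Γ (ConjAct.ofConjAct k) : H →ₗ[ℂ] H) (toOp_injective _) _).finrank_eq]

lemma rankPos_smul (k : ConjAct Γ) (q : BasicY2 Γ) :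
    rankPos (q.smul BasicY.g_smul k) = rankPos q := finrank_eigenSum_conj k _ _ _

lemma rankNeg_smul (k : ConjAct Γ) (q : BasicY2 Γ) :
    rankNeg (q.smul BasicY.g_smul k) = rankNeg q := finrank_eigenSum_conj k _ _ _

lemma IsBasicMul.smul {t : BasicY3 Γ} {a : BasicL t.p12} {b : BasicL t.p23} {c : BasicL t.p13}
    (h : IsBasicMul t a b c) (k : ConjAct Γ) :
    IsBasicMul (t.smul BasicY.g_smul k) (basicAct k t.p12 a) (basicAct k t.p23 b)
      (basicAct k t.p13 c) := by
  have e1 : rankPos (t.smul BasicY.g_smul k).p12 = rankPos t.p12 := rankPos_smul k t.p12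
  have e2 : rankNeg (t.smul BasicY.g_smul k).p12 = rankNeg t.p12 := rankNeg_smul k t.p12
  have e3 : rankPos (t.smul BasicY.g_smul k).p13 = rankPos t.p13 := rankPos_smul k t.p13
  have e4 : rankNeg (t.smul BasicY.g_smul k).p13 = rankNeg t.p13 := rankNeg_smul k t.p13
  exact IsMulRel.map (extMap (ConjAct.ofConjAct k)) (congrArg₂ (fun m n => (-1) ^ (m * n)) e1 e4)
    (congrArg₂ (fun m n => (-1) ^ (m * n)) e2 e3) (exists_coe_basicAct_eq k t.p12 a)
    (exists_coe_basicAct_eq k t.p23 b) (exists_coe_basicAct_eq k t.p13 c) h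

/-- The translated elements satisfy the translated relation, whose solution is unique. -/
lemma basicMul_smul (hfd : ∀ (g : Γ) (z z' : Circle), z ≠ 1 → z' ≠ 1 →
    FiniteDimensional ℂ (eigenSum z z' (toOp Γ g))) (k : ConjAct Γ) (t : BasicY3 Γ)
    (a : BasicL t.p12) (b : BasicL t.p23) :
    basicMul hfd (t.smul BasicY.g_smul k) (basicAct k t.p12 a) (basicAct k t.p23 b) =
      basicAct k t.p13 (basicMul hfd t a b) :=
  ((isBasicMul_iff hfd).1 ((isBasicMul_basicMul hfd t a b).smul k)).symm

/-- Comparing values in the ambient exterior algebra avoids transport between fibres over points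
that are equal only propositionally. -/
lemma basicL_sigma_ext {q q' : BasicY2 Γ} (h : q = q') {a : BasicL q} {b : BasicL q'}
    (hab : ∀ (x : detNeg q) (y : detNeg q'), (x : ExteriorAlgebra ℂ H) = y →
      (a x : ExteriorAlgebra ℂ H) = b y) : (⟨q, a⟩ : Σ q, BasicL q) = ⟨q', b⟩ := by
  subst h
  exact congrArg (Sigma.mk q) (LinearMap.ext fun x => Subtype.ext (hab x x rfl))

lemma fib2_smul_one (q : BasicY2 Γ) : q.smul BasicY.g_smul (1 : ConjAct Γ) = q :=
  Subtype.ext (Prod.ext (one_smul _ _) (one_smul _ _))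

lemma fib2_smul_mul (k k' : ConjAct Γ) (q : BasicY2 Γ) : q.smul BasicY.g_smul (k * k') =
    (q.smul BasicY.g_smul k').smul BasicY.g_smul k :=
  Subtype.ext (Prod.ext (mul_smul _ _ _) (mul_smul _ _ _))

lemma basicAct_one (q : BasicY2 Γ) (a : BasicL q) :
    (⟨q.smul BasicY.g_smul (1 : ConjAct Γ), basicAct 1 q a⟩ : Σ q, BasicL q) = ⟨q, a⟩ := by
  have e (x : ExteriorAlgebra ℂ H) : extMap (ConjAct.ofConjAct (1 : ConjAct Γ)) x = x := by
    rw [ConjAct.ofConjAct_one, extMap_one]; rfl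
  refine basicL_sigma_ext (fib2_smul_one q) fun x y h => ?_
  rw [coe_basicAct_eq 1 q a (y := y) (h.trans (e _).symm), e]

lemma basicAct_mul (k k' : ConjAct Γ) (q : BasicY2 Γ) (a : BasicL q) :
    (⟨q.smul BasicY.g_smul (k * k'), basicAct (k * k') q a⟩ : Σ q, BasicL q) =
      ⟨(q.smul BasicY.g_smul k').smul BasicY.g_smul k,
        basicAct k (q.smul BasicY.g_smul k') (basicAct k' q a)⟩ := by
  refine basicL_sigma_ext (fib2_smul_mul k k' q) fun x y h => ?_
  exact (exists_coe_basicAct_eq k (q.smul BasicY.g_smul k') (basicAct k' q a) y).elim fun y' h1 =>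
    (exists_coe_basicAct_eq k' q a y').elim fun y'' h2 =>
    (coe_basicAct_eq (k * k') q a (x := x) (y := y'')
      (h.trans (h1.1.symm.trans ((congrArg (extMap (ConjAct.ofConjAct k)) h2.1.symm).trans
        (extMap_mul_apply _ _ _).symm)))).trans
    ((extMap_mul_apply (ConjAct.ofConjAct k) (ConjAct.ofConjAct k') _).trans
      ((congrArg (extMap (ConjAct.ofConjAct k)) h2.2.symm).trans h1.2.symm))

end BasicAction

/-! ### Spectral projections of unitary operators -/

section RieszProjection

/-- The integral over a circle, as a continuous linear map. -/
noncomputable def circleIntegralCLM (E : Type*) [NormedAddCommGroup E] [NormedSpace ℂ E] (m : ℂ)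
    (r : ℝ) : C(Metric.sphere m |r|, E) →L[ℂ] E :=
  LinearMap.mkContinuous
    { toFun := fun f => ∫ φ in (0 : ℝ)..2 * Real.pi,
        deriv (circleMap m r) φ • f ⟨circleMap m r φ, circleMap_mem_sphere' m r φ⟩
      map_add' := fun f g => by
        rw [← intervalIntegral.integral_add]
        · simp only [ContinuousMap.add_apply, smul_add]
        all_goals
          refine Continuous.intervalIntegrable ?_ _ _
          simp only [deriv_circleMap]
          fun_prop
      map_smul' := fun k f => by
        rw [RingHom.id_apply, ← intervalIntegral.integral_smul]
        simp only [ContinuousMap.smul_apply, smul_comm k] }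
    (|r| * |2 * Real.pi - 0|) fun f => by
      refine (intervalIntegral.norm_integral_le_of_norm_le_const (C := |r| * ‖f‖)
        fun φ _ => ?_).trans_eq (by ring)
      rw [norm_smul, deriv_circleMap, norm_mul, Complex.norm_I, mul_one, norm_circleMap_zero]
      exact mul_le_mul_of_nonneg_left (f.norm_coe_le_norm _) (abs_nonneg r)

lemma circleIntegralCLM_apply {E : Type*} [NormedAddCommGroup E] [NormedSpace ℂ E] (m : ℂ)
    (r : ℝ) (f : C(Metric.sphere m |r|, E)) :
    circleIntegralCLM E m r f = ∫ φ in (0 : ℝ)..2 * Real.pi,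
      deriv (circleMap m r) φ • f ⟨circleMap m r φ, circleMap_mem_sphere' m r φ⟩ := rfl

lemma ContinuousLinearMap.comp_circleIntegralCLM {E F : Type*} [NormedAddCommGroup E]
    [NormedSpace ℂ E] [NormedAddCommGroup F] [NormedSpace ℂ F] [CompleteSpace E] [CompleteSpace F]
    (A : E →L[ℂ] F) (m : ℂ) (r : ℝ)
    (f : C(Metric.sphere m |r|, E)) : A (circleIntegralCLM E m r f) =
      circleIntegralCLM F m r ((A : C(E, F)).comp f) := by
  rw [circleIntegralCLM_apply, circleIntegralCLM_apply,
    ← ContinuousLinearMap.intervalIntegral_comp_comm]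
  · simp
  · refine Continuous.intervalIntegrable ?_ _ _
    simp only [deriv_circleMap]
    fun_prop

lemma circleIntegralCLM_eq {E : Type*} [NormedAddCommGroup E] [NormedSpace ℂ E] {m : ℂ}
    {r : ℝ} {f : C(Metric.sphere m |r|, E)} {g : ℂ → E} (h : ∀ ζ, f ζ = g ζ) :
    circleIntegralCLM E m r f = ∮ ζ in C(m, r), g ζ := by
  rw [circleIntegralCLM_apply, circleIntegral]
  simp only [h]

variable {H : Type*} [NormedAddCommGroup H] [InnerProductSpace ℂ H]

/-- The function `ζ ↦ ζ - T` on a circle. -/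
noncomputable def resolventDenom (m : ℂ) (r : ℝ) (T : H →L[ℂ] H) :
    C(Metric.sphere m |r|, H →L[ℂ] H) where
  toFun ζ := algebraMap ℂ (H →L[ℂ] H) ζ - T
  continuous_toFun := ((algebraMapCLM ℂ (H →L[ℂ] H)).continuous.comp continuous_subtype_val).sub
    continuous_const

variable [CompleteSpace H] {m : ℂ} {r : ℝ} {T : H →L[ℂ] H}

lemma isUnit_resolventDenom (h : ∀ ζ ∈ Metric.sphere m |r|, ζ ∉ spectrum ℂ T) :
    IsUnit (resolventDenom m r T) :=
  (ContinuousMap.isUnit_iff_forall_isUnit _).2 fun ζ => spectrum.notMem_iff.1 (h ζ ζ.2)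

lemma notMem_spectrum_of_isUnit_resolventDenom (h : IsUnit (resolventDenom m r T)) {ζ : ℂ}
    (hζ : ζ ∈ Metric.sphere m |r|) : ζ ∉ spectrum ℂ T :=
  spectrum.notMem_iff.2 ((ContinuousMap.isUnit_iff_forall_isUnit _).1 h ⟨ζ, hζ⟩)

lemma contDiff_resolventDenom (m : ℂ) (r : ℝ) :
    ContDiff ℝ ∞ (resolventDenom m r : (H →L[ℂ] H) → C(Metric.sphere m |r|, H →L[ℂ] H)) := by
  have e : (resolventDenom m r : (H →L[ℂ] H) → C(Metric.sphere m |r|, H →L[ℂ] H)) =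
      fun T => resolventDenom m r 0 - ContinuousLinearMap.const ℝ (Metric.sphere m |r|) T := by
    funext T
    ext ζ : 1
    show algebraMap ℂ (H →L[ℂ] H) ζ - T = algebraMap ℂ (H →L[ℂ] H) ζ - 0 - T
    rw [sub_zero]
  rw [e]
  fun_prop

/-- The Riesz projection `(2πi)⁻¹ ∮ (ζ - T)⁻¹ dζ`. -/
noncomputable def riesz (m : ℂ) (r : ℝ) (T : H →L[ℂ] H) : H →L[ℂ] H :=
  (2 * Real.pi * Complex.I : ℂ)⁻¹ •
    circleIntegralCLM (H →L[ℂ] H) m r (Ring.inverse (resolventDenom m r T))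

/-- The projection is a composite of an affine map into the Banach algebra of continuous
operator-valued functions on the circle, inversion in that algebra, and the bounded linear integral.
No differentiation under the integral sign is needed. -/
lemma contDiffAt_riesz (h : IsUnit (resolventDenom m r T)) : ContDiffAt ℝ ∞ (riesz m r) T := by
  obtain ⟨U, hU⟩ := h
  have h1 : ContDiffAt ℝ ∞ (Ring.inverse : C(Metric.sphere m |r|, H →L[ℂ] H) → _)
    (resolventDenom m r T) := hU ▸ contDiffAt_ringInverse ℝ U
  have h2 := h1.comp T (contDiff_resolventDenom m r).contDiffAt
  exact (((circleIntegralCLM (H →L[ℂ] H) m r).restrictScalars ℝ).contDiff.contDiffAt.comp T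
    h2).const_smul _

lemma eventually_isUnit_resolventDenom (h : IsUnit (resolventDenom m r T)) :
    ∀ᶠ T' in 𝓝 T, IsUnit (resolventDenom m r T') :=
  (contDiff_resolventDenom m r).continuous.continuousAt.eventually
    (Units.isOpen.mem_nhds h)

lemma inverse_resolventDenom_apply (h : IsUnit (resolventDenom m r T))
    (ζ : Metric.sphere m |r|) :
    Ring.inverse (resolventDenom m r T) ζ * (algebraMap ℂ (H →L[ℂ] H) ζ - T) = 1 :=
  congrArg (fun f : C(Metric.sphere m |r|, H →L[ℂ] H) => f ζ) (Ring.inverse_mul_cancel _ h)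

lemma inverse_resolventDenom_apply_eigenvector (h : IsUnit (resolventDenom m r T))
    (ζ : Metric.sphere m |r|) {μ : ℂ} {v : H} (hv : T v = μ • v) (hμ : (ζ : ℂ) ≠ μ) :
    Ring.inverse (resolventDenom m r T) ζ v = ((ζ : ℂ) - μ)⁻¹ • v := by
  have h1 := congrArg (fun A : H →L[ℂ] H => A v) (inverse_resolventDenom_apply h ζ)
  have h2 : (algebraMap ℂ (H →L[ℂ] H) ζ - T) v = ((ζ : ℂ) - μ) • v := by
    rw [sub_apply, hv, sub_smul, ContinuousLinearMap.algebraMap_apply]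
  simp only [mul_apply_eq_comp, h2, map_smul, one_apply_eq_self] at h1
  rw [← h1, smul_smul, h1, inv_mul_cancel₀ (sub_ne_zero.2 hμ), one_smul]

/-- On an eigenvector the resolvent is the scalar (ζ - μ)⁻¹, so the projection acts by the winding
number of the circle around μ. -/
lemma riesz_apply_eigenvector (h : IsUnit (resolventDenom m r T)) {μ : ℂ} {v : H}
    (hv : T v = μ • v) (hμ : μ ∉ Metric.sphere m |r|) :
    riesz m r T v = ((2 * Real.pi * Complex.I : ℂ)⁻¹ * ∮ ζ in C(m, r), (ζ - μ)⁻¹) • v := by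
  have h1 := ContinuousLinearMap.comp_circleIntegralCLM (ContinuousLinearMap.apply ℂ H v) m r
    (Ring.inverse (resolventDenom m r T))
  rw [circleIntegralCLM_eq (g := fun ζ => (ζ - μ)⁻¹ • v) fun ζ =>
    inverse_resolventDenom_apply_eigenvector h ζ hv fun h => hμ (h ▸ ζ.2),
    circleIntegral.integral_smul_const] at h1
  rw [riesz, smul_apply, mul_smul, ← h1]
  rfl

lemma circleIntegral_inv_sub_of_notMem {μ : ℂ} (hr : 0 ≤ r) (hμ : μ ∉ Metric.closedBall m r) :
    ∮ ζ in C(m, r), (ζ - μ)⁻¹ = 0 := by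
  have hd : ∀ ζ ∈ Metric.closedBall m r, DifferentiableAt ℂ (fun ζ => (ζ - μ)⁻¹) ζ :=
    fun ζ hζ => (differentiableAt_id.sub_const μ).inv (sub_ne_zero.2 fun h => hμ (h ▸ hζ))
  exact Complex.circleIntegral_eq_zero_of_differentiable_on_off_countable hr Set.countable_empty
    (fun ζ hζ => (hd ζ hζ).continuousAt.continuousWithinAt)
    fun ζ hζ => hd ζ (Metric.ball_subset_closedBall hζ.1)

lemma riesz_apply_of_mem (h : IsUnit (resolventDenom m r T)) {μ : ℂ} {v : H}
    (hv : T v = μ • v) (hμ : μ ∈ Metric.ball m r) : riesz m r T v = v := by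
  have hr : |r| = r := abs_of_pos (Metric.pos_of_mem_ball hμ)
  rw [riesz_apply_eigenvector h hv (hr.symm ▸ fun h' => (Metric.mem_sphere.1 h' ▸
    Metric.mem_ball.1 hμ).false), circleIntegral.integral_sub_inv_of_mem_ball hμ,
    inv_mul_cancel₀ Complex.two_pi_I_ne_zero, one_smul]

lemma riesz_apply_of_notMem (h : IsUnit (resolventDenom m r T)) {μ : ℂ} {v : H} (hr : 0 ≤ r)
    (hv : T v = μ • v) (hμ : μ ∉ Metric.closedBall m r) : riesz m r T v = 0 := by
  rw [riesz_apply_eigenvector h hv fun h' => hμ (Metric.sphere_subset_closedBall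
    (abs_of_nonneg hr ▸ h')), circleIntegral_inv_sub_of_notMem hr hμ, mul_zero, zero_smul]

/-- Use (ζ - T)⁻¹ = (ζ - 1)⁻¹ + (ζ - 1)⁻¹ (ζ - T)⁻¹ (T - 1). The scalar term integrates to zero
because 1 is outside the closed disc, and what remains is a bounded operator composed with T - 1. -/
lemma isCompactOperator_riesz (h : IsUnit (resolventDenom m r T)) (hr : 0 ≤ r)
    (hT : IsCompactOperator (T - 1 : H →L[ℂ] H)) (h1 : (1 : ℂ) ∉ Metric.closedBall m r) :
    IsCompactOperator (riesz m r T) := by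
  have hs (ζ : Metric.sphere m |r|) : (ζ : ℂ) - 1 ≠ 0 := sub_ne_zero.2 fun h' => h1
    (Metric.sphere_subset_closedBall (by
      have := ζ.2
      rwa [h', abs_of_nonneg hr] at this))
  let G : C(Metric.sphere m |r|, ℂ) :=
    ⟨fun ζ => ((ζ : ℂ) - 1)⁻¹, (continuous_subtype_val.sub continuous_const).inv₀ hs⟩
  let Q : C(Metric.sphere m |r|, H →L[ℂ] H) :=
    ⟨fun ζ => G ζ • Ring.inverse (resolventDenom m r T) ζ, by fun_prop⟩
  have e : riesz m r T = ((2 * Real.pi * Complex.I : ℂ)⁻¹ • circleIntegralCLM _ m r Q) ∘L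
      (T - 1) := by
    ext v
    have e1 := ContinuousLinearMap.comp_circleIntegralCLM (ContinuousLinearMap.apply ℂ H v) m r
      (Ring.inverse (resolventDenom m r T))
    have e2 := ContinuousLinearMap.comp_circleIntegralCLM
      (ContinuousLinearMap.apply ℂ H ((T - 1) v)) m r Q
    have e3 : (ContinuousLinearMap.apply ℂ H v : C(H →L[ℂ] H, H)).comp
        (Ring.inverse (resolventDenom m r T)) =
      (⟨fun ζ => G ζ • v, by fun_prop⟩ : C(Metric.sphere m |r|, H)) +
        (ContinuousLinearMap.apply ℂ H ((T - 1) v) : C(H →L[ℂ] H, H)).comp Q := by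
      ext ζ
      have h1 := congrArg (fun A : H →L[ℂ] H => A v) (inverse_resolventDenom_apply h ζ)
      have h2 : (algebraMap ℂ (H →L[ℂ] H) ζ - T) v = ((ζ : ℂ) - 1) • v - (T - 1) v := by
        rw [sub_apply, sub_apply, sub_smul, ContinuousLinearMap.algebraMap_apply, one_smul,
          one_apply_eq_self]
        abel
      simp only [mul_apply_eq_comp, h2, map_sub, map_smul, one_apply_eq_self] at h1
      show Ring.inverse (resolventDenom m r T) ζ v = ((ζ : ℂ) - 1)⁻¹ • v +
        ((ζ : ℂ) - 1)⁻¹ • Ring.inverse (resolventDenom m r T) ζ ((T - 1) v)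
      rw [← smul_add, eq_inv_smul_iff₀ (hs ζ), ← sub_eq_iff_eq_add]
      exact h1
    rw [e3, map_add, ← e2, circleIntegralCLM_eq (g := fun ζ => (ζ - 1)⁻¹ • v) fun ζ => rfl,
      circleIntegral.integral_smul_const, circleIntegral_inv_sub_of_notMem hr h1, zero_smul,
      zero_add] at e1
    exact congrArg (fun w => (2 * Real.pi * Complex.I : ℂ)⁻¹ • w) e1
  rw [e]
  exact hT.clm_comp ((2 * Real.pi * Complex.I : ℂ)⁻¹ • circleIntegralCLM (H →L[ℂ] H) m r Q)

end RieszProjection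

/-! ### Eigenvectors of unitary operators that differ from 1 by a compact operator -/

section UnitaryEigenvectors

variable {H : Type*} [NormedAddCommGroup H] [InnerProductSpace ℂ H] [CompleteSpace H]
  {T : H →L[ℂ] H}

lemma norm_eq_one_of_unitary_eigenvector (hT : T ∈ unitary (H →L[ℂ] H)) {μ : ℂ} {v : H}
    (hv : T v = μ • v) (h0 : v ≠ 0) : ‖μ‖ = 1 := by
  have h1 : ‖T v‖ = ‖v‖ := (Unitary.linearIsometryEquiv ⟨T, hT⟩).norm_map v
  rw [hv, norm_smul] at h1
  exact (mul_eq_right₀ (norm_ne_zero_iff.2 h0)).1 h1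

lemma adjoint_apply_of_unitary_eigenvector (hT : T ∈ unitary (H →L[ℂ] H)) {μ : ℂ} {v : H}
    (hv : T v = μ • v) : star T v = μ⁻¹ • v := by
  rcases eq_or_ne v 0 with rfl | h0
  · simp
  have hμ : μ ≠ 0 := fun h => by
    simpa [h] using norm_eq_one_of_unitary_eigenvector hT hv h0
  have h1 : star T (T v) = v := congrArg (fun A : H →L[ℂ] H => A v) (Unitary.star_mul_self_of_mem hT)
  rw [hv, map_smul] at h1
  rw [eq_inv_smul_iff₀ hμ, h1]

/-- A generalised eigenvector of a unitary operator is an eigenvector. -/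
lemma unitary_eigenvector_of_sq (hT : T ∈ unitary (H →L[ℂ] H)) {μ : ℂ} {v : H}
    (hv : T (T v - μ • v) = μ • (T v - μ • v)) : T v = μ • v := by
  by_contra hne
  have h0 : T v - μ • v ≠ 0 := sub_ne_zero.2 hne
  have hμ := norm_eq_one_of_unitary_eigenvector hT hv h0
  have h1 := adjoint_apply_of_unitary_eigenvector hT hv
  refine h0 (inner_self_eq_zero (𝕜 := ℂ).1 ?_)
  set w := T v - μ • v with hw
  have h2 : ⟪w, T v⟫_ℂ = ⟪star T w, v⟫_ℂ := (ContinuousLinearMap.adjoint_inner_left T v w).symm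
  have h3 : starRingEnd ℂ μ⁻¹ = μ := by
    rw [Complex.inv_eq_conj hμ, Complex.conj_conj]
  -- The vector w = T v - μ v is an eigenvector, hence one of T* with eigenvalue μ⁻¹; moving T
  -- across the inner product shows that w is orthogonal to itself.
  calc ⟪w, w⟫_ℂ = ⟪w, T v⟫_ℂ - μ * ⟪w, v⟫_ℂ := by
        conv_lhs => rw [hw, inner_sub_right, inner_smul_right]
    _ = 0 := by rw [h2, h1, inner_smul_left, h3, sub_self]

/-- Applying T gives T² v = s T v - v, so (T - μ)(T - μ⁻¹) v = 0 for a root μ of X² - s X + 1. If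
the roots differ, v is a combination of the eigenvectors T v - μ v and T v - μ⁻¹ v; if they
coincide, v is a generalised eigenvector and hence an eigenvector. -/
lemma mem_iSup_eigenspace_of_apply_add_star (hT : T ∈ unitary (H →L[ℂ] H)) {s : ℂ} {v : H}
    (hv : T v + star T v = s • v) :
    v ∈ ⨆ μ : ℂ, Module.End.eigenspace (T : H →ₗ[ℂ] H) μ := by
  obtain ⟨μ, hμ⟩ : ∃ μ : ℂ, μ * μ - s * μ + 1 = 0 := by
    obtain ⟨μ, hμ⟩ := exists_quadratic_eq_zero (a := 1) (b := -s) (c := 1) one_ne_zero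
      (IsAlgClosed.exists_eq_mul_self _)
    exact ⟨μ, by linear_combination hμ⟩
  have hμ0 : μ ≠ 0 := by rintro rfl; simp at hμ
  have hs : s = μ + μ⁻¹ := by field_simp; linear_combination -hμ
  have h1 : T (star T v) = v := congrArg (fun A : H →L[ℂ] H => A v) (Unitary.mul_star_self_of_mem hT)
  have h2 : T (T v) = s • T v - v := by
    have := congrArg T hv
    rw [map_add, h1, map_smul] at this
    rw [← this]; abel
  have mem {ν : ℂ} {w : H} (h : T w = ν • w) :
      w ∈ ⨆ μ : ℂ, Module.End.eigenspace (T : H →ₗ[ℂ] H) μ :=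
    Submodule.mem_iSup_of_mem ν (Module.End.mem_eigenspace_iff.2 h)
  have h3 : T (T v - μ • v) = μ⁻¹ • (T v - μ • v) := by
    rw [map_sub, map_smul, h2, hs, smul_sub, add_smul, smul_smul, inv_mul_cancel₀ hμ0]
    module
  have h4 : T (T v - μ⁻¹ • v) = μ • (T v - μ⁻¹ • v) := by
    rw [map_sub, map_smul, h2, hs, smul_sub, add_smul, smul_smul, mul_inv_cancel₀ hμ0]
    module
  rcases eq_or_ne μ⁻¹ μ with h | h
  · rw [h] at h3
    exact mem (unitary_eigenvector_of_sq hT h3)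
  · have e : v = (μ - μ⁻¹)⁻¹ • ((T v - μ⁻¹ • v) - (T v - μ • v)) := by
      rw [eq_inv_smul_iff₀ (sub_ne_zero.2 h.symm)]
      module
    rw [e]
    exact Submodule.smul_mem _ _ (Submodule.sub_mem _ (mem h4) (mem h3))

/-- The eigenvectors of a unitary operator `T` with `T - 1` compact span a dense subspace. -/
lemma dense_iSup_eigenspace_of_isCompactOperator (hT : T ∈ unitary (H →L[ℂ] H))
    (hc : IsCompactOperator (T - 1 : H →L[ℂ] H)) :
    (⨆ μ : ℂ, Module.End.eigenspace (T : H →ₗ[ℂ] H) μ).topologicalClosure = ⊤ := by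
  rw [Submodule.topologicalClosure_eq_top_iff, eq_bot_iff]
  obtain ⟨K, hK⟩ : ∃ K : H →L[ℂ] H, K = T - 1 := ⟨_, rfl⟩
  rw [← hK] at hc
  -- The operator S = (T - 1)* (T - 1) = 2 - (T + T*) is compact and self-adjoint, so the spectral
  -- theorem applies to it; each of its eigenvectors is a sum of eigenvectors of T.
  obtain ⟨S, hSK⟩ : ∃ S : H →L[ℂ] H, S = star K * K := ⟨_, rfl⟩
  have hS : IsCompactOperator S := by
    rw [hSK]
    exact hc.clm_comp (star K)
  have hS' : S.IsSymmetric := by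
    rw [hSK]
    exact (IsSelfAdjoint.star_mul_self K).isSymmetric
  rw [← ContinuousLinearMap.orthogonalComplement_iSup_eigenspaces_eq_bot hS hS']
  refine Submodule.orthogonal_le (iSup_le fun s v hv => ?_)
  have h1 : S v = s • v := Module.End.mem_eigenspace_iff.1 hv
  have h2 : S = 2 - (T + star T) := by
    rw [hSK, hK, star_sub, star_one, sub_mul, mul_sub, Unitary.star_mul_self_of_mem hT, mul_one, one_mul]
    rw [← one_add_one_eq_two]
    abel
  refine mem_iSup_eigenspace_of_apply_add_star hT (s := 2 - s) ?_
  have h3 : (2 : H →L[ℂ] H) v = (2 : ℂ) • v := by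
    rw [← one_add_one_eq_two, add_apply, one_apply_eq_self, two_smul]
  rw [h2, sub_apply, add_apply, h3] at h1
  rw [sub_smul, ← h1]
  abel

/-- If the eigenvalues in an arc are those in a disc, then the Riesz projection of the disc maps
onto the sum of their eigenspaces. -/
lemma riesz_mem_eigenSum (hT : T ∈ unitary (H →L[ℂ] H))
    (hc : IsCompactOperator (T - 1 : H →L[ℂ] H)) {m : ℂ} {r : ℝ} (hr : 0 ≤ r)
    (hu : IsUnit (resolventDenom m r T)) {z z' : Circle}
    (hball : ∀ μ : Circle, (μ : ℂ) ∈ Metric.ball m r → CircLT z' μ ∧ CircLT μ z)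
    [FiniteDimensional ℂ (eigenSum z z' T)] (v : H) : riesz m r T v ∈ eigenSum z z' T := by
  have h1 : (⨆ μ : ℂ, Module.End.eigenspace (T : H →ₗ[ℂ] H) μ) ≤
      (eigenSum z z' T).comap (riesz m r T : H →ₗ[ℂ] H) := by
    refine iSup_le fun μ v hv => ?_
    have hv : T v = μ • v := Module.End.mem_eigenspace_iff.1 hv
    show riesz m r T v ∈ eigenSum z z' T
    rcases eq_or_ne v 0 with rfl | h0
    · rw [map_zero]; exact zero_mem _
    by_cases hb : μ ∈ Metric.ball m r
    · rw [riesz_apply_of_mem hu hv hb]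
      obtain ⟨μ', rfl⟩ : ∃ μ' : Circle, (μ' : ℂ) = μ :=
        ⟨⟨μ, by simpa [Submonoid.unitSphere] using norm_eq_one_of_unitary_eigenvector hT hv h0⟩, rfl⟩
      exact Submodule.mem_iSup_of_mem μ' (Submodule.mem_iSup_of_mem (hball μ' hb)
        (Module.End.mem_eigenspace_iff.2 hv))
    · rw [riesz_apply_of_notMem hu hr hv fun h => ?_]
      · exact zero_mem _
      · rw [← Metric.ball_union_sphere] at h
        have hs := h.resolve_left hb
        -- An eigenvalue on the bounding circle is impossible, since the circle lies in the
        -- resolvent set.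
        refine notMem_spectrum_of_isUnit_resolventDenom hu ((abs_of_nonneg hr).symm ▸ hs) ?_
        by_contra hsp
        have := eigenspace_eq_bot hsp
        exact h0 ((Submodule.eq_bot_iff _).1 this v (Module.End.mem_eigenspace_iff.2 hv))
  have h2 := dense_iSup_eigenspace_of_isCompactOperator hT hc
  -- The target is finite dimensional, hence closed, so the inclusion extends from the span of the
  -- eigenvectors to its closure.
  have h3 := (⨆ μ : ℂ, Module.End.eigenspace (T : H →ₗ[ℂ] H) μ).topologicalClosure_minimal h1
    ((eigenSum z z' T).closed_of_finiteDimensional.preimage (riesz m r T).continuous)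
  rw [h2] at h3
  exact h3 (Submodule.mem_top (x := v))

lemma riesz_apply_of_mem_eigenSum {m : ℂ} {r : ℝ} (hu : IsUnit (resolventDenom m r T))
    {z z' : Circle} (hball : ∀ μ : Circle, CircLT z' μ → CircLT μ z → (μ : ℂ) ∈ Metric.ball m r)
    {v : H} (hv : v ∈ eigenSum z z' T) : riesz m r T v = v := by
  have h : eigenSum z z' T ≤ LinearMap.eqLocus (riesz m r T : H →ₗ[ℂ] H) LinearMap.id :=
    iSup₂_le fun μ hμ v hv => riesz_apply_of_mem hu (Module.End.mem_eigenspace_iff.1 hv)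
      (hball μ hμ.1 hμ.2)
  exact h hv

/-- The space lies in the eigenspace of a compact operator, the Riesz projection, for the eigenvalue
1. -/
lemma finiteDimensional_eigenSum {m : ℂ} {r : ℝ} (hr : 0 ≤ r)
    (hu : IsUnit (resolventDenom m r T)) (hc : IsCompactOperator (T - 1 : H →L[ℂ] H))
    (h1 : (1 : ℂ) ∉ Metric.closedBall m r) {z z' : Circle}
    (hball : ∀ μ : Circle, CircLT z' μ → CircLT μ z → (μ : ℂ) ∈ Metric.ball m r) :
    FiniteDimensional ℂ (eigenSum z z' T) := by
  have := ContinuousLinearMap.finite_dimensional_eigenspace (isCompactOperator_riesz hu hr hc h1)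
    1 one_ne_zero
  refine Submodule.finiteDimensional_of_le
    (S₂ := Module.End.eigenspace (riesz m r T : H →ₗ[ℂ] H) (1 : ℂ)) fun v hv =>
    Module.End.mem_eigenspace_iff.2 ?_
  rw [one_smul]
  exact riesz_apply_of_mem_eigenSum hu hball hv

end UnitaryEigenvectors

/-! ### Arcs, discs and smooth frames of spectral subspaces -/

section Arcs

open Real in
-- Chord lengths are governed by cosines of angle differences. Beyond π the cosine increases again,
-- but the bound x < 2π - δ keeps it below cos δ.
lemma cos_lt_cos_iff_of_lt {δ x : ℝ} (h0 : 0 < δ) (hπ : δ < π) (hx : 0 ≤ x) (hx' : x < 2 * π - δ) :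
    (Real.cos δ < Real.cos x ↔ x < δ) ∧ (Real.cos δ = Real.cos x ↔ x = δ) := by
  have hδ : δ ∈ Set.Icc 0 π := ⟨h0.le, hπ.le⟩
  rcases le_or_gt x π with h | h
  · have hx : x ∈ Set.Icc 0 π := ⟨hx, h⟩
    exact ⟨Real.strictAntiOn_cos.lt_iff_gt hδ hx, (Real.injOn_cos.eq_iff hδ hx).trans eq_comm⟩
  · have h1 : Real.cos (2 * π - x) < Real.cos δ :=
      Real.strictAntiOn_cos hδ ⟨by linarith, by linarith⟩ (by linarith)
    rw [Real.cos_two_pi_sub] at h1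
    exact ⟨⟨fun h' => by linarith, fun h' => by linarith⟩, ⟨fun h' => by linarith,
      fun h' => by linarith⟩⟩

lemma dist_circleExp_sq (a b : ℝ) :
    dist (Circle.exp a : ℂ) (Circle.exp b) ^ 2 = 2 - 2 * Real.cos (a - b) := by
  rw [Complex.dist_eq, Complex.sq_norm, Circle.coe_exp, Circle.coe_exp, Complex.normSq_apply,
    Complex.sub_re, Complex.sub_im, Complex.exp_ofReal_mul_I_re, Complex.exp_ofReal_mul_I_im,
    Complex.exp_ofReal_mul_I_re, Complex.exp_ofReal_mul_I_im, Real.cos_sub]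
  linear_combination Real.sin_sq_add_cos_sq a + Real.sin_sq_add_cos_sq b

/-- An arc is the intersection of the unit circle with a disc. -/
lemma exists_ball_of_circLT {z z' : Circle} (h : CircLT z' z) :
    ∃ (m : ℂ) (r : ℝ), 0 ≤ r ∧ (1 : ℂ) ∉ Metric.closedBall m r ∧
      (∀ μ : Circle, (μ : ℂ) ∈ Metric.ball m r ↔ CircLT z' μ ∧ CircLT μ z) ∧
      ∀ μ : Circle, (μ : ℂ) ∈ Metric.sphere m r → μ = z ∨ μ = z' := by
  obtain ⟨h1, hz⟩ := circLT_iff.1 h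
  have h2 := ang_lt_two_pi hz
  have h3 := ang_pos z'
  have hπ := Real.pi_pos
  -- The disc is centred at the midpoint exp(iγ) of the arc, and its radius is the chord from there
  -- to either end point, at angular distance δ.
  obtain ⟨γ, hγ⟩ : ∃ γ, γ = (ang z + ang z') / 2 := ⟨_, rfl⟩
  obtain ⟨δ, hδ⟩ : ∃ δ, δ = (ang z - ang z') / 2 := ⟨_, rfl⟩
  obtain ⟨r, hr0, hr⟩ : ∃ r : ℝ, 0 ≤ r ∧ r ^ 2 = 2 - 2 * Real.cos δ :=
    ⟨√(2 - 2 * Real.cos δ), Real.sqrt_nonneg _,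
      Real.sq_sqrt (by linarith [Real.cos_le_one δ])⟩
  have key (μ : Circle) : (dist (μ : ℂ) (Circle.exp γ) < r ↔ |ang μ - γ| < δ) ∧
      (dist (μ : ℂ) (Circle.exp γ) = r ↔ |ang μ - γ| = δ) := by
    have h4 := dist_circleExp_sq (ang μ) γ
    rw [exp_ang, ← Real.cos_abs] at h4
    have h5 := ang_pos μ
    have h6 := ang_le μ
    have h7 := cos_lt_cos_iff_of_lt (δ := δ) (x := |ang μ - γ|) (by linarith) (by linarith)
      (abs_nonneg _) (abs_lt.2 ⟨by linarith, by linarith⟩)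
    rw [← h7.1, ← h7.2, ← sq_lt_sq₀ dist_nonneg hr0, ← sq_eq_sq₀ dist_nonneg hr0, h4, hr]
    exact ⟨⟨fun h => by linarith, fun h => by linarith⟩, ⟨fun h => by linarith,
      fun h => by linarith⟩⟩
  refine ⟨Circle.exp γ, r, hr0, fun h => ?_, fun μ => ?_, fun μ hμ => ?_⟩
  · have h4 := key 1
    rw [ang_one, Circle.coe_one] at h4
    have h5 : |2 * Real.pi - γ| ≤ δ := by
      rcases (Metric.mem_closedBall.1 h).lt_or_eq with h | h
      · exact (h4.1.1 h).le
      · exact (h4.2.1 h).le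
    rw [abs_le] at h5
    linarith
  · rw [Metric.mem_ball, (key μ).1, circLT_iff, circLT_iff, abs_lt]
    constructor
    · rintro ⟨h4, h5⟩
      refine ⟨⟨by linarith, ?_⟩, by linarith, hz⟩
      rintro rfl
      rw [ang_one] at h5
      linarith
    · rintro ⟨⟨h4, -⟩, h5, -⟩
      exact ⟨by linarith, by linarith⟩
  · have h4 := (key μ).2.1 (Metric.mem_sphere.1 hμ)
    rcases abs_choice (ang μ - γ) with h5 | h5
    · left; apply ang_injective; linarith
    · right; apply ang_injective; linarith

variable {H : Type*} [NormedAddCommGroup H] [InnerProductSpace ℂ H]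

lemma eigenSum_le_of_circLT_iff {T : H →L[ℂ] H} {z z' w w' : Circle}
    (h : ∀ μ : Circle, (μ : ℂ) ∈ spectrum ℂ T → CircLT z' μ → CircLT μ z →
      CircLT w' μ ∧ CircLT μ w) : eigenSum z z' T ≤ eigenSum w w' T := by
  refine iSup₂_le fun μ hμ => ?_
  by_cases hs : (μ : ℂ) ∈ spectrum ℂ T
  · exact le_iSup₂_of_le μ (h μ hs hμ.1 hμ.2) le_rfl
  · rw [eigenspace_eq_bot hs]
    exact bot_le

variable [CompleteSpace H]

lemma isUnit_resolventDenom_of_unitary {T : H →L[ℂ] H} (hT : T ∈ unitary (H →L[ℂ] H)) {m : ℂ}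
    {r : ℝ} (hr : 0 ≤ r) (hs : ∀ μ : Circle, (μ : ℂ) ∈ Metric.sphere m r → (μ : ℂ) ∉ spectrum ℂ T) :
    IsUnit (resolventDenom m r T) := by
  refine isUnit_resolventDenom fun ζ hζ h => ?_
  rw [abs_of_nonneg hr] at hζ
  have h1 := spectrum.subset_circle_of_unitary hT h
  exact hs ⟨ζ, by simpa [Submonoid.unitSphere] using h1⟩ hζ h

/-- The relative position of a point outside the spectrum and the points of the spectrum is
locally constant. -/
lemma eventually_circLT_iff {z₀ : Circle} (h1 : z₀ ≠ 1) {T₀ : H →L[ℂ] H}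
    (hs : (z₀ : ℂ) ∉ spectrum ℂ T₀) : ∀ᶠ p : ℂ × (H →L[ℂ] H) in 𝓝 ((z₀ : ℂ), T₀),
      ∀ z : Circle, (z : ℂ) = p.1 → z ≠ 1 ∧ (z : ℂ) ∉ spectrum ℂ p.2 ∧
        ∀ μ : Circle, (μ : ℂ) ∈ spectrum ℂ p.2 →
          (CircLT z μ ↔ CircLT z₀ μ) ∧ (CircLT μ z ↔ CircLT μ z₀) := by
  have hu : ∀ᶠ p : ℂ × (H →L[ℂ] H) in 𝓝 ((z₀ : ℂ), T₀), p.1 ∉ spectrum ℂ p.2 := by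
    have hc : Continuous fun p : ℂ × (H →L[ℂ] H) => algebraMap ℂ (H →L[ℂ] H) p.1 - p.2 :=
      ((algebraMapCLM ℂ (H →L[ℂ] H)).continuous.comp continuous_fst).sub continuous_snd
    filter_upwards [hc.continuousAt.eventually
      (Units.isOpen.mem_nhds (spectrum.notMem_iff.1 hs))] with p hp
    exact spectrum.notMem_iff.2 hp
  obtain ⟨ε, hε, hεu⟩ := Metric.eventually_nhds_iff.1 hu
  obtain ⟨η, hη, hη'⟩ := Metric.continuousAt_iff.1 (Circle.exp.continuous.continuousAt
    (x := ang z₀)) ε hε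
  obtain ⟨ε₁, hε₁, h3⟩ := Metric.continuousAt_iff.1 (continuousAt_ang h1) η hη
  obtain ⟨ε₂, hε₂, h4⟩ := Metric.eventually_nhds_iff.1 (eventually_ne_nhds h1)
  filter_upwards [Metric.ball_mem_nhds _ (lt_min hε (lt_min hε₁ hε₂))] with p hp z hz
  rw [Metric.mem_ball, lt_min_iff, lt_min_iff] at hp
  obtain ⟨hp1, hp2, hp3⟩ := hp
  have hd : dist z z₀ ≤ dist p ((z₀ : ℂ), T₀) := by
    rw [Prod.dist_eq, ← hz]
    exact le_max_left _ _
  have hz1 : z ≠ 1 := h4 (hd.trans_lt hp3)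
  refine ⟨hz1, hz ▸ hεu hp1, fun μ hμ => ?_⟩
  have h5 : |ang z - ang z₀| < η := h3 (hd.trans_lt hp2)
  -- A point of the circle at angular distance less than η from z₀ is within ε of it, hence in the
  -- resolvent set of all nearby operators. So the spectrum stays at angular distance η, whereas z
  -- is closer, and no spectral point separates z from z₀.
  have h6 : η ≤ |ang μ - ang z₀| := by
    by_contra! h
    have h7 := hη' (x := ang μ) h
    rw [exp_ang, exp_ang] at h7
    refine hεu (y := ((μ : ℂ), p.2)) ?_ hμ
    rw [Prod.dist_eq]
    refine max_lt h7 (lt_of_le_of_lt ?_ hp1)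
    rw [Prod.dist_eq]
    exact le_max_right _ _
  rw [circLT_iff, circLT_iff, circLT_iff, circLT_iff]
  rw [abs_lt] at h5
  rcases le_abs'.1 h6 with h | h
  · exact ⟨⟨fun h' => by linarith, fun h' => by linarith [h'.1]⟩,
      ⟨fun _ => ⟨by linarith, h1⟩, fun _ => ⟨by linarith, hz1⟩⟩⟩
  · exact ⟨⟨fun h' => ⟨by linarith, h'.2⟩, fun h' => ⟨by linarith, h'.2⟩⟩,
      ⟨fun h' => by linarith [h'.1], fun h' => by linarith [h'.1]⟩⟩

/-- The end points move inside gaps of the spectrum. They may therefore be frozen locally, and only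
the dependence on the operator matters for frames. -/
lemma eventually_eigenSum_eq {z₀ w₀ : Circle} (hz1 : z₀ ≠ 1) (hw1 : w₀ ≠ 1) {T₀ : H →L[ℂ] H}
    (hz : (z₀ : ℂ) ∉ spectrum ℂ T₀) (hw : (w₀ : ℂ) ∉ spectrum ℂ T₀) :
    ∀ᶠ p : ℂ × ℂ × (H →L[ℂ] H) in 𝓝 ((z₀ : ℂ), (w₀ : ℂ), T₀), ∀ z w : Circle, (z : ℂ) = p.1 →
      (w : ℂ) = p.2.1 → eigenSum z w p.2.2 = eigenSum z₀ w₀ p.2.2 := by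
  have h1 : Tendsto (fun p : ℂ × ℂ × (H →L[ℂ] H) => (p.1, p.2.2))
      (𝓝 ((z₀ : ℂ), (w₀ : ℂ), T₀)) (𝓝 ((z₀ : ℂ), T₀)) :=
    Continuous.tendsto' (by fun_prop) _ _ rfl
  have h2 : Tendsto (fun p : ℂ × ℂ × (H →L[ℂ] H) => (p.2.1, p.2.2))
      (𝓝 ((z₀ : ℂ), (w₀ : ℂ), T₀)) (𝓝 ((w₀ : ℂ), T₀)) :=
    Continuous.tendsto' (by fun_prop) _ _ rfl
  filter_upwards [h1.eventually (eventually_circLT_iff hz1 hz),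
    h2.eventually (eventually_circLT_iff hw1 hw)] with p hp1 hp2 z w hzp hwp
  have e1 := (hp1 z hzp).2.2
  have e2 := (hp2 w hwp).2.2
  refine le_antisymm (eigenSum_le_of_circLT_iff fun μ hμ h h' => ?_)
    (eigenSum_le_of_circLT_iff fun μ hμ h h' => ?_)
  · exact ⟨(e2 μ hμ).1.1 h, (e1 μ hμ).2.1 h'⟩
  · exact ⟨(e2 μ hμ).1.2 h, (e1 μ hμ).2.2 h'⟩

/-- Smooth local frames for the sums of eigenspaces. -/
lemma exists_smooth_eigenframe {z w : Circle} (hz1 : z ≠ 1) (hw1 : w ≠ 1) {T₀ : H →L[ℂ] H}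
    (hz : (z : ℂ) ∉ spectrum ℂ T₀) (hw : (w : ℂ) ∉ spectrum ℂ T₀) (hT₀ : T₀ ∈ unitary (H →L[ℂ] H))
    (hc₀ : IsCompactOperator (T₀ - 1 : H →L[ℂ] H)) :
    ∃ (d : ℕ) (u : Fin d → (H →L[ℂ] H) → H), ∀ᶠ T in 𝓝 T₀, (∀ i, ContDiffAt ℝ ∞ (u i) T) ∧
      (T ∈ unitary (H →L[ℂ] H) → IsCompactOperator (T - 1 : H →L[ℂ] H) →
        LinearIndependent ℂ (fun i => u i T) ∧
        Submodule.span ℂ (Set.range fun i => u i T) = eigenSum z w T) := by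
  by_cases h : CircLT w z
  swap
  · refine ⟨0, Fin.elim0, Eventually.of_forall fun T => ⟨fun i => i.elim0, fun _ _ =>
      ⟨linearIndependent_empty_type, ?_⟩⟩⟩
    rw [eigenSum_eq_bot h, Set.range_eq_empty, Submodule.span_empty]
  obtain ⟨m, r, hr, h1, hball, hsph⟩ := exists_ball_of_circLT h
  have hu₀ : IsUnit (resolventDenom m r T₀) := by
    refine isUnit_resolventDenom_of_unitary hT₀ hr fun μ hμ => ?_
    rcases hsph μ hμ with rfl | rfl
    · exact hz
    · exact hw
  have hfd₀ := finiteDimensional_eigenSum hr hu₀ hc₀ h1 fun μ h h' => (hball μ).2 ⟨h, h'⟩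
  obtain ⟨d, e, heLI, heE⟩ := exists_frame_of_finiteDimensional (eigenSum z w T₀)
  -- The frame at T is the Riesz projection of T applied to a fixed basis e of the space at T₀.
  refine ⟨d, fun i T => riesz m r T (e i), ?_⟩
  have hnear : ∀ᶠ T in 𝓝 T₀, ‖riesz m r T - riesz m r T₀‖ < 1 := by
    have h2 := (contDiffAt_riesz hu₀).continuousAt
    filter_upwards [Metric.continuousAt_iff'.1 h2 1 one_pos] with T hT
    rwa [dist_eq_norm] at hT
  filter_upwards [hnear, eventually_isUnit_resolventDenom hu₀] with T hn hu
  refine ⟨fun i => ((ContinuousLinearMap.apply ℂ H (e i)).restrictScalars ℝ).contDiff.contDiffAt.comp T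
    (contDiffAt_riesz hu), fun hT hc => ?_⟩
  have hfd := finiteDimensional_eigenSum hr hu hc h1 fun μ h h' => (hball μ).2 ⟨h, h'⟩
  have hmem (v : H) := riesz_mem_eigenSum hT hc hr hu (fun μ hμ => (hball μ).1 hμ) v
  have hmem₀ (v : H) := riesz_mem_eigenSum hT₀ hc₀ hr hu₀ (fun μ hμ => (hball μ).1 hμ) v
  have hid {v : H} (hv : v ∈ eigenSum z w T) : riesz m r T v = v :=
    riesz_apply_of_mem_eigenSum hu (fun μ h h' => (hball μ).2 ⟨h, h'⟩) hv
  have hid₀ {v : H} (hv : v ∈ eigenSum z w T₀) : riesz m r T₀ v = v :=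
    riesz_apply_of_mem_eigenSum hu₀ (fun μ h h' => (hball μ).2 ⟨h, h'⟩) hv
  -- Since the two projections differ by less than 1 in norm, each is injective on the range of the
  -- other. This gives the independence of the projected basis and the equality of dimensions.
  have hsmall {v : H} (hv : ‖v‖ ≤ ‖(riesz m r T - riesz m r T₀) v‖) : v = 0 := by
    by_contra hv0
    have h3 := norm_pos_iff.2 hv0
    have h4 := (riesz m r T - riesz m r T₀).le_opNorm v
    nlinarith
  have hLI : LinearIndependent ℂ fun i => riesz m r T (e i) := by
    refine heLI.map_injOn (riesz m r T : H →ₗ[ℂ] H) ?_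
    refine LinearMap.injOn_of_disjoint_ker le_rfl (LinearMap.disjoint_ker.2 fun v hv h0 =>
      hsmall ?_)
    have h3 : riesz m r T v = 0 := h0
    rw [sub_apply, h3, hid₀ (heE ▸ hv), zero_sub, norm_neg]
  refine ⟨hLI, Submodule.eq_of_le_of_finrank_le (Submodule.span_le.2 ?_) ?_⟩
  · rintro _ ⟨i, rfl⟩
    exact hmem _
  · rw [finrank_span_eq_card hLI, ← finrank_span_eq_card heLI, heE]
    refine LinearMap.finrank_le_finrank_of_injective
      (f := ((riesz m r T₀ : H →ₗ[ℂ] H).restrict (p := eigenSum z w T) (q := eigenSum z w T₀)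
        fun v _ => hmem₀ v)) ((injective_iff_map_eq_zero _).2 fun v hv => Subtype.ext (hsmall ?_))
    have h3 : riesz m r T₀ v = 0 := congrArg Subtype.val hv
    rw [sub_apply, h3, hid v.2, sub_zero]

end Arcs

/-! ### Resolvent points on the circle and finite dimensionality -/

section ResolventPoints

variable {H : Type*} [NormedAddCommGroup H] [InnerProductSpace ℂ H] [CompleteSpace H]
  {T : H →L[ℂ] H}

lemma exists_eigenvector_of_mem_spectrum (hc : IsCompactOperator (T - 1 : H →L[ℂ] H)) {μ : ℂ}
    (hμ : μ ≠ 1) (hs : μ ∈ spectrum ℂ T) : ∃ v : H, ‖v‖ = 1 ∧ T v = μ • v := by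
  have h1 : μ - 1 ∈ spectrum ℂ (T - 1) := by
    rw [spectrum.mem_iff] at hs ⊢
    have e : algebraMap ℂ (H →L[ℂ] H) (μ - 1) - (T - 1) = algebraMap ℂ (H →L[ℂ] H) μ - T := by
      rw [map_sub, map_one]; abel
    rwa [e]
  obtain ⟨v, hv, hv0⟩ :=
    ((hc.hasEigenvalue_iff_mem_spectrum (sub_ne_zero.2 hμ)).2 h1).exists_hasEigenvector
  have h2 : T v - v = (μ - 1) • v := Module.End.mem_eigenspace_iff.1 hv
  have h3 : T v = μ • v := by
    rw [sub_eq_iff_eq_add.1 h2, sub_smul, one_smul, sub_add_cancel]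
  refine ⟨((‖v‖⁻¹ : ℝ) : ℂ) • v, ?_, by rw [map_smul, h3, smul_comm]⟩
  rw [norm_smul, Complex.norm_real, norm_inv, norm_norm, inv_mul_cancel₀ (norm_ne_zero_iff.2 hv0)]

lemma inner_eq_zero_of_unitary_eigenvectors (hT : T ∈ unitary (H →L[ℂ] H)) {μ ν : ℂ} {v w : H}
    (hv : T v = μ • v) (hw : T w = ν • w) (h : μ ≠ ν) : ⟪v, w⟫_ℂ = 0 := by
  rcases eq_or_ne v 0 with rfl | h0
  · exact inner_zero_left w
  have hμ := norm_eq_one_of_unitary_eigenvector hT hv h0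
  have h1 : ⟪v, T w⟫_ℂ = ⟪star T v, w⟫_ℂ := (ContinuousLinearMap.adjoint_inner_left T w v).symm
  rw [hw, inner_smul_right, adjoint_apply_of_unitary_eigenvector hT hv, inner_smul_left,
    Complex.inv_eq_conj hμ, Complex.conj_conj] at h1
  by_contra h2
  exact h (mul_right_cancel₀ h2 h1).symm

/-- Unit eigenvectors for distinct eigenvalues are orthogonal, hence at distance √2. The balls of
radius 1/2 around them are disjoint, and a separable space contains only countably many disjoint
non-empty open sets. -/
lemma countable_spectrum_sdiff [TopologicalSpace.SeparableSpace H]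
    (hT : T ∈ unitary (H →L[ℂ] H)) (hc : IsCompactOperator (T - 1 : H →L[ℂ] H)) :
    (spectrum ℂ T \ {1}).Countable := by
  have h (μ : ℂ) : ∃ v : H, μ ∈ spectrum ℂ T \ {1} → ‖v‖ = 1 ∧ T v = μ • v := by
    by_cases hμ : μ ∈ spectrum ℂ T \ {1}
    · obtain ⟨v, hv⟩ := exists_eigenvector_of_mem_spectrum hc hμ.2 hμ.1
      exact ⟨v, fun _ => hv⟩
    · exact ⟨0, fun h => absurd h hμ⟩
  choose v hv using h
  refine Set.PairwiseDisjoint.countable_of_isOpen (s := fun μ => Metric.ball (v μ) (1 / 2))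
    (fun μ hμ ν hν hne => Metric.ball_disjoint_ball ?_) (fun _ _ => Metric.isOpen_ball)
    (fun μ _ => Metric.nonempty_ball.2 one_half_pos)
  have h1 := inner_eq_zero_of_unitary_eigenvectors hT (hv μ hμ).2 (hv ν hν).2 hne
  have h2 := norm_sub_sq (𝕜 := ℂ) (v μ) (v ν)
  rw [h1, (hv μ hμ).1, (hv ν hν).1, map_zero] at h2
  rw [dist_eq_norm]
  nlinarith [norm_nonneg (v μ - v ν)]

/-- A non-trivial arc is uncountable, while the spectrum without 1 is countable. -/
lemma exists_notMem_spectrum [TopologicalSpace.SeparableSpace H]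
    (hT : T ∈ unitary (H →L[ℂ] H)) (hc : IsCompactOperator (T - 1 : H →L[ℂ] H)) {α β : ℝ}
    (h0 : 0 ≤ α) (h : α < β) (h1 : β ≤ 2 * Real.pi) :
    ∃ z : Circle, z ≠ 1 ∧ (z : ℂ) ∉ spectrum ℂ T ∧ α < ang z ∧ ang z < β := by
  by_contra! hcon
  have hne {x : ℝ} (hx : x ∈ Set.Ioo α β) : ang (Circle.exp x) = x :=
    ang_exp (h0.trans_lt hx.1) (hx.2.le.trans h1)
  have hmaps : Set.MapsTo (fun x : ℝ => (Circle.exp x : ℂ)) (Set.Ioo α β)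
      (spectrum ℂ T \ {1}) := fun x hx => by
    have hx1 : Circle.exp x ≠ 1 := fun h' => by
      have h2 := hne hx
      rw [h', ang_one] at h2
      linarith [hx.2]
    refine ⟨?_, fun h' => hx1 (Circle.ext h')⟩
    by_contra h2
    exact absurd (hcon _ hx1 h2 ((hne hx).symm ▸ hx.1)) (by rw [hne hx]; exact not_le.2 hx.2)
  have hinj : Set.InjOn (fun x : ℝ => (Circle.exp x : ℂ)) (Set.Ioo α β) := fun x hx y hy h' => by
    rw [← hne hx, ← hne hy, Circle.ext h']
  exact h.not_ge (Cardinal.Real.Ioo_countable_iff.1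
    (hmaps.countable_of_injOn hinj (countable_spectrum_sdiff hT hc)))

/-- The end points of the arc may lie in the spectrum. The arc is enlarged to one with end points in
the resolvent set, for which the Riesz projection is defined. -/
lemma finiteDimensional_eigenSum_of_isCompactOperator [TopologicalSpace.SeparableSpace H]
    (hT : T ∈ unitary (H →L[ℂ] H)) (hc : IsCompactOperator (T - 1 : H →L[ℂ] H)) {z z' : Circle}
    (hz : z ≠ 1) : FiniteDimensional ℂ (eigenSum z z' T) := by
  obtain ⟨w, hw1, hw, hw2, -⟩ := exists_notMem_spectrum hT hc (ang_pos z).le (ang_lt_two_pi hz)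
    le_rfl
  obtain ⟨w', hw1', hw', -, hw2'⟩ := exists_notMem_spectrum hT hc le_rfl (ang_pos z') (ang_le z')
  have hle : eigenSum z z' T ≤ eigenSum w w' T := eigenSum_le_of_circLT_iff fun μ _ h h' => by
    rw [circLT_iff] at h h' ⊢
    rw [circLT_iff]
    exact ⟨⟨hw2'.trans h.1, h.2⟩, h'.1.trans hw2, hw1⟩
  have : FiniteDimensional ℂ (eigenSum w w' T) := by
    by_cases h : CircLT w' w
    · obtain ⟨m, r, hr, h1, hball, hsph⟩ := exists_ball_of_circLT h
      refine finiteDimensional_eigenSum hr (isUnit_resolventDenom_of_unitary hT hr fun μ hμ => ?_)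
        hc h1 fun μ h h' => (hball μ).2 ⟨h, h'⟩
      rcases hsph μ hμ with rfl | rfl
      · exact hw
      · exact hw'
    · rw [eigenSum_eq_bot h]
      infer_instance
  exact Submodule.finiteDimensional_of_le hle

end ResolventPoints

/-! ### Smooth frames of the line bundle -/

section LineHomCoefficients

variable {Λ : Type*} [Ring Λ] [Algebra ℂ Λ] {A B A₁ B₁ A₂ B₂ A₃ B₃ : Submodule ℂ Λ}

/-- Rescaling the generator of the source enters inversely, rescaling that of the target directly.
-/
lemma lineHom_eq_div_smul {x x' y y' : Λ} {k l : ℂ} {a a' : A →ₗ[ℂ] B}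
    (hA : A = Submodule.span ℂ {x}) (ha : ∀ v : A, (v : Λ) = x → (a v : Λ) = y)
    (ha' : ∀ v : A, (v : Λ) = x' → (a' v : Λ) = y') (hx : x' = l • x) (hy : y' = k • y)
    (hl : l ≠ 0) : a' = (k / l) • a := by
  refine lineHom_ext hA ?_
  rintro v rfl
  have h1 := ha' (l • v) (by rw [hx]; rfl)
  rw [map_smul, Submodule.coe_smul, hy, ← ha v rfl] at h1
  refine Subtype.ext ?_
  rw [LinearMap.smul_apply, Submodule.coe_smul, div_eq_inv_mul, mul_smul, ← h1,
    inv_smul_smul₀ hl]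

/-- Any functional that does not vanish on y₃ x₂ x₁ reads off the coefficient of the product; the
freedom in φ permits one that varies smoothly with the frames. -/
lemma IsMulRel.eq_smul {σ τ : ℂ} {a : A₁ →ₗ[ℂ] B₁} {b : A₂ →ₗ[ℂ] B₂} {c e : A₃ →ₗ[ℂ] B₃}
    (h : IsMulRel σ τ a b c) (hτ : τ ≠ 0) {x₁ x₂ x₃ y₁ y₂ y₃ : Λ} (hx₁ : x₁ ∈ A₁) (hx₂ : x₂ ∈ A₂)
    (hA₃ : A₃ = Submodule.span ℂ {x₃}) (hB₃ : B₃ = Submodule.span ℂ {y₃}) (hy₃ : y₃ ≠ 0)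
    (ha : ∀ v : A₁, (v : Λ) = x₁ → (a v : Λ) = y₁) (hb : ∀ v : A₂, (v : Λ) = x₂ → (b v : Λ) = y₂)
    (he : ∀ v : A₃, (v : Λ) = x₃ → (e v : Λ) = y₃) (φ : Λ →ₗ[ℂ] ℂ)
    (h0 : φ (y₃ * x₂ * x₁) ≠ 0) : c = (σ / τ * (φ (y₁ * y₂ * x₃) / φ (y₃ * x₂ * x₁))) • e := by
  obtain ⟨ψ, hψ⟩ := exists_lineHom_coord hA₃ hB₃ hy₃ he
  have hx₃ : x₃ ∈ A₃ := hA₃ ▸ Submodule.mem_span_singleton_self x₃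
  have h1 := h ⟨x₁, hx₁⟩ ⟨x₂, hx₂⟩ ⟨x₃, hx₃⟩
  rw [ha _ rfl, hb _ rfl, hψ c, LinearMap.smul_apply, Submodule.coe_smul, he _ rfl] at h1
  have h2 := congrArg φ h1
  simp only [smul_mul_assoc, map_smul, smul_eq_mul] at h2
  have h3 : ψ c = σ / τ * (φ (y₁ * y₂ * x₃) / φ (y₃ * x₂ * x₁)) := by
    field_simp
    linear_combination -h2
  rw [← h3]
  exact hψ c

end LineHomCoefficients

/-! ### Ratios of Gram determinants -/

section GramRatio

variable {H : Type*} [NormedAddCommGroup H] [InnerProductSpace ℂ H]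

/-- The ratio of the wedge products of two frames. -/
noncomputable def gramRatio {m n : ℕ} (u : Fin n → H) (u' : Fin m → H) : ℂ :=
  gramFunctional u (ExteriorAlgebra.ιMulti ℂ m u') / gramFunctional u (ExteriorAlgebra.ιMulti ℂ n u)

lemma gramFunctional_self_ne_zero {n : ℕ} {u : Fin n → H} (hu : LinearIndependent ℂ u) :
    gramFunctional u (ExteriorAlgebra.ιMulti ℂ n u) ≠ 0 := by
  rw [gramFunctional_ιMulti]
  exact gramForm_self_ne_zero hu

lemma ιMulti_eq_gramRatio_smul {m n : ℕ} {u : Fin n → H} {u' : Fin m → H}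
    (hu : LinearIndependent ℂ u) (h : ExteriorAlgebra.ιMulti ℂ m u' ∈
      Submodule.span ℂ {ExteriorAlgebra.ιMulti ℂ n u}) :
    ExteriorAlgebra.ιMulti ℂ m u' = gramRatio u u' • ExteriorAlgebra.ιMulti ℂ n u := by
  obtain ⟨k, hk⟩ := Submodule.mem_span_singleton.1 h
  rw [gramRatio, ← hk, map_smul, smul_eq_mul, mul_div_cancel_right₀ _ (gramFunctional_self_ne_zero hu)]

lemma gramRatio_ne_zero {m n : ℕ} {u : Fin n → H} {u' : Fin m → H} (hu : LinearIndependent ℂ u)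
    (hu' : LinearIndependent ℂ u') (h : ExteriorAlgebra.ιMulti ℂ m u' ∈
      Submodule.span ℂ {ExteriorAlgebra.ιMulti ℂ n u}) : gramRatio u u' ≠ 0 := fun h0 =>
  ιMulti_ne_zero hu' (by rw [ιMulti_eq_gramRatio_smul hu h, h0, zero_smul])

/-- Numerator and denominator are either polynomials in inner products or identically zero, and the
denominator is a non-zero Gram determinant at x. -/
lemma SmoothAt.gramRatio {X W : Type*} [NormedAddCommGroup W] [NormedSpace ℝ W] {c : X → W}
    {m n : ℕ} {u : Fin n → X → H} {u' : Fin m → X → H} {x : X}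
    (hu : ∀ i, SmoothAt c (u i) x) (hu' : ∀ i, SmoothAt c (u' i) x)
    (h : LinearIndependent ℂ fun i => u i x) :
    SmoothAt c (fun x' => gramRatio (fun i => u i x') fun i => u' i x') x :=
  (SmoothAt.gramFunctional hu hu').div (SmoothAt.gramFunctional hu hu)
    (gramFunctional_self_ne_zero h)

end GramRatio

section EigenFrames

variable {H : Type u} [NormedAddCommGroup H] [InnerProductSpace ℂ H] [CompleteSpace H]

/-- The frames for operators near T x₀ are pulled back along x ↦ T x. Since the end points are
frozen locally, they only have to be continuous in x. -/
lemma exists_eigenframe {X W : Type*} [NormedAddCommGroup W] [NormedSpace ℝ W] {c : X → W}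
    {z w : X → Circle} {T : X → H →L[ℂ] H} {z' w' : W → ℂ} {T' : W → H →L[ℂ] H}
    (hz' : Continuous z') (hw' : Continuous w') (hT' : ContDiff ℝ ∞ T')
    (ez : ∀ x, (z x : ℂ) = z' (c x)) (ew : ∀ x, (w x : ℂ) = w' (c x)) (eT : ∀ x, T x = T' (c x))
    (hu : ∀ x, T x ∈ unitary (H →L[ℂ] H)) (hc : ∀ x, IsCompactOperator (T x - 1 : H →L[ℂ] H))
    {x₀ : X} (hz1 : z x₀ ≠ 1) (hw1 : w x₀ ≠ 1) (hz : (z x₀ : ℂ) ∉ spectrum ℂ (T x₀))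
    (hw : (w x₀ : ℂ) ∉ spectrum ℂ (T x₀)) :
    ∃ (d : ℕ) (u : Fin d → X → H) (U : Set X), x₀ ∈ U ∧ IsOpenVia c U ∧ ∀ x ∈ U,
      (∀ i, SmoothAt c (u i) x) ∧ LinearIndependent ℂ (fun i => u i x) ∧
      Submodule.span ℂ (Set.range fun i => u i x) = eigenSum (z x) (w x) (T x) := by
  obtain ⟨d, u, h⟩ := exists_smooth_eigenframe hz1 hw1 hz hw (hu x₀) (hc x₀)
  have h2 := eventually_eigenSum_eq hz1 hw1 hz hw
  rw [eT] at h
  rw [ez, ew, eT] at h2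
  have h3 : Tendsto (fun p => (z' p, w' p, T' p)) (𝓝 (c x₀))
      (𝓝 (z' (c x₀), w' (c x₀), T' (c x₀))) :=
    (hz'.prodMk (hw'.prodMk hT'.continuous)).continuousAt
  obtain ⟨U, hxU, hU, hUp⟩ := exists_isOpenVia_of_eventually
    ((hT'.continuous.continuousAt.eventually h).and (h3.eventually h2))
  refine ⟨d, fun i x => u i (T x), U, hxU, hU, fun x hx => ?_⟩
  obtain ⟨⟨h4, h5⟩, h6⟩ := hUp x hx
  have e := h6 (z x) (w x) (ez x) (ew x)
  rw [← eT] at h4 h5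
  obtain ⟨h7, h8⟩ := h5 (hu x) (hc x)
  refine ⟨fun i => ?_, h7, ?_⟩
  · have h9 : SmoothAt c T x := (SmoothAt.of_contDiffAt (x := x) hT'.contDiffAt).congr
      (Eventually.of_forall eT)
    exact ContDiffAt.comp_smoothAt (h4 i) h9
  · rw [h8]
    simpa only [← eT] using e.symm

end EigenFrames

/-! ### Coordinates on the group and frames at a point of Y^[2] -/

section SmoothRealization

variable {H : Type u} [NormedAddCommGroup H] [InnerProductSpace ℂ H] [CompleteSpace H]
  {Γ : Subgroup (unitary (H →L[ℂ] H))} {V : Type*} [NormedAddCommGroup V] [NormedSpace ℝ V]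

/-- The properties of the coordinates `j` on the group `Γ` that make the basic bundle gerbe
smooth. -/
structure IsSmoothRealization (Γ : Subgroup (unitary (H →L[ℂ] H))) (j : Γ → V) : Prop where
  isCompactOperator : ∀ g : Γ, IsCompactOperator (toOp Γ g - 1 : H →L[ℂ] H)
  exists_affine : ∃ (T₀ : H →L[ℂ] H) (A : V →L[ℝ] H →L[ℂ] H), ∀ g, toOp Γ g = T₀ + A (j g)
  exists_conj : ∃ C : V × V → V, ContDiff ℝ ∞ C ∧ ∀ k g : Γ, j (k * g * k⁻¹) = C (j k, j g)

variable {j : Γ → V}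

lemma IsSmoothRealization.exists_contDiff (hj : IsSmoothRealization Γ j) :
    ∃ T' : V → H →L[ℂ] H, ContDiff ℝ ∞ T' ∧ ∀ g, toOp Γ g = T' (j g) := by
  obtain ⟨T₀, A, h⟩ := hj.exists_affine
  exact ⟨fun v => T₀ + A v, contDiff_const.add A.contDiff, h⟩

lemma IsSmoothRealization.finiteDimensional [TopologicalSpace.SeparableSpace H]
    (hj : IsSmoothRealization Γ j) (g : Γ) (z z' : Circle) (hz : z ≠ 1) (_ : z' ≠ 1) :
    FiniteDimensional ℂ (eigenSum z z' (toOp Γ g)) :=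
  finiteDimensional_eigenSum_of_isCompactOperator (g : unitary (H →L[ℂ] H)).2
    (hj.isCompactOperator g) hz

/-- `u` and `w` are frames of `E_{(z₁, z₂, g)}` and `E_{(z₂, z₁, g)}` to which the element `a` of
`L` corresponds. -/
structure IsFrameAt {d e : ℕ} (q : BasicY2 Γ) (u : Fin d → H) (w : Fin e → H) (a : BasicL q) :
    Prop where
  linearIndependent_pos : LinearIndependent ℂ u
  span_pos : Submodule.span ℂ (Set.range u) = eigenSum q.1.1.z q.1.2.z (toOp Γ q.1.1.g)
  linearIndependent_neg : LinearIndependent ℂ w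
  span_neg : Submodule.span ℂ (Set.range w) = eigenSum q.1.2.z q.1.1.z (toOp Γ q.1.1.g)
  apply_eq : ∀ x : detNeg q, (x : ExteriorAlgebra ℂ H) = ExteriorAlgebra.ιMulti ℂ e w →
    (a x : ExteriorAlgebra ℂ H) = ExteriorAlgebra.ιMulti ℂ d u

namespace IsFrameAt

variable {d e d' e' : ℕ} {q : BasicY2 Γ} {u : Fin d → H} {w : Fin e → H} {a : BasicL q}
  {u' : Fin d' → H} {w' : Fin e' → H} {a' : BasicL q}

lemma detPos_eq (h : IsFrameAt q u w a) :
    detPos q = Submodule.span ℂ {ExteriorAlgebra.ιMulti ℂ d u} := by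
  rw [← detLine_span h.linearIndependent_pos, h.span_pos]; rfl

lemma detNeg_eq (h : IsFrameAt q u w a) :
    detNeg q = Submodule.span ℂ {ExteriorAlgebra.ιMulti ℂ e w} := by
  rw [← detLine_span h.linearIndependent_neg, h.span_neg]; rfl

lemma mem_detPos (h : IsFrameAt q u w a) : ExteriorAlgebra.ιMulti ℂ d u ∈ detPos q :=
  h.detPos_eq ▸ Submodule.mem_span_singleton_self _

lemma mem_detNeg (h : IsFrameAt q u w a) : ExteriorAlgebra.ιMulti ℂ e w ∈ detNeg q :=
  h.detNeg_eq ▸ Submodule.mem_span_singleton_self _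

lemma ne_zero (h : IsFrameAt q u w a) : a ≠ 0 := fun h0 =>
  ιMulti_ne_zero h.linearIndependent_pos <|
    (h.apply_eq ⟨_, h.mem_detNeg⟩ rfl).symm.trans
      (congrArg (fun b : BasicL q => (b ⟨_, h.mem_detNeg⟩ : ExteriorAlgebra ℂ H)) h0)

lemma rankPos_eq (h : IsFrameAt q u w a) : rankPos q = d := by
  rw [rankPos, ← h.span_pos, finrank_span_eq_card h.linearIndependent_pos, Fintype.card_fin]

lemma rankNeg_eq (h : IsFrameAt q u w a) : rankNeg q = e := by
  rw [rankNeg, ← h.span_neg, finrank_span_eq_card h.linearIndependent_neg, Fintype.card_fin]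

lemma finrank_eq_one (h : IsFrameAt q u w a) : Module.finrank ℂ (BasicL q) = 1 := by
  obtain ⟨φ, hφ⟩ := exists_lineHom_coord h.detNeg_eq h.detPos_eq
    (ιMulti_ne_zero h.linearIndependent_pos) h.apply_eq
  exact _root_.finrank_eq_one a h.ne_zero fun b => ⟨φ b, (hφ b).symm⟩

lemma eq_smul (h : IsFrameAt q u w a) (h' : IsFrameAt q u' w' a') :
    a' = (gramRatio u u' / gramRatio w w') • a :=
  lineHom_eq_div_smul h.detNeg_eq h.apply_eq h'.apply_eq
    (ιMulti_eq_gramRatio_smul h.linearIndependent_neg (h.detNeg_eq ▸ h'.mem_detNeg))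
    (ιMulti_eq_gramRatio_smul h.linearIndependent_pos (h.detPos_eq ▸ h'.mem_detPos))
    (gramRatio_ne_zero h.linearIndependent_neg h'.linearIndependent_neg
      (h.detNeg_eq ▸ h'.mem_detNeg))

lemma gramRatio_neg_ne_zero (h : IsFrameAt q u w a) (h' : IsFrameAt q u' w' a') :
    gramRatio w w' ≠ 0 :=
  gramRatio_ne_zero h.linearIndependent_neg h'.linearIndependent_neg (h.detNeg_eq ▸ h'.mem_detNeg)

lemma smul (h : IsFrameAt q u w a) (k : ConjAct Γ) :
    IsFrameAt (q.smul BasicY.g_smul k) (fun i => toOp Γ (ConjAct.ofConjAct k) (u i))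
      (fun i => toOp Γ (ConjAct.ofConjAct k) (w i)) (basicAct k q a) where
  linearIndependent_pos := h.linearIndependent_pos.map'
    (toOp Γ (ConjAct.ofConjAct k) : H →ₗ[ℂ] H) (LinearMap.ker_eq_bot.2 (toOp_injective _))
  span_pos := by
    refine Eq.trans ?_ (eigenSum_conj_eq k q.1.1.z q.1.2.z q.1.1.g)
    rw [← h.span_pos, Submodule.map_span, ← Set.range_comp]
    rfl
  linearIndependent_neg := h.linearIndependent_neg.map'
    (toOp Γ (ConjAct.ofConjAct k) : H →ₗ[ℂ] H) (LinearMap.ker_eq_bot.2 (toOp_injective _))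
  span_neg := by
    refine Eq.trans ?_ (eigenSum_conj_eq k q.1.2.z q.1.1.z q.1.1.g)
    rw [← h.span_neg, Submodule.map_span, ← Set.range_comp]
    rfl
  apply_eq x hx := by
    rw [← extMap_ιMulti] at hx ⊢
    rw [← h.apply_eq ⟨_, h.mem_detNeg⟩ rfl]
    exact coe_basicAct_eq k q a hx

end IsFrameAt

lemma isBasicFrame_iff {U : Set (BasicY2 Γ)} {σ : ∀ q : BasicY2 Γ, BasicL q} :
    IsBasicFrame j U σ ↔ IsOpenVia (coord2 BasicY.g (BasicY.coord j)) U ∧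
      ∃ (d e : ℕ) (u : Fin d → BasicY2 Γ → H) (w : Fin e → BasicY2 Γ → H), ∀ q ∈ U,
        (∀ i, SmoothAt (coord2 BasicY.g (BasicY.coord j)) (u i) q) ∧
        (∀ i, SmoothAt (coord2 BasicY.g (BasicY.coord j)) (w i) q) ∧
        IsFrameAt q (fun i => u i q) (fun i => w i q) (σ q) := by
  refine and_congr_right fun _ => exists_congr fun d => exists_congr fun e => exists_congr fun u =>
    exists_congr fun w => forall₂_congr fun q _ => and_congr_right fun _ => and_congr_right fun _ =>
    ⟨fun h => ⟨h.1, h.2.1, h.2.2.1, h.2.2.2.1, h.2.2.2.2⟩,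
      fun h => ⟨h.1, h.2, h.3, h.4, h.5⟩⟩

end SmoothRealization

/-! ### The multiplication in frames and the smooth structure of L -/

section BasicGerbe

variable {H : Type u} [NormedAddCommGroup H] [InnerProductSpace ℂ H]

/-- The coefficient of the multiplication on `L` with respect to frames. -/
noncomputable def mulCoeff {d₁ e₁ d₂ e₂ d₃ e₃ : ℕ} (u₁ : Fin d₁ → H) (w₁ : Fin e₁ → H)
    (u₂ : Fin d₂ → H) (w₂ : Fin e₂ → H) (u₃ : Fin d₃ → H) (w₃ : Fin e₃ → H) : ℂ :=
  (-1) ^ (d₁ * e₃) / (-1) ^ (e₁ * d₃) *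
    gramRatio (Fin.append (Fin.append u₃ w₂) w₁) (Fin.append (Fin.append u₁ u₂) w₃)

lemma SmoothAt.mulCoeff {X W : Type*} [NormedAddCommGroup W] [NormedSpace ℝ W] {c : X → W}
    {d₁ e₁ d₂ e₂ d₃ e₃ : ℕ} {u₁ : Fin d₁ → X → H} {w₁ : Fin e₁ → X → H} {u₂ : Fin d₂ → X → H}
    {w₂ : Fin e₂ → X → H} {u₃ : Fin d₃ → X → H} {w₃ : Fin e₃ → X → H} {x : X}
    (hu₁ : ∀ i, SmoothAt c (u₁ i) x) (hw₁ : ∀ i, SmoothAt c (w₁ i) x)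
    (hu₂ : ∀ i, SmoothAt c (u₂ i) x) (hw₂ : ∀ i, SmoothAt c (w₂ i) x)
    (hu₃ : ∀ i, SmoothAt c (u₃ i) x) (hw₃ : ∀ i, SmoothAt c (w₃ i) x)
    (h : LinearIndependent ℂ (Fin.append (Fin.append (fun i => u₃ i x) fun i => w₂ i x)
      fun i => w₁ i x)) :
    SmoothAt c (fun x' => mulCoeff (fun i => u₁ i x') (fun i => w₁ i x') (fun i => u₂ i x')
      (fun i => w₂ i x') (fun i => u₃ i x') fun i => w₃ i x') x :=
  (smoothAt_const _ x).mul (SmoothAt.gramRatio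
    (u := fun i x => Fin.append (Fin.append (fun i => u₃ i x) fun i => w₂ i x)
      (fun i => w₁ i x) i)
    (u' := fun i x => Fin.append (Fin.append (fun i => u₁ i x) fun i => u₂ i x)
      (fun i => w₃ i x) i)
    (SmoothAt.append (v := fun i x => Fin.append (fun i => u₃ i x) (fun i => w₂ i x) i)
      (SmoothAt.append hu₃ hw₂) hw₁)
    (SmoothAt.append (v := fun i x => Fin.append (fun i => u₁ i x) (fun i => u₂ i x) i)
      (SmoothAt.append hu₁ hu₂) hw₃) h)

variable [CompleteSpace H] {Γ : Subgroup (unitary (H →L[ℂ] H))} {V : Type*} [NormedAddCommGroup V] [NormedSpace ℝ V]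
  {j : Γ → V}

/-- For generators, this product is the right side of `IsGeneratorSystem.relation`, hence non-zero
in every order of the points. It is the non-vanishing needed for the denominator of `mulCoeff`. -/
lemma mul_detNeg_mul_detNeg_ne_zero (hfd : ∀ (g : Γ) (z z' : Circle), z ≠ 1 → z' ≠ 1 →
    FiniteDimensional ℂ (eigenSum z z' (toOp Γ g))) (t : BasicY3 Γ) {x y r : ExteriorAlgebra ℂ H}
    (hx : x ∈ detPos t.p13) (hy : y ∈ detNeg t.p23) (hr : r ∈ detNeg t.p12) (hx0 : x ≠ 0)
    (hy0 : y ≠ 0) (hr0 : r ≠ 0) : x * y * r ≠ 0 := by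
  obtain ⟨θ, hθ⟩ := exists_isGeneratorSystem_of_finite (hfd t.1.1.g)
    (S := {t.1.1.z, t.1.2.1.z, t.1.2.2.z}) (by
      rintro z (rfl | rfl | rfl)
      · exact BasicY.admissible rfl
      · exact BasicY.admissible t.2.1.symm
      · exact BasicY.admissible (t.2.1.trans t.2.2).symm) (Set.toFinite _) ⟨_, Or.inl rfl⟩
  have m1 : t.1.1.z ∈ ({t.1.1.z, t.1.2.1.z, t.1.2.2.z} : Set Circle) := Or.inl rfl
  have m2 : t.1.2.1.z ∈ ({t.1.1.z, t.1.2.1.z, t.1.2.2.z} : Set Circle) := Or.inr (Or.inl rfl)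
  have m3 : t.1.2.2.z ∈ ({t.1.1.z, t.1.2.1.z, t.1.2.2.z} : Set Circle) := Or.inr (Or.inr rfl)
  have e : toOp Γ t.1.2.1.g = toOp Γ t.1.1.g := congrArg _ t.2.1.symm
  have hrel := hθ.relation m1 m2 m3
  have h0 := (smul_ne_zero_iff.1 (hrel.1 ▸ smul_ne_zero
    (pow_ne_zero _ (neg_ne_zero.2 one_ne_zero)) hrel.2)).2
  have hx' : x ∈ Submodule.span ℂ {θ t.1.1.z t.1.2.2.z} := hθ.span _ m1 _ m3 ▸ hx
  have hr' : r ∈ Submodule.span ℂ {θ t.1.2.1.z t.1.1.z} := hθ.span _ m2 _ m1 ▸ hr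
  have hy' : y ∈ Submodule.span ℂ {θ t.1.2.2.z t.1.2.1.z} := by
    rw [← hθ.span _ m3 _ m2, ← e]; exact hy
  obtain ⟨k, rfl⟩ := Submodule.mem_span_singleton.1 hx'
  obtain ⟨l, rfl⟩ := Submodule.mem_span_singleton.1 hy'
  obtain ⟨m, rfl⟩ := Submodule.mem_span_singleton.1 hr'
  rw [smul_mul_smul_comm, smul_mul_smul_comm]
  exact smul_ne_zero (mul_ne_zero (mul_ne_zero (left_ne_zero_of_smul hx0)
    (left_ne_zero_of_smul hy0)) (left_ne_zero_of_smul hr0)) h0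

lemma IsFrameAt.linearIndependent_append (hfd : ∀ (g : Γ) (z z' : Circle), z ≠ 1 → z' ≠ 1 →
    FiniteDimensional ℂ (eigenSum z z' (toOp Γ g))) {t : BasicY3 Γ} {d₁ e₁ d₂ e₂ d₃ e₃ : ℕ}
    {u₁ : Fin d₁ → H} {w₁ : Fin e₁ → H} {u₂ : Fin d₂ → H} {w₂ : Fin e₂ → H} {u₃ : Fin d₃ → H}
    {w₃ : Fin e₃ → H} {a : BasicL t.p12} {b : BasicL t.p23} {c : BasicL t.p13}
    (h₁ : IsFrameAt t.p12 u₁ w₁ a) (h₂ : IsFrameAt t.p23 u₂ w₂ b) (h₃ : IsFrameAt t.p13 u₃ w₃ c) :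
    LinearIndependent ℂ (Fin.append (Fin.append u₃ w₂) w₁) := by
  apply linearIndependent_of_ιMulti_ne_zero
  rw [← ExteriorAlgebra.ιMulti_mul_ιMulti, ← ExteriorAlgebra.ιMulti_mul_ιMulti]
  exact mul_detNeg_mul_detNeg_ne_zero hfd t h₃.mem_detPos h₂.mem_detNeg h₁.mem_detNeg
    (ιMulti_ne_zero h₃.linearIndependent_pos) (ιMulti_ne_zero h₂.linearIndependent_neg)
    (ιMulti_ne_zero h₁.linearIndependent_neg)

/-- Apply to the defining relation the Gram functional of the concatenated frame (u₃, w₂, w₁), whose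
wedge is exactly the product on the right side. -/
lemma IsFrameAt.basicMul_eq (hfd : ∀ (g : Γ) (z z' : Circle), z ≠ 1 → z' ≠ 1 →
    FiniteDimensional ℂ (eigenSum z z' (toOp Γ g))) {t : BasicY3 Γ} {d₁ e₁ d₂ e₂ d₃ e₃ : ℕ}
    {u₁ : Fin d₁ → H} {w₁ : Fin e₁ → H} {u₂ : Fin d₂ → H} {w₂ : Fin e₂ → H} {u₃ : Fin d₃ → H}
    {w₃ : Fin e₃ → H} {a : BasicL t.p12} {b : BasicL t.p23} {c : BasicL t.p13}
    (h₁ : IsFrameAt t.p12 u₁ w₁ a) (h₂ : IsFrameAt t.p23 u₂ w₂ b) (h₃ : IsFrameAt t.p13 u₃ w₃ c) :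
    basicMul hfd t a b = mulCoeff u₁ w₁ u₂ w₂ u₃ w₃ • c := by
  have h := isBasicMul_basicMul hfd t a b
  have hLI := h₁.linearIndependent_append hfd h₂ h₃
  have h0 := gramFunctional_self_ne_zero hLI
  have r1 : (-1 : ℂ) ^ (rankPos t.p12 * rankNeg t.p13) = (-1) ^ (d₁ * e₃) := by
    rw [h₁.rankPos_eq, h₃.rankNeg_eq]
  have r2 : (-1 : ℂ) ^ (rankNeg t.p12 * rankPos t.p13) = (-1) ^ (e₁ * d₃) := by
    rw [h₁.rankNeg_eq, h₃.rankPos_eq]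
  have e1 := IsMulRel.eq_smul h (pow_ne_zero _ (neg_ne_zero.2 one_ne_zero)) h₁.mem_detNeg
    h₂.mem_detNeg h₃.detNeg_eq h₃.detPos_eq (ιMulti_ne_zero h₃.linearIndependent_pos) h₁.apply_eq
    h₂.apply_eq h₃.apply_eq (gramFunctional (Fin.append (Fin.append u₃ w₂) w₁)) (by
      rw [ExteriorAlgebra.ιMulti_mul_ιMulti, ExteriorAlgebra.ιMulti_mul_ιMulti]
      exact h0)
  refine e1.trans (congrArg (fun k : ℂ => k • c) ?_)
  rw [r1, r2, ExteriorAlgebra.ιMulti_mul_ιMulti, ExteriorAlgebra.ιMulti_mul_ιMulti,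
    ExteriorAlgebra.ιMulti_mul_ιMulti, ExteriorAlgebra.ιMulti_mul_ιMulti]
  rfl

lemma exists_isBasicFrame (hj : IsSmoothRealization Γ j) (q₀ : BasicY2 Γ) :
    ∃ U σ, q₀ ∈ U ∧ IsBasicFrame j U σ := by
  obtain ⟨T', hT', hT⟩ := hj.exists_contDiff
  have hu (q : BasicY2 Γ) : toOp Γ q.1.1.g ∈ unitary (H →L[ℂ] H) :=
    (q.1.1.g : unitary (H →L[ℂ] H)).2
  have h2 : (q₀.1.2.z : ℂ) ∉ spectrum ℂ (toOp Γ q₀.1.1.g) := (BasicY.admissible q₀.2.symm).2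
  obtain ⟨d, u, U, hqU, hU, hUu⟩ := exists_eigenframe
    (c := coord2 BasicY.g (BasicY.coord j)) (z := fun q : BasicY2 Γ => q.1.1.z)
    (w := fun q => q.1.2.z) (T := fun q => toOp Γ q.1.1.g) (z' := fun w => w.1.1)
    (w' := fun w => w.2.1) (T' := fun w => T' w.1.2) (x₀ := q₀) (by fun_prop) (by fun_prop)
    (hT'.comp (by fun_prop)) (fun _ => rfl) (fun _ => rfl) (fun q => hT _) hu
    (fun q => hj.isCompactOperator _) q₀.1.1.2.1 q₀.1.2.2.1 q₀.1.1.2.2 h2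
  obtain ⟨e, w, U', hqU', hU', hUw⟩ := exists_eigenframe
    (c := coord2 BasicY.g (BasicY.coord j)) (z := fun q : BasicY2 Γ => q.1.2.z)
    (w := fun q => q.1.1.z) (T := fun q => toOp Γ q.1.1.g) (z' := fun w => w.2.1)
    (w' := fun w => w.1.1) (T' := fun w => T' w.1.2) (x₀ := q₀) (by fun_prop) (by fun_prop)
    (hT'.comp (by fun_prop)) (fun _ => rfl) (fun _ => rfl) (fun q => hT _) hu
    (fun q => hj.isCompactOperator _) q₀.1.2.2.1 q₀.1.1.2.1 h2 q₀.1.1.2.2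
  have hσ (q : BasicY2 Γ) : ∃ a : BasicL q, q ∈ U ∩ U' →
      IsFrameAt q (fun i => u i q) (fun i => w i q) a := by
    by_cases hq : q ∈ U ∩ U'
    · obtain ⟨-, u1, u2⟩ := hUu q hq.1
      obtain ⟨-, w1, w2⟩ := hUw q hq.2
      obtain ⟨a, ha⟩ := exists_lineHom (A := detNeg q) (B := detPos q)
        (x := ExteriorAlgebra.ιMulti ℂ e fun i => w i q)
        (y := ExteriorAlgebra.ιMulti ℂ d fun i => u i q)
        (by rw [← detLine_span w1, w2]; rfl) (ιMulti_ne_zero w1) (by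
          have : detPos q = Submodule.span ℂ {ExteriorAlgebra.ιMulti ℂ d fun i => u i q} := by
            rw [← detLine_span u1, u2]; rfl
          rw [this]
          exact Submodule.mem_span_singleton_self _)
      exact ⟨a, fun _ => ⟨u1, u2, w1, w2, ha⟩⟩
    -- The value off the common domain of the two frames is irrelevant and set to zero.
    · exact ⟨0, fun h => absurd h hq⟩
  choose σ hσ using hσ
  refine ⟨U ∩ U', σ, ⟨hqU, hqU'⟩, isBasicFrame_iff.2 ⟨fun q hq => inter_mem (hU q hq.1)
    (hU' q hq.2), d, e, u, w, fun q hq => ⟨(hUu q hq.1).1, (hUw q hq.2).1, hσ q hq⟩⟩⟩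

lemma isSmoothLineBundle_basicL (hj : IsSmoothRealization Γ j) :
    IsSmoothLineBundle (coord2 BasicY.g (BasicY.coord j)) (BasicL : BasicY2 Γ → Type u)
      (IsBasicFrame j) where
  rank_one q := by
    obtain ⟨U, σ, hq, hσ⟩ := exists_isBasicFrame hj q
    obtain ⟨-, d, e, u, w, h⟩ := isBasicFrame_iff.1 hσ
    exact (h q hq).2.2.finrank_eq_one
  isOpen U σ hσ := hσ.1
  ne_zero U σ hσ q hq := by
    obtain ⟨-, d, e, u, w, h⟩ := isBasicFrame_iff.1 hσ
    exact (h q hq).2.2.ne_zero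
  exists_frame := exists_isBasicFrame hj
  transition U σ U' σ' hσ hσ' := by
    obtain ⟨-, d, e, u, w, h⟩ := isBasicFrame_iff.1 hσ
    obtain ⟨-, d', e', u', w', h'⟩ := isBasicFrame_iff.1 hσ'
    refine ⟨fun q => gramRatio (fun i => u i q) (fun i => u' i q) /
      gramRatio (fun i => w i q) (fun i => w' i q), fun q hq => ⟨?_, ?_⟩⟩
    · obtain ⟨h1, h2, h3⟩ := h q hq.1
      obtain ⟨h1', h2', h3'⟩ := h' q hq.2
      exact (SmoothAt.gramRatio h1 h1' h3.linearIndependent_pos).div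
        (SmoothAt.gramRatio h2 h2' h3.linearIndependent_neg) (h3.gramRatio_neg_ne_zero h3')
    · exact (h q hq.1).2.2.eq_smul (h' q hq.2).2.2

end BasicGerbe

/-! ### Smoothness of the section and of the action, and the general theorem -/

section Assembly

variable {H : Type u} [NormedAddCommGroup H] [InnerProductSpace ℂ H] [CompleteSpace H]
  {Γ : Subgroup (unitary (H →L[ℂ] H))} {V : Type*} [NormedAddCommGroup V] [NormedSpace ℝ V]
  {j : Γ → V}

lemma SmoothAt.clm_apply {X W : Type*} [NormedAddCommGroup W] [NormedSpace ℝ W] {c : X → W}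
    {T : X → H →L[ℂ] H} {v : X → H} {x : X} (hT : SmoothAt c T x) (hv : SmoothAt c v x) :
    SmoothAt c (fun x' => T x' (v x')) x :=
  ContDiff.comp_smoothAt (Φ := fun p : (H →L[ℂ] H) × H => p.1 p.2)
    ((isBoundedBilinearMap_apply (𝕜 := ℂ)).contDiff.restrict_scalars ℝ) (hT.prodMk hv)

lemma basicMul_smooth (hfd : ∀ (g : Γ) (z z' : Circle), z ≠ 1 → z' ≠ 1 →
    FiniteDimensional ℂ (eigenSum z z' (toOp Γ g))) {U₁ U₂ U₃ : Set (BasicY2 Γ)}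
    {σ₁ σ₂ σ₃ : ∀ q : BasicY2 Γ, BasicL q} (h₁ : IsBasicFrame j U₁ σ₁) (h₂ : IsBasicFrame j U₂ σ₂)
    (h₃ : IsBasicFrame j U₃ σ₃) :
    ∃ f : BasicY3 Γ → ℂ, ∀ t : BasicY3 Γ, t.p12 ∈ U₁ → t.p23 ∈ U₂ → t.p13 ∈ U₃ →
      SmoothAt (coord3 BasicY.g (BasicY.coord j)) f t ∧
        basicMul hfd t (σ₁ t.p12) (σ₂ t.p23) = f t • σ₃ t.p13 := by
  obtain ⟨-, d₁, e₁, u₁, w₁, h₁⟩ := isBasicFrame_iff.1 h₁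
  obtain ⟨-, d₂, e₂, u₂, w₂, h₂⟩ := isBasicFrame_iff.1 h₂
  obtain ⟨-, d₃, e₃, u₃, w₃, h₃⟩ := isBasicFrame_iff.1 h₃
  have s12 (t : BasicY3 Γ) : SmoothAt (coord3 BasicY.g (BasicY.coord j))
      (fun t : BasicY3 Γ => coord2 BasicY.g (BasicY.coord j) t.p12) t :=
    SmoothAt.of_contDiffAt (f := fun w : (ℂ × V) × (ℂ × V) × ℂ × V => (w.1, w.2.1)) (by fun_prop)
  have s23 (t : BasicY3 Γ) : SmoothAt (coord3 BasicY.g (BasicY.coord j))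
      (fun t : BasicY3 Γ => coord2 BasicY.g (BasicY.coord j) t.p23) t :=
    SmoothAt.of_contDiffAt (f := fun w : (ℂ × V) × (ℂ × V) × ℂ × V => (w.2.1, w.2.2)) (by fun_prop)
  have s13 (t : BasicY3 Γ) : SmoothAt (coord3 BasicY.g (BasicY.coord j))
      (fun t : BasicY3 Γ => coord2 BasicY.g (BasicY.coord j) t.p13) t :=
    SmoothAt.of_contDiffAt (f := fun w : (ℂ × V) × (ℂ × V) × ℂ × V => (w.1, w.2.2)) (by fun_prop)
  refine ⟨fun t => mulCoeff (fun i => u₁ i t.p12) (fun i => w₁ i t.p12) (fun i => u₂ i t.p23)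
    (fun i => w₂ i t.p23) (fun i => u₃ i t.p13) fun i => w₃ i t.p13,
    fun t ht₁ ht₂ ht₃ => ⟨?_, ?_⟩⟩
  · obtain ⟨a1, b1, c1⟩ := h₁ _ ht₁
    obtain ⟨a2, b2, c2⟩ := h₂ _ ht₂
    obtain ⟨a3, b3, c3⟩ := h₃ _ ht₃
    exact SmoothAt.mulCoeff (fun i => (a1 i).comp (s12 t)) (fun i => (b1 i).comp (s12 t))
      (fun i => (a2 i).comp (s23 t)) (fun i => (b2 i).comp (s23 t)) (fun i => (a3 i).comp (s13 t))
      (fun i => (b3 i).comp (s13 t)) (c1.linearIndependent_append hfd c2 c3)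
  · exact (h₁ _ ht₁).2.2.basicMul_eq hfd (h₂ _ ht₂).2.2 (h₃ _ ht₃).2.2

lemma IsSmoothRealization.smoothAt_smul (hj : IsSmoothRealization Γ j) {X W : Type*}
    [NormedAddCommGroup W] [NormedSpace ℝ W] {c : X → W} {k : X → ConjAct Γ} {g : X → Γ} {x : X}
    (hk : SmoothAt c (fun x => j (ConjAct.ofConjAct (k x))) x)
    (hg : SmoothAt c (fun x => j (g x)) x) : SmoothAt c (fun x => j (k x • g x)) x := by
  obtain ⟨C, hC, h⟩ := hj.exists_conj
  simp only [ConjAct.smul_def, h]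
  exact hC.comp_smoothAt (hk.prodMk hg)

/-- The coordinates on `Γ × Y^[2]`. -/
noncomputable def actCoord (j : Γ → V) (x : ConjAct Γ × BasicY2 Γ) : V × (ℂ × V) × ℂ × V :=
  (j (ConjAct.ofConjAct x.1), coord2 BasicY.g (BasicY.coord j) x.2)

/-- The coefficient of the action on `L` with respect to frames. -/
noncomputable def actCoeff {d e d' e' : ℕ} (u : Fin d → BasicY2 Γ → H) (w : Fin e → BasicY2 Γ → H)
    (u' : Fin d' → BasicY2 Γ → H) (w' : Fin e' → BasicY2 Γ → H) (x : ConjAct Γ × BasicY2 Γ) : ℂ :=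
  gramRatio (fun i => u' i (x.2.smul BasicY.g_smul x.1))
      (fun i => toOp Γ (ConjAct.ofConjAct x.1) (u i x.2)) /
    gramRatio (fun i => w' i (x.2.smul BasicY.g_smul x.1))
      (fun i => toOp Γ (ConjAct.ofConjAct x.1) (w i x.2))

/-- The frame translated by k is compared with a frame at the translated point. Both vary smoothly,
because k is an affine function of its coordinates and conjugation is smooth in coordinates. -/
lemma IsSmoothRealization.smoothAt_gramRatio_smul (hj : IsSmoothRealization Γ j) {d d' : ℕ}
    {u : Fin d → BasicY2 Γ → H} {u' : Fin d' → BasicY2 Γ → H} {x : ConjAct Γ × BasicY2 Γ}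
    (hu : ∀ i, SmoothAt (coord2 BasicY.g (BasicY.coord j)) (u i) x.2)
    (hu' : ∀ i, SmoothAt (coord2 BasicY.g (BasicY.coord j)) (u' i)
      (x.2.smul BasicY.g_smul x.1))
    (h : LinearIndependent ℂ fun i => u' i (x.2.smul BasicY.g_smul x.1)) :
    SmoothAt (actCoord j) (fun x => gramRatio (fun i => u' i (x.2.smul BasicY.g_smul x.1))
      (fun i => toOp Γ (ConjAct.ofConjAct x.1) (u i x.2))) x := by
  obtain ⟨T', hT', hT⟩ := hj.exists_contDiff
  have s1 : SmoothAt (actCoord j) (fun x => j (ConjAct.ofConjAct x.1)) x :=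
    SmoothAt.of_contDiffAt (f := fun w : V × (ℂ × V) × ℂ × V => w.1) contDiffAt_fst
  have s2 : SmoothAt (actCoord j) (fun x => coord2 BasicY.g (BasicY.coord j) x.2) x :=
    SmoothAt.of_contDiffAt (f := fun w : V × (ℂ × V) × ℂ × V => w.2) contDiffAt_snd
  have s3 : SmoothAt (actCoord j) (fun x => toOp Γ (ConjAct.ofConjAct x.1)) x := by
    simp only [hT]
    exact hT'.comp_smoothAt s1
  have p1 : SmoothAt (actCoord j) (fun x => (x.2.1.1.z : ℂ)) x :=
    SmoothAt.of_contDiffAt (f := fun w : V × (ℂ × V) × ℂ × V => w.2.1.1) (by fun_prop)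
  have p2 : SmoothAt (actCoord j) (fun x => j x.2.1.1.g) x :=
    SmoothAt.of_contDiffAt (f := fun w : V × (ℂ × V) × ℂ × V => w.2.1.2) (by fun_prop)
  have p3 : SmoothAt (actCoord j) (fun x => (x.2.1.2.z : ℂ)) x :=
    SmoothAt.of_contDiffAt (f := fun w : V × (ℂ × V) × ℂ × V => w.2.2.1) (by fun_prop)
  have p4 : SmoothAt (actCoord j) (fun x => j x.2.1.2.g) x :=
    SmoothAt.of_contDiffAt (f := fun w : V × (ℂ × V) × ℂ × V => w.2.2.2) (by fun_prop)
  have s4 : SmoothAt (actCoord j) (fun x => coord2 BasicY.g (BasicY.coord j)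
      (x.2.smul BasicY.g_smul x.1)) x :=
    (p1.prodMk (hj.smoothAt_smul s1 p2)).prodMk (p3.prodMk (hj.smoothAt_smul s1 p4))
  exact SmoothAt.gramRatio (u := fun i (x : ConjAct Γ × BasicY2 Γ) =>
    u' i (x.2.smul BasicY.g_smul x.1))
    (fun i => SmoothAt.comp (ψ := fun x : ConjAct Γ × BasicY2 Γ => x.2.smul BasicY.g_smul x.1)
      (x := x) (hu' i) s4)
    (fun i => s3.clm_apply (SmoothAt.comp (ψ := Prod.snd) (x := x) (hu i) s2)) h

lemma basicAct_smooth (hj : IsSmoothRealization Γ j) {U U' : Set (BasicY2 Γ)}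
    {σ σ' : ∀ q : BasicY2 Γ, BasicL q} (h : IsBasicFrame j U σ) (h' : IsBasicFrame j U' σ') :
    ∃ f : ConjAct Γ × BasicY2 Γ → ℂ, ∀ x : ConjAct Γ × BasicY2 Γ, x.2 ∈ U →
      x.2.smul BasicY.g_smul x.1 ∈ U' → SmoothAt (actCoord j) f x ∧
      basicAct x.1 x.2 (σ x.2) = f x • σ' (x.2.smul BasicY.g_smul x.1) :=
  (isBasicFrame_iff.1 h).2.elim fun _ h => h.elim fun _ h => h.elim fun u h => h.elim fun w h =>
  (isBasicFrame_iff.1 h').2.elim fun _ h' => h'.elim fun _ h' => h'.elim fun u' h' =>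
    h'.elim fun w' h' =>
  ⟨actCoeff u w u' w', fun x hx hx' =>
    ⟨(hj.smoothAt_gramRatio_smul (h _ hx).1 (h' _ hx').1
        (h' _ hx').2.2.linearIndependent_pos).div
      (hj.smoothAt_gramRatio_smul (h _ hx).2.1 (h' _ hx').2.1
        (h' _ hx').2.2.linearIndependent_neg)
      ((h' _ hx').2.2.gramRatio_neg_ne_zero ((h _ hx).2.2.smul x.1)),
    (h' _ hx').2.2.eq_smul ((h _ hx).2.2.smul x.1)⟩⟩

/-- The local section keeps z fixed; it stays in Y near the given point because invertibility of z -
g is an open condition. -/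
lemma BasicY.exists_section (hj : IsSmoothRealization Γ j) (y : BasicY Γ) :
    ∃ r : Γ → BasicY Γ, r y.g = y ∧ ∀ᶠ m in nhdsVia j y.g, (r m).g = m ∧
      SmoothAt j (fun m' => BasicY.coord j (r m')) m := by
  classical
  obtain ⟨T', hT', hT⟩ := hj.exists_contDiff
  let r (m : Γ) : BasicY Γ :=
    -- The value y away from that neighbourhood is only a default.
    if h : (y.z : ℂ) ∉ spectrum ℂ (toOp Γ m) then ⟨(y.z, m), y.2.1, h⟩ else y
  have hr {m : Γ} (h : (y.z : ℂ) ∉ spectrum ℂ (toOp Γ m)) : r m = ⟨(y.z, m), y.2.1, h⟩ := dif_pos h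
  have hu : ∀ᶠ v in 𝓝 (j y.g), IsUnit (algebraMap ℂ (H →L[ℂ] H) y.z - T' v) := by
    refine (continuous_const.sub hT'.continuous).continuousAt.eventually
      (Units.isOpen.mem_nhds ?_)
    show IsUnit (algebraMap ℂ (H →L[ℂ] H) y.z - T' (j y.g))
    rw [← hT]
    exact spectrum.notMem_iff.1 y.2.2
  obtain ⟨U, hyU, hU, hUp⟩ := exists_isOpenVia_of_eventually hu
  have hU' {m : Γ} (hm : m ∈ U) : (y.z : ℂ) ∉ spectrum ℂ (toOp Γ m) := by
    rw [spectrum.notMem_iff, hT]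
    exact hUp m hm
  refine ⟨r, hr (hU' hyU), ?_⟩
  filter_upwards [hU _ hyU] with m hm
  refine ⟨by rw [hr (hU' hm)]; rfl, ?_⟩
  refine (SmoothAt.of_contDiffAt (f := fun v : V => ((y.z : ℂ), v)) (by fun_prop)).congr ?_
  filter_upwards [hU _ hm] with m' hm'
  rw [hr (hU' hm')]
  rfl

lemma isBundleGerbe_basicGerbe [TopologicalSpace.SeparableSpace H] (hj : IsSmoothRealization Γ j) :
    (basicGerbe j (basicMul hj.finiteDimensional)).IsBundleGerbe j (BasicY.coord j) where
  surjective g := by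
    obtain ⟨z, hz, hs, -⟩ := exists_notMem_spectrum (g : unitary (H →L[ℂ] H)).2
      (hj.isCompactOperator g) le_rfl Real.two_pi_pos le_rfl
    exact ⟨⟨(z, g), hz, hs⟩, rfl⟩
  smooth y := SmoothAt.of_contDiffAt (f := fun w : ℂ × V => w.2) contDiffAt_snd
  submersion := BasicY.exists_section hj
  lineBundle := isSmoothLineBundle_basicL hj
  s_ne_zero := basicMul_ne_zero hj.finiteDimensional
  s_smooth _ _ _ _ _ _ := basicMul_smooth hj.finiteDimensional
  assoc := basicMul_assoc hj.finiteDimensional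

/-- The basic bundle gerbe is equivariant. -/
theorem IsSmoothRealization.basicGerbeEquivariant [TopologicalSpace.SeparableSpace H]
    (hj : IsSmoothRealization Γ j) : BasicGerbeEquivariant Γ j := by
  refine ⟨basicMul hj.finiteDimensional, isBasicSection_basicMul hj.finiteDimensional,
    fun s' hs' => hs'.eq_basicMul hj.finiteDimensional, ?_⟩
  exact
    { isBundleGerbe := isBundleGerbe_basicGerbe hj
      smooth_base := fun x => hj.smoothAt_smul
        (SmoothAt.of_contDiffAt (f := fun w : V × V => w.1) contDiffAt_fst)
        (SmoothAt.of_contDiffAt (f := fun w : V × V => w.2) contDiffAt_snd)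
      smooth_total := fun x => SmoothAt.prodMk
        (SmoothAt.of_contDiffAt (f := fun w : V × ℂ × V => w.2.1) (by fun_prop))
        (hj.smoothAt_smul
          (SmoothAt.of_contDiffAt (f := fun w : V × ℂ × V => w.1) contDiffAt_fst)
          (SmoothAt.of_contDiffAt (f := fun w : V × ℂ × V => w.2.2) (by fun_prop)))
      act_one := basicAct_one
      act_mul := basicAct_mul
      act_smooth := fun _ _ _ _ => basicAct_smooth hj
      s_equivariant := basicMul_smul hj.finiteDimensional }

end Assembly

/-! ### The Schatten ideals -/

section Schatten

variable {H : Type u} [NormedAddCommGroup H] [InnerProductSpace ℂ H]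

lemma enorm_inner_le_schattenENorm {p : ℝ} (hp : 1 ≤ p) (A : H →L[ℂ] H) {v w : H} (hv : ‖v‖ = 1)
    (hw : ‖w‖ = 1) : ‖⟪w, A v⟫_ℂ‖ₑ ≤ schattenENorm p A := by
  have on {v : H} (hv : ‖v‖ = 1) : Orthonormal ℂ (fun _ : Fin 1 => v) :=
    ⟨fun _ => hv, fun i j hij => absurd (Subsingleton.elim i j) hij⟩
  have h := le_schattenENorm p A (on hv) (on hw)
  rwa [Finset.univ_unique, Finset.sum_singleton, ← ENNReal.rpow_mul,
    mul_one_div_cancel (by linarith), ENNReal.rpow_one] at h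

/-- A bound for an operator by its matrix coefficients with respect to unit vectors. -/
lemma norm_apply_le_of_inner_le {A : H →L[ℂ] H} {C : ℝ} {v : H}
    (h : ∀ w : H, ‖w‖ = 1 → ‖⟪w, A v⟫_ℂ‖ ≤ C * ‖v‖) (hC : 0 ≤ C) : ‖A v‖ ≤ C * ‖v‖ := by
  rcases eq_or_ne (A v) 0 with h0 | h0
  · rw [h0, norm_zero]; positivity
  have h1 := h (((‖A v‖⁻¹ : ℝ) : ℂ) • A v) (by
    rw [norm_smul, Complex.norm_real, norm_inv, norm_norm, inv_mul_cancel₀ (norm_ne_zero_iff.2 h0)])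
  rw [inner_smul_left, norm_mul, inner_self_eq_norm_sq_to_K, norm_pow] at h1
  simp only [Complex.conj_ofReal, Complex.norm_real, norm_inv, norm_norm, Complex.coe_algebraMap]
    at h1
  rwa [sq, inv_mul_cancel_left₀ (norm_ne_zero_iff.2 h0)] at h1

lemma norm_inner_smul_eq {v w : H} (A : H →L[ℂ] H) (hv : v ≠ 0) :
    ‖⟪w, A v⟫_ℂ‖ = ‖⟪w, A (((‖v‖⁻¹ : ℝ) : ℂ) • v)⟫_ℂ‖ * ‖v‖ := by
  rw [map_smul, inner_smul_right, norm_mul, Complex.norm_real, norm_inv, norm_norm, mul_right_comm,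
    inv_mul_cancel₀ (norm_ne_zero_iff.2 hv), one_mul]

lemma norm_inv_norm_smul {v : H} (hv : v ≠ 0) : ‖((‖v‖⁻¹ : ℝ) : ℂ) • v‖ = 1 := by
  rw [norm_smul, Complex.norm_real, norm_inv, norm_norm, inv_mul_cancel₀ (norm_ne_zero_iff.2 hv)]

/-- Orthonormal families of length one already bound all matrix coefficients between unit vectors.
-/
lemma opNorm_le_schattenENorm {p : ℝ} (hp : 1 ≤ p) {A : H →L[ℂ] H} (hA : schattenENorm p A ≠ ⊤) :
    ‖A‖ ≤ (schattenENorm p A).toReal := by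
  refine A.opNorm_le_bound ENNReal.toReal_nonneg fun v =>
    norm_apply_le_of_inner_le (fun w hw => ?_) ENNReal.toReal_nonneg
  rcases eq_or_ne v 0 with rfl | hv
  · simp
  rw [norm_inner_smul_eq A hv]
  gcongr
  rw [← toReal_enorm]
  exact ENNReal.toReal_mono hA (enorm_inner_le_schattenENorm hp A (norm_inv_norm_smul hv) hw)

section Ideal

lemma schattenENorm_sum_le {ι : Type*} {p : ℝ} (hp : 1 ≤ p) (s : Finset ι) (A : ι → H →L[ℂ] H) :
    schattenENorm p (∑ i ∈ s, A i) ≤ ∑ i ∈ s, schattenENorm p (A i) := by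
  classical
  induction s using Finset.induction_on with
  | empty => simp [schattenENorm_zero hp]
  | insert i s hi h =>
    rw [Finset.sum_insert hi, Finset.sum_insert hi]
    exact (schattenENorm_add hp _ _).trans (add_le_add le_rfl h)

lemma schattenENorm_sum_smul_le {p : ℝ} (hp : 1 ≤ p) {B : H →L[ℂ] H} {C : ℝ≥0∞}
    {c : Fin 4 → ℂ} (hc : ∀ i, ‖c i‖ ≤ ‖B‖ / 2) {D : Fin 4 → H →L[ℂ] H}
    (hD : ∀ i, schattenENorm p (D i) ≤ C) :
    schattenENorm p (∑ i, c i • D i) ≤ ENNReal.ofReal (2 * ‖B‖) * C := by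
  have h (i : Fin 4) : schattenENorm p (c i • D i) ≤ ENNReal.ofReal (‖B‖ / 2) * C := by
    rw [schattenENorm_smul hp, ← ofReal_norm]
    exact mul_le_mul' (ENNReal.ofReal_le_ofReal (hc i)) (hD i)
  refine (schattenENorm_sum_le hp _ _).trans ((Finset.sum_le_sum fun i _ => h i).trans_eq ?_)
  rw [Finset.sum_const, Finset.card_univ, Fintype.card_fin, ← smul_mul_assoc, nsmul_eq_mul,
    Nat.cast_ofNat, ← ENNReal.ofReal_ofNat 4, ← ENNReal.ofReal_mul (by norm_num)]
  congr 2
  ring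

variable [CompleteSpace H]

/-- A bounded operator is a combination of four unitaries with coefficients at most ‖B‖ / 2, and
multiplication by a unitary does not increase the Schatten norm. The resulting constant 2 is not
optimal, but continuity of the multiplication is all that is needed. -/
lemma schattenENorm_mul_le_left {p : ℝ} (hp : 1 ≤ p) (B A : H →L[ℂ] H) :
    schattenENorm p (B * A) ≤ ENNReal.ofReal (2 * ‖B‖) * schattenENorm p A := by
  obtain ⟨u, c, hB, hc⟩ := CStarAlgebra.exists_sum_four_unitary B
  have e : B * A = ∑ i, c i • ((u i : H →L[ℂ] H) * A) := by
    conv_lhs => rw [hB]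
    rw [Finset.sum_mul]
    simp only [smul_mul_assoc]
  rw [e]
  exact schattenENorm_sum_smul_le hp hc fun i => schattenENorm_unitary_mul p A (u i)

lemma schattenENorm_mul_le_right {p : ℝ} (hp : 1 ≤ p) (B A : H →L[ℂ] H) :
    schattenENorm p (A * B) ≤ ENNReal.ofReal (2 * ‖B‖) * schattenENorm p A := by
  obtain ⟨u, c, hB, hc⟩ := CStarAlgebra.exists_sum_four_unitary B
  have e : A * B = ∑ i, c i • (A * (u i : H →L[ℂ] H)) := by
    conv_lhs => rw [hB]
    rw [Finset.mul_sum]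
    simp only [mul_smul_comm]
  rw [e]
  exact schattenENorm_sum_smul_le hp hc fun i => schattenENorm_mul_unitary p A (u i)

end Ideal

/-! ### Compactness of Schatten class operators -/

section Compactness

lemma isCompactOperator_starProjection (K : Submodule ℂ H) [FiniteDimensional ℂ K] :
    IsCompactOperator (K.starProjection : H → H) := by
  have h : IsCompactOperator (id : K → K) :=
    (isCompactOperator_id_iff_finiteDimensional (𝕜 := ℂ)).2 inferInstance
  exact (h.comp_clm K.orthogonalProjectionOnto).clm_comp K.subtypeL

/-- Otherwise orthonormal families could be extended indefinitely with all coefficients ⟨fᵢ, A eᵢ⟩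
of modulus at least ε, so that n ε^p would be bounded by the finite number ‖A‖_p^p for every n. -/
lemma exists_maximal_orthonormal_pair {p : ℝ} (hp : 1 ≤ p) {A : H →L[ℂ] H}
    (hA : schattenENorm p A ≠ ⊤) {ε : ℝ} (hε : 0 < ε) :
    ∃ (n : ℕ) (e f : Fin n → H), ∀ v w : H, ‖v‖ = 1 → ‖w‖ = 1 → (∀ i, ⟪v, e i⟫_ℂ = 0) →
      (∀ i, ⟪w, f i⟫_ℂ = 0) → ‖⟪w, A v⟫_ℂ‖ ≤ ε := by
  by_contra! hcon
  have key (n : ℕ) : ∃ e f : Fin n → H, Orthonormal ℂ e ∧ Orthonormal ℂ f ∧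
      ∀ i, ε ≤ ‖⟪f i, A (e i)⟫_ℂ‖ := by
    induction n with
    | zero => exact ⟨Fin.elim0, Fin.elim0, ⟨fun i => i.elim0, fun i => i.elim0⟩,
        ⟨fun i => i.elim0, fun i => i.elim0⟩, fun i => i.elim0⟩
    | succ n ih =>
      obtain ⟨e, f, he, hf, h⟩ := ih
      obtain ⟨v, w, hv, hw, hve, hwf, hvw⟩ := hcon n e f
      refine ⟨Matrix.vecCons v e, Matrix.vecCons w f, orthonormal_vecCons_iff.2 ⟨hv, hve, he⟩,
        orthonormal_vecCons_iff.2 ⟨hw, hwf, hf⟩, fun i => ?_⟩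
      refine Fin.cases ?_ (fun i => ?_) i
      · exact hvw.le
      · exact h i
  have hp0 : 0 < p := by linarith
  obtain ⟨n, hn⟩ := ENNReal.exists_nat_mul_gt (a := ENNReal.ofReal ε ^ p)
    (b := schattenENorm p A ^ p) (ENNReal.rpow_pos (ENNReal.ofReal_pos.2 hε)
      ENNReal.ofReal_ne_top).ne' (ENNReal.rpow_ne_top_of_nonneg hp0.le hA)
  obtain ⟨e, f, he, hf, h⟩ := key n
  refine hn.not_ge (le_trans ?_ (ENNReal.rpow_le_rpow (le_schattenENorm p A he hf) hp0.le))
  rw [← ENNReal.rpow_mul, one_div_mul_cancel hp0.ne', ENNReal.rpow_one]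
  calc (n : ℝ≥0∞) * ENNReal.ofReal ε ^ p = ∑ _i : Fin n, ENNReal.ofReal ε ^ p := by
        rw [Finset.sum_const, Finset.card_univ, Fintype.card_fin, nsmul_eq_mul]
    _ ≤ _ := Finset.sum_le_sum fun i _ => ENNReal.rpow_le_rpow (by
        rw [← ofReal_norm]
        exact ENNReal.ofReal_le_ofReal (h i)) hp0.le

/-- The operators in the Schatten ideals are compact. -/
lemma isCompactOperator_of_schattenENorm_ne_top [CompleteSpace H] {p : ℝ} (hp : 1 ≤ p) {A : H →L[ℂ] H}
    (hA : schattenENorm p A ≠ ⊤) : IsCompactOperator A := by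
  have hcl : IsClosed {B : H →L[ℂ] H | IsCompactOperator B} :=
    isClosed_setOfPred_isCompactOperator
  refine hcl.closure_subset (Metric.mem_closure_iff.2 fun ε hε => ?_)
  obtain ⟨n, e, f, h⟩ := exists_maximal_orthonormal_pair hp hA (half_pos hε)
  have hfin {m : ℕ} (g : Fin m → H) : FiniteDimensional ℂ (Submodule.span ℂ (Set.range g)) :=
    FiniteDimensional.span_of_finite ℂ (Set.finite_range g)
  let P := (Submodule.span ℂ (Set.range e)).starProjection
  let Q := (Submodule.span ℂ (Set.range f)).starProjection
  have hP : IsCompactOperator P := isCompactOperator_starProjection _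
  have hQ : IsCompactOperator Q := isCompactOperator_starProjection _
  -- With P and Q the projections onto the spans of e and f, this finite-rank operator differs from
  -- A by (1 - Q) A (1 - P), whose matrix coefficients are controlled by the maximality of the pair.
  refine ⟨Q ∘L A + ((1 - Q) ∘L A) ∘L P, ?_, ?_⟩
  · have hcomp {B C : H →L[ℂ] H} (h : IsCompactOperator C) : IsCompactOperator (B ∘L C) :=
      h.clm_comp B
    exact IsCompactOperator.add (f := Q ∘L A) (hQ.comp_clm A) (hcomp hP)
  have e1 : A - (Q ∘L A + ((1 - Q) ∘L A) ∘L P) = ((1 - Q) ∘L A) ∘L (1 - P) := by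
    ext v
    simp only [sub_apply, add_apply, ContinuousLinearMap.comp_apply, one_apply_eq_self, map_sub]
    abel
  rw [dist_eq_norm, e1]
  refine lt_of_le_of_lt (ContinuousLinearMap.opNorm_le_bound _ (half_pos hε).le fun v => ?_)
    (half_lt_self hε)
  have hperp {m : ℕ} (g : Fin m → H) (x : H) (i : Fin m) :
      ⟪x - (Submodule.span ℂ (Set.range g)).starProjection x, g i⟫_ℂ = 0 :=
    Submodule.starProjection_inner_eq_zero _ _ (Submodule.subset_span ⟨i, rfl⟩)
  have hcontr : ‖v - P v‖ ≤ ‖v‖ := by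
    have h1 := Submodule.norm_sq_eq_add_norm_sq_starProjection v (Submodule.span ℂ (Set.range e))
    rw [Submodule.starProjection_orthogonal_val] at h1
    nlinarith [norm_nonneg v, norm_nonneg (v - P v), sq_nonneg ‖P v‖]
  show ‖A (v - P v) - Q (A (v - P v))‖ ≤ ε / 2 * ‖v‖
  refine le_trans ?_ (mul_le_mul_of_nonneg_left hcontr (half_pos hε).le)
  set x := v - P v with hx
  set w := A x - Q (A x) with hw
  rcases eq_or_ne w 0 with hw0 | hw0
  · rw [hw0, norm_zero]; positivity
  have hx0 : x ≠ 0 := fun h0 => hw0 (by rw [hw, h0, map_zero, map_zero, sub_zero])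
  have h1 := h (((‖x‖⁻¹ : ℝ) : ℂ) • x) (((‖w‖⁻¹ : ℝ) : ℂ) • w) (norm_inv_norm_smul hx0)
    (norm_inv_norm_smul hw0) (fun i => by rw [inner_smul_left, hx, hperp, mul_zero])
    (fun i => by rw [inner_smul_left, hw, hperp, mul_zero])
  -- Since w = (1 - Q) A x, the coefficient of A between the normalised x and w is ‖w‖ / ‖x‖.
  have h2 : ⟪w, A x⟫_ℂ = ⟪w, w⟫_ℂ := by
    have h3 : ⟪w, Q (A x)⟫_ℂ = 0 := Submodule.starProjection_inner_eq_zero _ _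
      (Submodule.starProjection_apply_mem _ _)
    conv_rhs => rw [hw, inner_sub_right, ← hw, h3, sub_zero]
  rw [map_smul, inner_smul_right, inner_smul_left, h2, inner_self_eq_norm_sq_to_K, norm_mul,
    norm_mul, norm_pow] at h1
  simp only [Complex.conj_ofReal, Complex.norm_real, norm_inv, norm_norm, Complex.coe_algebraMap]
    at h1
  rw [sq, inv_mul_cancel_left₀ (norm_ne_zero_iff.2 hw0), inv_mul_le_iff₀ (norm_pos_iff.2 hx0)] at h1
  linarith

end Compactness

end Schatten

/-! ### The three families of groups -/

section Realizations

variable {H : Type u} [NormedAddCommGroup H] [InnerProductSpace ℂ H] [CompleteSpace H]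

lemma coe_inv_eq_star {Γ : Subgroup (unitary (H →L[ℂ] H))} (k : Γ) :
    toOp Γ k⁻¹ = star (toOp Γ k) := rfl

lemma coe_mul_mul_inv {Γ : Subgroup (unitary (H →L[ℂ] H))} (k g : Γ) :
    toOp Γ (k * g * k⁻¹) = toOp Γ k * toOp Γ g * star (toOp Γ k) := rfl

/-- In finite dimensions any subgroup qualifies, which covers the full unitary group and the torus
at once. -/
lemma isSmoothRealization_toOp [FiniteDimensional ℂ H] (Γ : Subgroup (unitary (H →L[ℂ] H))) :
    IsSmoothRealization Γ (toOp Γ) where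
  isCompactOperator g := by
    have h : IsCompactOperator (id : H → H) :=
      (isCompactOperator_id_iff_finiteDimensional (𝕜 := ℂ)).2 inferInstance
    exact h.clm_comp (toOp Γ g - 1)
  exists_affine := ⟨0, ContinuousLinearMap.id ℝ _, fun g => (zero_add _).symm⟩
  exists_conj := by
    refine ⟨fun w => w.1 * w.2 * star w.1, ?_, coe_mul_mul_inv⟩
    have h : ContDiff ℝ ∞ (star : (H →L[ℂ] H) → H →L[ℂ] H) :=
      (starL' ℝ : (H →L[ℂ] H) ≃L[ℝ] H →L[ℂ] H).contDiff
    exact (contDiff_fst.mul contDiff_snd).mul (h.comp contDiff_fst)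

variable (H) in
/-- The inclusion of the Schatten ideal in the bounded operators. -/
noncomputable def schattenInclusion (p : ℝ) [Fact (1 ≤ p)] : SchattenClass H p →L[ℝ] H →L[ℂ] H :=
  LinearMap.mkContinuous
    { toFun := fun A => A.1
      map_add' := fun _ _ => rfl
      map_smul' := fun _ _ => rfl } 1 fun A => by
    rw [one_mul]
    exact opNorm_le_schattenENorm Fact.out ((mem_schattenSubmodule H).1 A.2).ne

/-- Multiplication of elements of the Schatten ideal by bounded operators from the left. -/
noncomputable def schattenMulLeft (p : ℝ) [Fact (1 ≤ p)] :
    (H →L[ℂ] H) →L[ℝ] SchattenClass H p →L[ℝ] SchattenClass H p :=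
  LinearMap.mkContinuous₂ (LinearMap.mk₂ ℝ
    (fun B A => (⟨B * A.1, (schattenENorm_mul_le_left Fact.out B A.1).trans_lt
      (ENNReal.mul_lt_top ENNReal.ofReal_lt_top A.2)⟩ : SchattenClass H p))
    (fun _ _ _ => Subtype.ext (add_mul _ _ _)) (fun _ _ _ => Subtype.ext (smul_mul_assoc _ _ _))
    (fun _ _ _ => Subtype.ext (mul_add _ _ _)) (fun _ _ _ => Subtype.ext (mul_smul_comm _ _ _)))
    2 fun B A => by
    refine (ENNReal.toReal_mono (ENNReal.mul_lt_top ENNReal.ofReal_lt_top A.2).ne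
      (schattenENorm_mul_le_left Fact.out B A.1)).trans_eq ?_
    rw [ENNReal.toReal_mul, ENNReal.toReal_ofReal (by positivity)]
    rfl

/-- Multiplication of elements of the Schatten ideal by bounded operators from the right. -/
noncomputable def schattenMulRight (p : ℝ) [Fact (1 ≤ p)] :
    (H →L[ℂ] H) →L[ℝ] SchattenClass H p →L[ℝ] SchattenClass H p :=
  LinearMap.mkContinuous₂ (LinearMap.mk₂ ℝ
    (fun B A => (⟨A.1 * B, (schattenENorm_mul_le_right Fact.out B A.1).trans_lt
      (ENNReal.mul_lt_top ENNReal.ofReal_lt_top A.2)⟩ : SchattenClass H p))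
    (fun _ _ _ => Subtype.ext (mul_add _ _ _)) (fun _ _ _ => Subtype.ext (mul_smul_comm _ _ _))
    (fun _ _ _ => Subtype.ext (add_mul _ _ _)) (fun _ _ _ => Subtype.ext (smul_mul_assoc _ _ _)))
    2 fun B A => by
    refine (ENNReal.toReal_mono (ENNReal.mul_lt_top ENNReal.ofReal_lt_top A.2).ne
      (schattenENorm_mul_le_right Fact.out B A.1)).trans_eq ?_
    rw [ENNReal.toReal_mul, ENNReal.toReal_ofReal (by positivity)]
    rfl

/-- Conjugation in the coordinates is k g k⁻¹ - 1 = k (g - 1) k*. With k replaced by 1 plus its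
coordinate, the right side extends to a smooth map on all pairs in ℒ_p. -/
lemma isSmoothRealization_schattenUnitary (p : ℝ) [Fact (1 ≤ p)] :
    IsSmoothRealization (schattenUnitary H p) (schattenUnitary.coord H p) where
  isCompactOperator g := isCompactOperator_of_schattenENorm_ne_top (p := p) Fact.out
    ((mem_schattenSubmodule H).1 g.2).ne
  exists_affine := ⟨1, schattenInclusion H p, fun g => (add_sub_cancel 1 (toOp _ g)).symm⟩
  exists_conj := by
    refine ⟨fun w => schattenMulRight p (star (1 + schattenInclusion H p w.1))
      (schattenMulLeft p (1 + schattenInclusion H p w.1) w.2), ?_, fun k g => ?_⟩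
    · have h : ContDiff ℝ ∞ (star : (H →L[ℂ] H) → H →L[ℂ] H) :=
        (starL' ℝ : (H →L[ℂ] H) ≃L[ℝ] H →L[ℂ] H).contDiff
      have h1 : ContDiff ℝ ∞ fun w : SchattenClass H p × SchattenClass H p =>
          1 + schattenInclusion H p w.1 := by fun_prop
      exact ((schattenMulRight p).contDiff.comp (h.comp h1)).clm_apply
        (((schattenMulLeft p).contDiff.comp h1).clm_apply contDiff_snd)
    · refine Subtype.ext ?_
      have e : 1 + schattenInclusion H p (schattenUnitary.coord H p k) =
        toOp (schattenUnitary H p) k := add_sub_cancel 1 (toOp _ k)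
      show toOp (schattenUnitary H p) (k * g * k⁻¹) - 1 =
        (1 + schattenInclusion H p (schattenUnitary.coord H p k)) *
          (toOp (schattenUnitary H p) g - 1) *
          star (1 + schattenInclusion H p (schattenUnitary.coord H p k))
      rw [e, coe_mul_mul_inv, mul_sub, sub_mul, mul_one, ← coe_inv_eq_star, toOp_mul_inv]

end Realizations

theorem mainTheorem5 :
    (∀ (H : Type u) [NormedAddCommGroup H] [InnerProductSpace ℂ H] [CompleteSpace H]
      [FiniteDimensional ℂ H], BasicGerbeEquivariant (fullUnitary H) (fullUnitary.coord H)) ∧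
    (∀ n : ℕ, BasicGerbeEquivariant (diagTorus n) (diagTorus.coord n)) ∧
    (∀ (H : Type u) [NormedAddCommGroup H] [InnerProductSpace ℂ H] [CompleteSpace H]
      [TopologicalSpace.SeparableSpace H] (p : ℝ) [Fact (1 ≤ p)], ¬ FiniteDimensional ℂ H →
      BasicGerbeEquivariant (schattenUnitary H p) (schattenUnitary.coord H p)) := by
  refine ⟨fun H _ _ _ _ => ?_, fun n => ?_, fun H _ _ _ _ p _ _ => ?_⟩
  -- A finite-dimensional space is proper, hence separable, as the general theorem requires.
  · have := FiniteDimensional.proper ℂ H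
    exact (isSmoothRealization_toOp (fullUnitary H)).basicGerbeEquivariant
  · have := FiniteDimensional.proper ℂ (EuclideanSpace ℂ (Fin n))
    exact (isSmoothRealization_toOp (diagTorus n)).basicGerbeEquivariant
  · exact (isSmoothRealization_schattenUnitary p).basicGerbeEquivariant
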